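/- Setting. Let $D$ be a finite-dimensional real Lie group with Lie algebra $\mathcal D$ carrying a symmetric, non-degenerate, $\mathrm{Ad}_D$-invariant bilinear form $\langle\cdot|\cdot\rangle$, and let $G,\hat G\subset D$ be (immersed) Lie subgroups whose Lie algebras $\mathcal G,\hat{\mathcal G}$ are isotropic and satisfy $\mathcal D=\mathcal G\oplus\hat{\mathcal G}$. Assume that $D$ is a perfect Drinfeld double: every $l\in D$ is uniquely $l=g\hat h$ with $g\in G$, $\hat h\in\hat G$ (hence also uniquely $l=\hat g h$). Let $J,\hat J$ be the projections of $\mathcal D$ onto $\mathcal G$ along $\hat{\mathcal G}$ and onto $\hat{\mathcal G}$ along $\mathcal G$, and put $\Pi^g=J\,\mathrm{Ad}_g\,J\,\mathrm{Ad}_{g^{-1}}\hat J:\hat{\mathcal G}\to\mathcal G$ for $g\in G$, and $\hat\Pi^{\hat g}=\hat J\,\mathrm{Ad}_{\hat g}\,\hat J\,\mathrm{Ad}_{\hat g^{-1}}J:\mathcal G\to\hat{\mathcal G}$ for $\hat g\in\hat G$. Let $F$ be an (immersed) Lie subgroup of $D$. It acts on $G$ by the dressing action: $f\rhd g$ is the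 factor in $G$ of $fg=(f\rhd g)\hat h$; and on $\hat G$ by: $f\rhd\hat g$ is the factor in $\hat G$ of $f\hat g=(f\rhd\hat g)h$. Fields are smooth maps on the world-sheet $\mathbb R^2$ with coordinates $(\tau,\sigma)$, and $\partial_\pm=\partial_\tau\pm\partial_\sigma$. A gauge transformation supported in a compact set $K\subset\mathbb R^2$ is a smooth $f:\mathbb R^2\to F$ with $f=1$ off $K$ that is connected to the constant map $1$ by a smooth homotopy through maps equal to $1$ off $K$ (for example $f=e^{\epsilon}$, with $\epsilon$ smooth, Lie$(F)$-valued and zero off $K$). Gauge invariance. Consider a $\sigma$-model on $G$ with action $S_K(g)=\frac12\int_K\ell_g(\partial_-gg^{-1},\partial_+gg^{-1})\,d\tau d\sigma$, where $\ell_g$ is a bilinear form on $\mathcal G$ defined for $g$ in a subset $G^{\rm adm}\subset G$. We call it gauge invariant under the dressing action of $F$ if: (a) for $f\in F$, $f\rhd g\in G^{\rm adm}$ if and only if $g\in G^{\rm adm}$; (b) for all smooth $f:\mathbb R^2\to F$ and $g:\mathbb R^2\to G$, the field $f\rhd g$ is smooth and defines the same field with values in the orbit space $F\backslash G$ as $g$;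 (c) for every compact $K$, every gauge transformation $f$ supported in $K$ and every field $g$ with $g(K)\subset G^{\rm adm}$, the Lagrangians of $g$ and of $f\rhd g$ are integrable on $K$ and $S_K(f\rhd g)=S_K(g)$; (d) the target metric $v\mapsto\ell_g(v,v)$ satisfies $\ell_{f\rhd g}(v',v')=\ell_g(v,v)$, at each point at which $g\in G^{\rm adm}$, for all smooth $f,g$ and every derivative $\partial_u$ on the world-sheet, where $v=\partial_ug\,g^{-1}$ and $v'=\partial_u(f\rhd g)(f\rhd g)^{-1}$. In this sense the target space is $F\backslash G$. The same definition, with the roles of $G$ and $\hat G$ exchanged, is used on $\hat G$ and $F\backslash\hat G$. All adjoints below are with respect to $\langle\cdot|\cdot\rangle$. (1) Standard dressing cosets. Let $R:\hat{\mathcal G}\to\mathcal G$ be linear and invertible with adjoint $R^*:\hat{\mathcal G}\to\mathcal G$; suppose that the Lie algebra of $F$ is $\mathcal F=\{\gamma+R\gamma:\gamma\in\mathrm{Ker}(R+R^*)\}$ and that $$J\mathrm{Ad}_f\hat J+J[\mathrm{Ad}_f,R]\hat J=R\,\mathrm{Ad}_fR\quad\text{on }\hat{\mathcal G},\text{ for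 all }f\in F,$$ that is, $J\mathrm{Ad}_fx+J\mathrm{Ad}_fRx-R\hat J\mathrm{Ad}_fx=R\hat J\mathrm{Ad}_fRx$. Then the model $S(g)=\frac12\int\langle\partial_-gg^{-1}|(R+\Pi^g)^{-1}\partial_+gg^{-1}\rangle$ on $G$ and the dual model $S(\hat g)=\frac12\int\langle\partial_-\hat g\hat g^{-1}|(R^{-1}+\hat\Pi^{\hat g})^{-1}\partial_+\hat g\hat g^{-1}\rangle$ on $\hat G$, defined where $R+\Pi^g$, respectively $R^{-1}+\hat\Pi^{\hat g}$, is invertible, are gauge invariant under $F$. (2) Generalized dressing cosets. Let $R:\mathrm{Dom}R\to\mathcal G$ and $\hat R:\mathrm{Dom}\hat R\to\hat{\mathcal G}$ be linear, with $\mathrm{Dom}R\subset\hat{\mathcal G}$ and $\mathrm{Dom}\hat R\subset\mathcal G$ linear subspaces, and with adjoints $R^*:\mathrm{Dom}R\to\mathrm{Im}R$ and $\hat R^*:\mathrm{Dom}\hat R\to\mathrm{Im}\hat R$, such that: $\mathrm{Ker}R=\mathrm{Ker}R^*$ and $\mathrm{Ker}\hat R=\mathrm{Ker}\hat R^*$;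 $\mathrm{Im}\hat R\subset\mathrm{Dom}R$, $\mathrm{Im}R\subset\mathrm{Dom}\hat R$ and $(R|_{\mathrm{Im}\hat R})^{-1}=\hat R|_{\mathrm{Im}R}$; $\mathrm{Dom}R$ is the annihilator of $\mathrm{Ker}\hat R$ in $\hat{\mathcal G}$ and $\mathrm{Dom}\hat R$ that of $\mathrm{Ker}R$ in $\mathcal G$; and the form is non-degenerate on $\mathrm{Im}R\oplus\mathrm{Im}\hat R$. Suppose that the Lie algebra of $F$ is $\mathrm{Ker}\hat R\oplus\{\gamma+R\gamma:\gamma\in\mathrm{Ker}(R+R^*)\}$ and that, for all $f\in F$, the condition of (1) holds for $R$ on $\mathrm{Dom}R$, and the condition $\hat J\mathrm{Ad}_fJ+\hat J[\mathrm{Ad}_f,\hat R]J=\hat R\,\mathrm{Ad}_f\hat R$ holds on $\mathrm{Dom}\hat R$; explicitly, for $x\in\mathrm{Dom}R$, $\hat J\mathrm{Ad}_f(x+Rx)\in\mathrm{Dom}R$ and $J\mathrm{Ad}_f(x+Rx)=R\hat J\mathrm{Ad}_f(x+Rx)$, and similarly for $\hat R$ with $J,\hat J$ exchanged. Let $\rho$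 be a projector of $\mathcal G$ onto $\mathrm{Im}R\oplus\hat{\mathcal A}$ with kernel $\mathrm{Ker}\hat R$, where $\hat{\mathcal A}$ is a complement of $\mathrm{Dom}\hat R$ in $\mathcal G$, and let $\tilde\rho$ be a projector of $\hat{\mathcal G}$ onto $\mathrm{Im}\hat R\oplus\mathcal A$ with kernel $\mathrm{Ker}R$, where $\mathcal A$ is a complement of $\mathrm{Dom}R$ in $\hat{\mathcal G}$. Then the model $S(g)=\frac12\int\langle\rho(\partial_-gg^{-1})|(R+\rho\circ\Pi^g)^{-1}\rho(\partial_+gg^{-1})\rangle$ on $G$ and the dual model $S(\hat g)=\frac12\int\langle\tilde\rho(\partial_-\hat g\hat g^{-1})|(\hat R+\tilde\rho\circ\hat\Pi^{\hat g})^{-1}\tilde\rho(\partial_+\hat g\hat g^{-1})\rangle$ on $\hat G$, defined where $R+\rho\circ\Pi^g:\mathrm{Dom}R\to\mathrm{Im}\rho$, respectively $\hat R+\tilde\rho\circ\hat\Pi^{\hat g}:\mathrm{Dom}\hat R\to\mathrm{Im}\tilde\rho$, is invertible, are gauge invariant under $F$. (3) Sfetsos' models. In (2) suppose moreover that $\mathrm{Ker}R=\mathrm{Ker}(R+R^*)=\{0\}$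 and $\mathrm{Ker}\hat R=\mathrm{Ker}(\hat R+\hat R^*)$ (so that the Lie algebra of $F$ is $\mathrm{Ker}\hat R$), and let $t_i$, $T^i$ be bases of $\mathcal G$, $\hat{\mathcal G}$ with $\langle t_i|T^j\rangle=\delta_i^j$, whose indices split into $i=\alpha$ and $i=M$ in such a way that $\mathrm{Ker}\hat R=\mathrm{Span}(t_\alpha)$, $\mathrm{Im}R=\mathrm{Span}(t_M)$, $\mathrm{Im}\hat R=\mathrm{Span}(T^M)$. Write $RT^M=R^{MN}t_N$, $\Pi^gT^i=\Pi(g)^{ij}t_j$, $\hat\Pi^{\hat g}t_i=\hat\Pi(\hat g)_{ij}T^j$. Then Sfetsos' action $$S(g)=\tfrac12\int(\partial_+gg^{-1})^M\big[(R^{PQ}+\Pi(g)^{PQ})^{-1}\big]_{MN}(\partial_-gg^{-1})^N$$ on $G$ and Sfetsos' dual action $$S(\hat g)=\tfrac12\int(\partial_+\hat g\hat g^{-1})_i\left[\begin{pmatrix}\hat\Pi_{\alpha\beta}&\hat\Pi_{\alpha N}\\ \hat\Pi_{M\beta}&(R^{-1})_{MN}+\hat\Pi_{MN}\end{pmatrix}^{-1}\right]^{ij}(\partial_-\hat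 g\hat g^{-1})_j$$ on $\hat G$, defined where these matrices are invertible, are gauge invariant under the dressing action of $F$; the second assertion is Sfetsos' conjecture. -/

import Mathlib

open scoped Manifold ContDiff
open MeasureTheory

noncomputable section

namespace DressingCosets

/-! ### Lie groups: adjoint action, logarithmic derivatives, immersed Lie subgroups -/

section LieGroups

variable (E : Type*) [NormedAddCommGroup E] [NormedSpace ℝ E]
  {D : Type*} [TopologicalSpace D] [ChartedSpace E D] [Group D]

/-- The Lie algebra of a Lie group modelled on `E`, that is, the tangent space at `1`. -/
abbrev Lie (D : Type*) [TopologicalSpace D] [ChartedSpace E D] [Group D] : Type _ :=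
  GroupLieAlgebra 𝓘(ℝ, E) D

/-- The adjoint action `Ad_d`: the derivative at `1` of the conjugation `x ↦ d x d⁻¹`
(whose value at `1` is `1`). -/
def Ad (d : D) : Lie E D →ₗ[ℝ] Lie E D :=
  (mfderiv 𝓘(ℝ, E) 𝓘(ℝ, E) (fun x : D => d * x * d⁻¹) 1).toLinearMap

/-- The world-sheet, with coordinates `(τ, σ)`. -/
abbrev Worldsheet : Type := ℝ × ℝ

/-- The direction of `∂₊ = ∂_τ + ∂_σ`. -/
def dirPlus : Worldsheet := (1, 1)

/-- The direction of `∂₋ = ∂_τ - ∂_σ`. -/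
def dirMinus : Worldsheet := (1, -1)

/-- The right logarithmic derivative `∂_u φ φ⁻¹` at `z` of a field `φ` with values in a Lie group:
the derivative at `z`, in the direction `u`, of `w ↦ φ(w) φ(z)⁻¹`, which takes the value `1`
at `z`. -/
def logDeriv (φ : Worldsheet → D) (z u : Worldsheet) : Lie E D :=
  mfderiv 𝓘(ℝ, Worldsheet) 𝓘(ℝ, E) (fun w => φ w * (φ z)⁻¹) z u

/-- Smooth fields on the world-sheet. -/
def IsField (φ : Worldsheet → D) : Prop :=
  ContMDiff 𝓘(ℝ, Worldsheet) 𝓘(ℝ, E) ∞ φ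

/-- A gauge transformation supported in `K`: a smooth field `f` which is `1` off `K` and which is
connected to the constant field `1` by a smooth homotopy `h` that is `1` off `K`.
In particular `f = exp ε`, for `ε` smooth and zero off `K`, is one, with `h t = exp (t ε)`. -/
def IsGaugeTransformation (K : Set Worldsheet) (f : Worldsheet → D) : Prop :=
  ∃ h : ℝ × Worldsheet → D, ContMDiff 𝓘(ℝ, ℝ × Worldsheet) 𝓘(ℝ, E) ∞ h ∧
    (∀ z, h (0, z) = 1) ∧ (∀ z, h (1, z) = f z) ∧ ∀ t, ∀ z ∉ K, h (t, z) = 1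

variable {E}
variable {E' : Type*} [NormedAddCommGroup E'] [NormedSpace ℝ E']
  {S : Type*} [TopologicalSpace S] [ChartedSpace E' S] [Group S]

variable (E E') in
/-- The homomorphism of Lie algebras given by the derivative at `1` of a homomorphism `i` of Lie
groups (recall `i 1 = 1`). -/
def dHom (i : S →* D) : Lie E' S →ₗ[ℝ] Lie E D :=
  (mfderiv 𝓘(ℝ, E') 𝓘(ℝ, E) i 1).toLinearMap

variable (E E') in
/-- `i` exhibits the Lie group `S` as a (not necessarily closed) Lie subgroup of `D`. -/
structure IsLieSubgroup (i : S →* D) : Prop where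
  smooth : ContMDiff 𝓘(ℝ, E') 𝓘(ℝ, E) ∞ i
  injective : Function.Injective i
  immersive : Function.Injective (dHom E E' i)

variable (E E') in
/-- The Lie algebra of a Lie subgroup, as a subspace of the Lie algebra of the ambient group. -/
def lieAlgebraOf (i : S →* D) : Submodule ℝ (Lie E D) := LinearMap.range (dHom E E' i)

end LieGroups


/-! ### Partially defined linear operators -/

section Partial

variable {V W : Type*} [AddCommGroup V] [Module ℝ V] [AddCommGroup W] [Module ℝ W]

/-- `Ker R`, as a subspace of the ambient space of the domain. -/
def kerP (R : V →ₗ.[ℝ] W) : Submodule ℝ V := (LinearMap.ker R.toFun).map R.domain.subtype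

/-- `Im R`. -/
def imP (R : V →ₗ.[ℝ] W) : Submodule ℝ W := LinearMap.range R.toFun

theorem mem_imP (R : V →ₗ.[ℝ] W) (x : R.domain) : R x ∈ imP R := ⟨x, rfl⟩

end Partial

/-! ### Perfect Drinfeld doubles -/

section Double

variable {E EG EH : Type*}
  [NormedAddCommGroup E] [NormedSpace ℝ E] [NormedAddCommGroup EG] [NormedSpace ℝ EG]
  [NormedAddCommGroup EH] [NormedSpace ℝ EH]
  {D G H : Type*}
  [TopologicalSpace D] [ChartedSpace E D] [Group D]
  [TopologicalSpace G] [ChartedSpace EG G] [Group G]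
  [TopologicalSpace H] [ChartedSpace EH H] [Group H]

variable (E EG EH D G H) in
/-- A perfect Drinfeld double `D` with its subgroups `G` and `H = Ĝ`: the Lie algebra of `D`
carries a symmetric non-degenerate invariant form, the Lie algebras of `G` and `Ĝ` are isotropic
and complementary, and every `l ∈ D` is uniquely `l = g ĥ`. -/
structure PerfectDouble where
  inG : G →* D
  inH : H →* D
  isLieSubgroup_inG : IsLieSubgroup E EG inG
  isLieSubgroup_inH : IsLieSubgroup E EH inH
  form : LinearMap.BilinForm ℝ (Lie E D)
  form_symm : ∀ x y, form x y = form y x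
  form_nondegenerate : form.Nondegenerate
  form_invariant : ∀ (d : D) (x y : Lie E D), form (Ad E d x) (Ad E d y) = form x y
  isCompl : IsCompl (lieAlgebraOf E EG inG) (lieAlgebraOf E EH inH)
  isotropicG : ∀ x ∈ lieAlgebraOf E EG inG, ∀ y ∈ lieAlgebraOf E EG inG, form x y = 0
  isotropicH : ∀ x ∈ lieAlgebraOf E EH inH, ∀ y ∈ lieAlgebraOf E EH inH, form x y = 0
  perfect : ∀ l : D, ∃! p : G × H, l = inG p.1 * inH p.2

namespace PerfectDouble

/-- The same double with the roles of `G` and `Ĝ` exchanged; now `l = ĝ h`. -/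
@[reducible] def swap (P : PerfectDouble E EG EH D G H) : PerfectDouble E EH EG D H G where
  inG := P.inH
  inH := P.inG
  isLieSubgroup_inG := P.isLieSubgroup_inH
  isLieSubgroup_inH := P.isLieSubgroup_inG
  form := P.form
  form_symm := P.form_symm
  form_nondegenerate := P.form_nondegenerate
  form_invariant := P.form_invariant
  isCompl := P.isCompl.symm
  isotropicG := P.isotropicH
  isotropicH := P.isotropicG
  perfect := by
    intro l
    obtain ⟨⟨g, h⟩, hl, huniq⟩ := P.perfect l⁻¹
    refine ⟨(h⁻¹, g⁻¹), ?_, ?_⟩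
    · simp only [map_inv, ← mul_inv_rev]
      exact (inv_eq_iff_eq_inv.mpr (by rw [← hl])).symm
    · rintro ⟨h', g'⟩ hl'
      have key := huniq (g'⁻¹, h'⁻¹) (by simp [hl'])
      simp only [Prod.mk.injEq] at key ⊢
      exact ⟨by rw [← key.2, inv_inv], by rw [← key.1, inv_inv]⟩

variable (P : PerfectDouble E EG EH D G H)

/-- The Lie algebra of `G`, inside that of `D`. -/
abbrev alg : Submodule ℝ (Lie E D) := lieAlgebraOf E EG P.inG

/-- The Lie algebra of `Ĝ`, inside that of `D`. -/
abbrev dualAlg : Submodule ℝ (Lie E D) := lieAlgebraOf E EH P.inH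

/-- The projection `J` onto the Lie algebra of `G` along that of `Ĝ`. -/
def J : Lie E D →ₗ[ℝ] P.alg := Submodule.projectionOnto P.alg P.dualAlg P.isCompl

/-- The projection `Ĵ` onto the Lie algebra of `Ĝ` along that of `G`. -/
def Jhat : Lie E D →ₗ[ℝ] P.dualAlg := Submodule.projectionOnto P.dualAlg P.alg P.isCompl.symm

/-- `Π^g = J Ad_g J Ad_{g⁻¹} Ĵ`, from the Lie algebra of `Ĝ` to that of `G`. -/
def poisson (g : G) : P.dualAlg →ₗ[ℝ] P.alg :=
  P.J ∘ₗ Ad E (P.inG g) ∘ₗ P.alg.subtype ∘ₗ P.J ∘ₗ Ad E (P.inG g)⁻¹ ∘ₗ P.dualAlg.subtype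

/-- The factor `g ∈ G` of `l = g ĥ`. -/
def factor (l : D) : G := (P.perfect l).choose.1

/-- The dressing action of `D` on `G`: `d ▷ g` is the factor in `G` of `d g`. -/
def dress (d : D) (g : G) : G := P.factor (d * P.inG g)

theorem factor_eq {l : D} {g : G} {h : H} (e : l = P.inG g * P.inH h) : P.factor l = g := by
  have := (P.perfect l).choose_spec.2 (g, h) e
  exact (congrArg Prod.fst this).symm

theorem factor_spec (l : D) : ∃ h : H, l = P.inG (P.factor l) * P.inH h :=
  ⟨(P.perfect l).choose.2, (P.perfect l).choose_spec.1⟩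

/-- The dressing action on `G` of a group `F` mapped to `D`. -/
@[reducible] def dressingAction {F : Type*} [Group F] (i : F →* D) : MulAction F G where
  smul f g := P.dress (i f) g
  one_smul g := P.factor_eq (h := 1) (by simp)
  mul_smul f₁ f₂ g := by
    obtain ⟨h₂, e₂⟩ := P.factor_spec (i f₂ * P.inG g)
    obtain ⟨h₁, e₁⟩ := P.factor_spec (i f₁ * P.inG (P.factor (i f₂ * P.inG g)))
    refine P.factor_eq (h := h₁ * h₂) ?_
    change _ = P.inG (P.factor (i f₁ * P.inG (P.factor (i f₂ * P.inG g)))) * _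
    rw [map_mul, map_mul, ← mul_assoc, ← e₁, mul_assoc, mul_assoc, ← e₂]

/-- The target space `F \ G`: the space of orbits of the dressing action of `F` on `G`. -/
def Target {F : Type*} [Group F] (i : F →* D) : Type _ :=
  @MulAction.orbitRel.Quotient F G _ (P.dressingAction i)

/-- The projection from `G` to `F \ G`. -/
def toTarget {F : Type*} [Group F] (i : F →* D) (g : G) : P.Target i :=
  @Quotient.mk _ (@MulAction.orbitRel F G _ (P.dressingAction i)) g

/-- The gauge transform `f ▷ g` of a field `g` by a field `f`. -/
def gauge {F : Type*} [Group F] (i : F →* D) (f : Worldsheet → F) (g : Worldsheet → G) :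
    Worldsheet → G :=
  fun z => P.dress (i (f z)) (g z)

/-- `∂_u g g⁻¹` for a field `g` with values in `G`, as an element of the Lie algebra of `G` inside
that of `D`. -/
def current (g : Worldsheet → G) (z u : Worldsheet) : P.alg :=
  ⟨dHom E EG P.inG (logDeriv EG g z u), LinearMap.mem_range_self _ _⟩

/-- The Lagrangian of the `σ`-model on `G` with density `ℓ g (∂₋g g⁻¹) (∂₊g g⁻¹)`. -/
def lagrangian (ℓ : G → P.alg → P.alg → ℝ) (g : Worldsheet → G) (z : Worldsheet) : ℝ :=
  ℓ (g z) (P.current g z dirMinus) (P.current g z dirPlus)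

/-- The action on the region `K` of the world-sheet. -/
def action (ℓ : G → P.alg → P.alg → ℝ) (K : Set Worldsheet) (g : Worldsheet → G) : ℝ :=
  (1 / 2) * ∫ z in K, P.lagrangian ℓ g z

/-- Gauge invariance under the dressing action of `F` of the `σ`-model on `G` with density `ℓ`,
where `ℓ g` is defined for those `g` only which satisfy `adm`. -/
structure GaugeInvariant {EF : Type*} [NormedAddCommGroup EF] [NormedSpace ℝ EF]
    {F : Type*} [TopologicalSpace F] [ChartedSpace EF F] [Group F]
    (i : F →* D) (adm : G → Prop) (ℓ : G → P.alg → P.alg → ℝ) : Prop where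
  /-- The dressing action preserves the points at which the density is defined. -/
  adm_iff : ∀ (f : F) (g : G), adm (P.dress (i f) g) ↔ adm g
  /-- Gauge transforms of smooth fields are smooth. -/
  isField : ∀ (f : Worldsheet → F) (g : Worldsheet → G),
    IsField EF f → IsField EG g → IsField EG (P.gauge i f g)
  /-- A field and its gauge transforms define the same field with values in `F \ G`. -/
  toTarget_eq : ∀ (f : Worldsheet → F) (g : Worldsheet → G) (z : Worldsheet),
    P.toTarget i (P.gauge i f g z) = P.toTarget i (g z)
  /-- The action is gauge invariant. -/
  action_eq : ∀ (K : Set Worldsheet) (f : Worldsheet → F) (g : Worldsheet → G),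
    IsCompact K → IsGaugeTransformation EF K f → IsField EG g → (∀ z ∈ K, adm (g z)) →
      IntegrableOn (P.lagrangian ℓ g) K ∧ IntegrableOn (P.lagrangian ℓ (P.gauge i f g)) K ∧
        P.action ℓ K (P.gauge i f g) = P.action ℓ K g
  /-- The metric `v ↦ ℓ g v v` of the target is gauge invariant, pointwise and for arbitrary smooth
  gauge transformations; so it is degenerate along the orbits of `F` and lives on `F \ G`. -/
  metric_eq : ∀ (f : Worldsheet → F) (g : Worldsheet → G) (z u : Worldsheet),
    IsField EF f → IsField EG g → adm (g z) →
      ℓ (P.gauge i f g z) (P.current (P.gauge i f g) z u) (P.current (P.gauge i f g) z u) =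
        ℓ (g z) (P.current g z u) (P.current g z u)

/-! ### Standard dressing cosets -/

/-- `R + Π^g`, for `R` defined everywhere. -/
def background (R : P.dualAlg ≃ₗ[ℝ] P.alg) (g : G) : P.dualAlg →ₗ[ℝ] P.alg :=
  R.toLinearMap + P.poisson g

/-- The density `⟨b | (R + Π^g)⁻¹ a⟩`; it is used where `R + Π^g` is bijective. -/
def density (R : P.dualAlg ≃ₗ[ℝ] P.alg) (g : G) (b a : P.alg) : ℝ :=
  P.form b (Function.invFun (P.background R g) a : P.dualAlg)

/-- `{γ + R γ : γ ∈ Ker (R + R*)}`. -/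
def fSpace (R Rs : P.dualAlg →ₗ[ℝ] P.alg) : Submodule ℝ (Lie E D) :=
  (LinearMap.ker (R + Rs)).map (P.dualAlg.subtype + P.alg.subtype ∘ₗ R)

/-- `J Ad_f Ĵ + J [Ad_f, R] Ĵ = R Ad_f R` for all `f ∈ F`. -/
def Condition {F : Type*} [Group F] (i : F →* D) (R : P.dualAlg →ₗ[ℝ] P.alg) : Prop :=
  ∀ (f : F) (x : P.dualAlg),
    P.J (Ad E (i f) x) + (P.J (Ad E (i f) (R x)) - R (P.Jhat (Ad E (i f) x))) =
      R (P.Jhat (Ad E (i f) (R x)))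

/-! ### Generalized dressing cosets -/

/-- `Rs = R*` is the adjoint of `R : Dom R → Im R` with respect to the form, as an operator on
`Dom R` with values in `Im R`. -/
structure IsAdjoint (R Rs : P.dualAlg →ₗ.[ℝ] P.alg) : Prop where
  domain_eq : Rs.domain = R.domain
  range_le : imP Rs ≤ imP R
  adjoint : ∀ (x : R.domain) (y : Rs.domain),
    P.form (R x) (y : P.dualAlg) = P.form (x : P.dualAlg) (Rs y)

/-- The annihilator, in the Lie algebra of `Ĝ`, of a subspace of the Lie algebra of `G`. -/
def ann (S : Submodule ℝ P.alg) : Submodule ℝ P.dualAlg where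
  carrier := {x | ∀ k ∈ S, P.form x k = 0}
  add_mem' := fun ha hb k hk => by simp [ha k hk, hb k hk]
  zero_mem' := fun k _ => by simp
  smul_mem' := fun c x hx k hk => by simp [hx k hk]

/-- A pair of operators `R` and `R̂` with their adjoints, subject to the requirements of the
generalized dressing cosets. -/
structure OperatorPair where
  R : P.dualAlg →ₗ.[ℝ] P.alg
  Rs : P.dualAlg →ₗ.[ℝ] P.alg
  Rhat : P.alg →ₗ.[ℝ] P.dualAlg
  Rhats : P.alg →ₗ.[ℝ] P.dualAlg
  isAdjoint : P.IsAdjoint R Rs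
  isAdjoint_hat : P.swap.IsAdjoint Rhat Rhats
  ker_eq : kerP R = kerP Rs
  ker_hat_eq : kerP Rhat = kerP Rhats
  im_hat_le : imP Rhat ≤ R.domain
  im_le : imP R ≤ Rhat.domain
  /-- `R̂ R = 1` on `Im R̂`. -/
  left_inv : ∀ (x : P.dualAlg) (hx : x ∈ imP Rhat),
    Rhat ⟨R ⟨x, im_hat_le hx⟩, im_le (mem_imP R _)⟩ = x
  /-- `R R̂ = 1` on `Im R`. -/
  right_inv : ∀ (y : P.alg) (hy : y ∈ imP R),
    R ⟨Rhat ⟨y, im_le hy⟩, im_hat_le (mem_imP Rhat _)⟩ = y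
  ann_ker_hat : P.ann (kerP Rhat) = R.domain
  ann_ker : P.swap.ann (kerP R) = Rhat.domain
  nondegenerate : (P.form.restrict
    ((imP R).map P.alg.subtype ⊔ (imP Rhat).map P.dualAlg.subtype)).Nondegenerate

/-- `γ ↦ γ + R γ` on `Dom R`. -/
def graphMap (R : P.dualAlg →ₗ.[ℝ] P.alg) : R.domain →ₗ[ℝ] Lie E D :=
  P.dualAlg.subtype ∘ₗ R.domain.subtype + P.alg.subtype ∘ₗ R.toFun

variable {P} in
/-- `Ker R̂ ⊕ {γ + R γ : γ ∈ Ker (R + R*)}`. -/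
def OperatorPair.fSpace (X : P.OperatorPair) : Submodule ℝ (Lie E D) :=
  (kerP X.Rhat).map P.alg.subtype ⊔
    ((kerP (X.R + X.Rs)).comap X.R.domain.subtype).map (P.graphMap X.R)

/-- `J Ad_f Ĵ + J [Ad_f, R] Ĵ = R Ad_f R` on `Dom R`, for all `f ∈ F`. The two terms
`R Ĵ Ad_f x` and `R Ĵ Ad_f R x` are collected on the right, and only their sum has to be defined. -/
def PartialCondition {F : Type*} [Group F] (i : F →* D) (R : P.dualAlg →ₗ.[ℝ] P.alg) : Prop :=
  ∀ (f : F) (x : R.domain),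
    ∃ h : P.Jhat (Ad E (i f) (x : P.dualAlg)) + P.Jhat (Ad E (i f) (R x)) ∈ R.domain,
      P.J (Ad E (i f) (x : P.dualAlg)) + P.J (Ad E (i f) (R x)) = R ⟨_, h⟩

/-- `ρ` is a projector onto `Im R ⊕ A` with kernel `Ker R̂`, where `A` is a complement of
`Dom R̂`. -/
def IsRho (R : P.dualAlg →ₗ.[ℝ] P.alg) (Rhat : P.alg →ₗ.[ℝ] P.dualAlg)
    (ρ : P.alg →ₗ[ℝ] P.alg) : Prop :=
  ρ ∘ₗ ρ = ρ ∧ LinearMap.ker ρ = kerP Rhat ∧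
    ∃ A : Submodule ℝ P.alg, IsCompl Rhat.domain A ∧ LinearMap.range ρ = imP R ⊔ A

/-- `R + ρ ∘ Π^g` on `Dom R`. -/
def genBackground (R : P.dualAlg →ₗ.[ℝ] P.alg) (ρ : P.alg →ₗ[ℝ] P.alg) (g : G) :
    R.domain →ₗ[ℝ] P.alg :=
  R.toFun + ρ ∘ₗ P.poisson g ∘ₗ R.domain.subtype

/-- `R + ρ ∘ Π^g` is invertible as a map from `Dom R` to the image of `ρ`. -/
def GenAdmissible (R : P.dualAlg →ₗ.[ℝ] P.alg) (ρ : P.alg →ₗ[ℝ] P.alg) (g : G) : Prop :=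
  Function.Injective (P.genBackground R ρ g) ∧
    LinearMap.range (P.genBackground R ρ g) = LinearMap.range ρ

/-- The density `⟨ρ b | (R + ρ ∘ Π^g)⁻¹ ρ a⟩`; it is used where `R + ρ ∘ Π^g` is invertible. -/
def genDensity (R : P.dualAlg →ₗ.[ℝ] P.alg) (ρ : P.alg →ₗ[ℝ] P.alg) (g : G) (b a : P.alg) : ℝ :=
  P.form (ρ b) ((Function.invFun (P.genBackground R ρ g) (ρ a) : R.domain) : P.dualAlg)

/-! ### The models of Sfetsos -/

section Sfetsos

variable {α μ : Type*} [Fintype α] [Fintype μ] [DecidableEq α] [DecidableEq μ]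

variable {P} in
/-- The operators of Sfetsos' models, in dual bases `t_i` and `T^i`, where `i` is an index
`inl α` or `inr M`: `Ker R = Ker (R + R*) = 0`, `Ker R̂ = Ker (R̂ + R̂*) = Span (t_α)`,
`Im R = Span (t_M)`, `Im R̂ = Span (T^M)`, and `R T^M = ∑ R^{MN} t_N`. -/
structure OperatorPair.IsSfetsos (X : P.OperatorPair) (t : Module.Basis (α ⊕ μ) ℝ P.alg)
    (T : Module.Basis (α ⊕ μ) ℝ P.dualAlg) (Rm : Matrix μ μ ℝ) : Prop where
  ker_eq_bot : kerP X.R = ⊥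
  ker_add_eq_bot : kerP (X.R + X.Rs) = ⊥
  ker_hat_eq : kerP X.Rhat = kerP (X.Rhat + X.Rhats)
  dual : ∀ i j, P.form (t i) (T j) = if i = j then 1 else 0
  ker_hat_eq_span : kerP X.Rhat = Submodule.span ℝ (Set.range fun a => t (Sum.inl a))
  im_eq_span : imP X.R = Submodule.span ℝ (Set.range fun M => t (Sum.inr M))
  im_hat_eq_span : imP X.Rhat = Submodule.span ℝ (Set.range fun M => T (Sum.inr M))
  matrix : ∀ M, ∃ h : T (Sum.inr M) ∈ X.R.domain,
    X.R ⟨T (Sum.inr M), h⟩ = ∑ N, Rm M N • t (Sum.inr N)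

/-- The components `Π(g)^{ij}` defined by `Π^g T^i = ∑ Π(g)^{ij} t_j`. -/
def poissonMatrix {ι : Type*} (T : ι → P.dualAlg) (g : G) : Matrix ι ι ℝ :=
  Matrix.of fun i j => P.form (P.poisson g (T i)) (T j)

/-- The density `∑ a^i (O⁻¹)_{ij} b^j` with `a^i = ⟨a | T^i⟩` and `b^j = ⟨b | T^j⟩`. -/
def matrixDensity {ι : Type*} [Fintype ι] [DecidableEq ι] (T : ι → P.dualAlg)
    (O : G → Matrix ι ι ℝ) (g : G) (b a : P.alg) : ℝ :=
  ∑ i, ∑ j, P.form a (T i) * (O g)⁻¹ i j * P.form b (T j)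

/-- The matrix `(R + Π(g))^{MN}` of the model of Sfetsos on `G`. -/
def sfetsosMatrix (T : α ⊕ μ → P.dualAlg) (Rm : Matrix μ μ ℝ) (g : G) : Matrix μ μ ℝ :=
  Rm + P.poissonMatrix (fun M => T (Sum.inr M)) g

/-- The matrix of the dual model of Sfetsos, on `Ĝ`: the blocks of `Π̂(ĝ)`, with the inverse matrix
of `R^{MN}` added to the block `MN`. -/
def sfetsosDualMatrix (t : α ⊕ μ → P.alg) (Rm : Matrix μ μ ℝ) (g : H) :
    Matrix (α ⊕ μ) (α ⊕ μ) ℝ :=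
  P.swap.poissonMatrix t g + Matrix.fromBlocks 0 0 0 Rm⁻¹

end Sfetsos

end PerfectDouble

end Double

end DressingCosets

end

/-! All the models have one geometric form. Write `a` for a current in the Lie algebra of `G`, and
let `S` be a subspace of the Lie algebra of `D`. If `S` is complementary to `Ad_g Ĝ` (`twist g`),
there is a unique `e ∈ S` with `e - a ∈ Ad_g Ĝ`, and the density is `⟨b | e⟩` (`IsModel`). For the
standard models `S` is the graph `{x + R x}`; for the generalized ones and those of Sfetsos it is
that graph plus `Ker R̂`. The dictionary is `sub_mem_twist_iff`: `x + y - a` lies in `Ad_g Ĝ`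
exactly when `y + Π^g x = a`. The same `S` serves the dual model (`swap_graphSpace`,
`swap_genSpace`), so each dual statement follows from the same theorem applied to the swapped
double.

The conditions on `R`, `R̂` and `F` say that `S` is `Ad_F`-invariant, contains the Lie algebra of
`F`, and is orthogonal to it (`IsCosetSpace`). If `f g = g' ĥ`, then `Ad_f` maps `Ad_g Ĝ` onto
`Ad_{g'} Ĝ`, and the component `e` of the current becomes `Ad_f e + ∂f f⁻¹` (`component_gauge`).
Since `2⟨a | e⟩ = ⟨e | e⟩`, the metric is invariant at once (`metric_gauge`).

The Lagrangian itself changes, by `⟨c₋ | p₊ - q₊⟩` with `c`, `p`, `q` the right logarithmic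
derivatives of `f g`, `f`, `g'` (`lagrangian_gauge`, `gaugeForm`). Isotropy of the subgroups makes
this expression antisymmetric, hence a `2`-form. It is closed: `⟨c ∧ p⟩` and `⟨c ∧ q⟩` have the same
exterior derivative, namely the Cartan `3`-form of `c`, because the Cartan form vanishes on `p`,
`q`, `c - p` and `c - q`, which come from maps into isotropic subgroups or their conjugates
(`cartan_cyclic`, `gaugeForm_closed`). Pulled back along the homotopy from `1` to `f`, the form
vanishes off `K` and at time `0`, so Stokes on `[0, 1] × ℝ²` kills its integral at time `1`
(`setIntegral_gaugeForm_eq_zero`).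

The analytic inputs are the Maurer–Cartan equation, smoothness of the factorization `l = g ĥ`
(inverse function theorem at `1`, then translation), and continuity of the Lagrangian where `S` is
complementary to `Ad_g Ĝ`. -/

set_option linter.unusedSectionVars false

namespace DressingCosets

open Filter Topology

noncomputable section

/-! ### Right logarithmic derivatives of maps into a Lie group, in the chart at the unit. -/

section Calculus

variable {E : Type*} [NormedAddCommGroup E] [NormedSpace ℝ E]
  {D : Type*} [TopologicalSpace D] [ChartedSpace E D] [Group D]
  {M : Type*} [NormedAddCommGroup M] [NormedSpace ℝ M]

variable (E) in
/-- The chart of a Lie group at `1`. -/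
def unitChart (D : Type*) [TopologicalSpace D] [ChartedSpace E D] [Group D] :
    PartialEquiv D E := extChartAt 𝓘(ℝ, E) (1 : D)

variable (E) in
/-- The coordinates of the unit. -/
abbrev unitPt (D : Type*) [TopologicalSpace D] [ChartedSpace E D] [Group D] : E :=
  unitChart E D 1

variable (E) in
/-- Smoothness at a point of a map from a normed space to a manifold. -/
abbrev SmoothAt {D : Type*} [TopologicalSpace D] [ChartedSpace E D] (φ : M → D) (z : M) : Prop :=
  ContMDiffAt 𝓘(ℝ, M) 𝓘(ℝ, E) ∞ φ z

variable (E) in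
/-- The right logarithmic derivative of a map to a Lie group, read in the chart at `1`. -/
def rlog (φ : M → D) (z : M) : M →L[ℝ] E :=
  fderiv ℝ (fun w => unitChart E D (φ w * (φ z)⁻¹)) z

/-- The derivative at `1`, read in charts, of a map between Lie groups that preserves `1`. -/
def tang {E' : Type*} [NormedAddCommGroup E'] [NormedSpace ℝ E']
    {S : Type*} [TopologicalSpace S] [ChartedSpace E' S] [Group S] (X : S → D) : E' →L[ℝ] E :=
  fderiv ℝ (fun x => unitChart E D (X ((unitChart E' S).symm x))) (unitPt E' S)

variable (E) in
/-- The adjoint action, read in the chart at `1`. -/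
def AdE (d : D) : E →L[ℝ] E := tang (E' := E) (fun x : D => d * x * d⁻¹)

theorem unitChart_symm_unitPt : (unitChart E D).symm (unitPt E D) = 1 :=
  extChartAt_to_inv (I := 𝓘(ℝ, E)) (1 : D)

theorem unitChart_left_inv_eventually {φ : M → D} {z : M} (hφ : ContinuousAt φ z) (h1 : φ z = 1) :
    ∀ᶠ w in 𝓝 z, (unitChart E D).symm (unitChart E D (φ w)) = φ w := by
  have : (unitChart E D).source ∈ 𝓝 (φ z) := by
    rw [h1]; exact extChartAt_source_mem_nhds (I := 𝓘(ℝ, E)) (1 : D)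
  filter_upwards [hφ.preimage_mem_nhds this] with w hw
  exact (unitChart E D).left_inv hw

section Lie

variable [LieGroup 𝓘(ℝ, E) ∞ D]

theorem isManifold_of_lieGroup : IsManifold 𝓘(ℝ, E) ∞ D :=
  (inferInstance : ContMDiffMul 𝓘(ℝ, E) ∞ D).toIsManifold

theorem smoothAt_unitChart_symm : SmoothAt E (unitChart E D).symm (unitPt E D) := by
  have := isManifold_of_lieGroup (E := E) (D := D)
  exact (contMDiffOn_extChartAt_symm (I := 𝓘(ℝ, E)) (n := ∞) (1 : D)).contMDiffAt
    (extChartAt_target_mem_nhds (I := 𝓘(ℝ, E)) (1 : D))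

theorem contDiffAt_unitChart_comp {φ : M → D} {z : M} (hφ : SmoothAt E φ z) (h1 : φ z = 1) :
    ContDiffAt ℝ ∞ (fun w => unitChart E D (φ w)) z := by
  have := isManifold_of_lieGroup (E := E) (D := D)
  have h : ContMDiffAt 𝓘(ℝ, E) 𝓘(ℝ, E) ∞ (unitChart E D) (φ z) := by
    rw [h1]; exact contMDiffAt_extChartAt
  exact (h.comp z hφ).contDiffAt

theorem SmoothAt.mul {φ ψ : M → D} {z : M} (hφ : SmoothAt E φ z) (hψ : SmoothAt E ψ z) :
    SmoothAt E (fun w => φ w * ψ w) z :=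
  ContMDiffAt.mul hφ hψ

theorem SmoothAt.inv {φ : M → D} {z : M} (hφ : SmoothAt E φ z) :
    SmoothAt E (fun w => (φ w)⁻¹) z :=
  ContMDiffAt.inv hφ

theorem SmoothAt.mul_const {φ : M → D} {z : M} (hφ : SmoothAt E φ z) (d : D) :
    SmoothAt E (fun w => φ w * d) z :=
  hφ.mul contMDiffAt_const

theorem SmoothAt.const_mul {φ : M → D} {z : M} (hφ : SmoothAt E φ z) (d : D) :
    SmoothAt E (fun w => d * φ w) z :=
  SmoothAt.mul contMDiffAt_const hφ

theorem contDiffAt_rlog_aux {φ : M → D} {z : M} (hφ : SmoothAt E φ z) :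
    ContDiffAt ℝ ∞ (fun w => unitChart E D (φ w * (φ z)⁻¹)) z :=
  contDiffAt_unitChart_comp (hφ.mul_const _) (mul_inv_cancel _)

variable {E' : Type*} [NormedAddCommGroup E'] [NormedSpace ℝ E']
    {S : Type*} [TopologicalSpace S] [ChartedSpace E' S] [Group S] [LieGroup 𝓘(ℝ, E') ∞ S]

/-- Chain rule at `1`. -/
theorem fderiv_unitChart_comp {X : S → D} (hX : ContMDiffAt 𝓘(ℝ, E') 𝓘(ℝ, E) ∞ X 1) (hX1 : X 1 = 1)
    {ψ : M → S} {z : M} (hψ : SmoothAt E' ψ z) (h1 : ψ z = 1) :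
    fderiv ℝ (fun w => unitChart E D (X (ψ w))) z =
      (tang (E := E) (E' := E') X).comp (fderiv ℝ (fun w => unitChart E' S (ψ w)) z) := by
  have e : (fun w => unitChart E D (X (ψ w))) =ᶠ[𝓝 z]
      (fun x => unitChart E D (X ((unitChart E' S).symm x))) ∘ fun w => unitChart E' S (ψ w) := by
    filter_upwards [unitChart_left_inv_eventually (E := E') hψ.continuousAt h1] with w hw
    simp [hw]
  rw [e.fderiv_eq, fderiv_comp]
  · simp only [h1, tang]
  · have hX' : SmoothAt E (fun x => X ((unitChart E' S).symm x)) (unitChart E' S (ψ z)) := by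
      rw [h1]
      refine ContMDiffAt.comp _ ?_ smoothAt_unitChart_symm
      rw [unitChart_symm_unitPt]; exact hX
    refine (contDiffAt_unitChart_comp hX' ?_).differentiableAt (by simp)
    rw [h1, unitChart_symm_unitPt, hX1]
  · exact (contDiffAt_unitChart_comp hψ h1).differentiableAt (by simp)

/-- A homomorphism maps logarithmic derivatives to logarithmic derivatives. -/
theorem rlog_hom {i : S →* D} (hi : ContMDiffAt 𝓘(ℝ, E') 𝓘(ℝ, E) ∞ i 1)
    {φ : M → S} {z : M} (hφ : SmoothAt E' φ z) :
    rlog E (fun w => i (φ w)) z = (tang i).comp (rlog E' φ z) := by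
  have := fderiv_unitChart_comp (E := E) (X := i) hi (map_one i)
    (hφ.mul_const (φ z)⁻¹) (mul_inv_cancel _)
  simpa [rlog] using this

theorem contMDiff_conj (d : D) : ContMDiff 𝓘(ℝ, E) 𝓘(ℝ, E) ∞ (fun x : D => d * x * d⁻¹) :=
  (contMDiff_const.mul contMDiff_id).mul contMDiff_const

theorem rlog_conj (d : D) {φ : M → D} {z : M} (hφ : SmoothAt E φ z) :
    rlog E (fun w => d * φ w * d⁻¹) z = (AdE E d).comp (rlog E φ z) := by
  have := rlog_hom (E := E) (E' := E) (i := (MulAut.conj d).toMonoidHom)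
    (by exact (contMDiff_conj d).contMDiffAt) hφ
  exact this

theorem contDiffAt_mulChart : ContDiffAt ℝ ∞ (fun p : E × E => unitChart E D
    ((unitChart E D).symm p.1 * (unitChart E D).symm p.2)) (unitPt E D, unitPt E D) := by
  have h1 : SmoothAt E (fun p : E × E => (unitChart E D).symm p.1) (unitPt E D, unitPt E D) :=
    ContMDiffAt.comp (I' := 𝓘(ℝ, E)) _ smoothAt_unitChart_symm contDiffAt_fst.contMDiffAt
  have h2 : SmoothAt E (fun p : E × E => (unitChart E D).symm p.2) (unitPt E D, unitPt E D) :=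
    ContMDiffAt.comp (I' := 𝓘(ℝ, E)) _ smoothAt_unitChart_symm contDiffAt_snd.contMDiffAt
  refine contDiffAt_unitChart_comp (h1.mul h2) ?_
  simp [unitChart_symm_unitPt]

theorem unitChart_right_inv_eventually :
    ∀ᶠ x in 𝓝 (unitPt E D), unitChart E D ((unitChart E D).symm x) = x := by
  filter_upwards [extChartAt_target_mem_nhds (I := 𝓘(ℝ, E)) (1 : D)] with x hx
  exact (unitChart E D).right_inv hx

/-- The derivative of multiplication at `(1, 1)` is addition: restricted to either axis,
multiplication is the identity. -/
theorem fderiv_mul_of_eq_one {φ ψ : M → D} {z : M} (hφ : SmoothAt E φ z) (hψ : SmoothAt E ψ z)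
    (h1 : φ z = 1) (h2 : ψ z = 1) :
    fderiv ℝ (fun w => unitChart E D (φ w * ψ w)) z =
      fderiv ℝ (fun w => unitChart E D (φ w)) z + fderiv ℝ (fun w => unitChart E D (ψ w)) z := by
  set m : E × E → E := fun p => unitChart E D
    ((unitChart E D).symm p.1 * (unitChart E D).symm p.2) with hm
  have hmd : HasFDerivAt m (fderiv ℝ m (unitPt E D, unitPt E D)) (unitPt E D, unitPt E D) :=
    ((contDiffAt_mulChart (E := E) (D := D)).differentiableAt (by simp)).hasFDerivAt
  have hl : (fderiv ℝ m (unitPt E D, unitPt E D)).comp (ContinuousLinearMap.inl ℝ E E) =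
      ContinuousLinearMap.id ℝ E := by
    have h := HasFDerivAt.comp (f := fun x => (x, unitPt E D)) (unitPt E D) hmd
      (hasFDerivAt_prodMk_left (𝕜 := ℝ) (unitPt E D) (unitPt E D))
    refine h.unique ?_
    refine (hasFDerivAt_id (unitPt E D)).congr_of_eventuallyEq ?_
    filter_upwards [unitChart_right_inv_eventually (E := E) (D := D)] with x hx
    simp [hm, unitChart_symm_unitPt, hx]
  have hr : (fderiv ℝ m (unitPt E D, unitPt E D)).comp (ContinuousLinearMap.inr ℝ E E) =
      ContinuousLinearMap.id ℝ E := by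
    have h := hmd.comp (unitPt E D) (hasFDerivAt_prodMk_right (𝕜 := ℝ) (unitPt E D) (unitPt E D))
    refine h.unique ?_
    refine (hasFDerivAt_id (unitPt E D)).congr_of_eventuallyEq ?_
    filter_upwards [unitChart_right_inv_eventually (E := E) (D := D)] with x hx
    simp [hm, unitChart_symm_unitPt, hx]
  have e : (fun w => unitChart E D (φ w * ψ w)) =ᶠ[𝓝 z]
      m ∘ fun w => (unitChart E D (φ w), unitChart E D (ψ w)) := by
    filter_upwards [unitChart_left_inv_eventually (E := E) hφ.continuousAt h1,
      unitChart_left_inv_eventually (E := E) hψ.continuousAt h2] with w hw hw'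
    simp [hm, hw, hw']
  have dφ := ((contDiffAt_unitChart_comp hφ h1).differentiableAt (by simp)).hasFDerivAt
  have dψ := ((contDiffAt_unitChart_comp hψ h2).differentiableAt (by simp)).hasFDerivAt
  have hmd' : HasFDerivAt m (fderiv ℝ m (unitPt E D, unitPt E D))
      (unitChart E D (φ z), unitChart E D (ψ z)) := by rw [h1, h2]; exact hmd
  rw [e.fderiv_eq, (hmd'.comp z (dφ.prodMk dψ)).fderiv]
  ext u
  have k : ∀ a b : E, fderiv ℝ m (unitPt E D, unitPt E D) (a, b) = a + b := fun a b => by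
    have ha := DFunLike.congr_fun hl a
    have hb := DFunLike.congr_fun hr b
    simp only [ContinuousLinearMap.comp_apply, ContinuousLinearMap.inl_apply,
      ContinuousLinearMap.inr_apply, ContinuousLinearMap.id_apply] at ha hb
    have : ((a, b) : E × E) = (a, 0) + (0, b) := by simp
    rw [this, map_add, ha, hb]
  simp [k]

/-- The product rule. -/
theorem rlog_mul {φ ψ : M → D} {z : M} (hφ : SmoothAt E φ z) (hψ : SmoothAt E ψ z) :
    rlog E (fun w => φ w * ψ w) z = rlog E φ z + (AdE E (φ z)).comp (rlog E ψ z) := by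
  rw [← rlog_conj _ hψ]
  -- With `χ = φ(z) ψ φ(z)⁻¹`, the quotient `φψ (φψ)(z)⁻¹` is the product of `φ φ(z)⁻¹` and `χ
  -- χ(z)⁻¹`, both equal to `1` at `z`.
  have := fderiv_mul_of_eq_one (E := E) (hφ.mul_const (φ z)⁻¹)
    (((hψ.const_mul (φ z)).mul_const (φ z)⁻¹).mul_const (φ z * ψ z * (φ z)⁻¹)⁻¹)
    (mul_inv_cancel _) (mul_inv_cancel _)
  simp only [rlog]
  rw [← this]
  congr 1
  funext w
  congr 1
  group

theorem rlog_const (d : D) (z : M) : rlog E (fun _ : M => d) z = 0 := by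
  simp [rlog]

theorem rlog_congr {φ ψ : M → D} {z : M} (h : φ =ᶠ[𝓝 z] ψ) : rlog E φ z = rlog E ψ z := by
  unfold rlog
  rw [h.eq_of_nhds]
  refine Filter.EventuallyEq.fderiv_eq ?_
  filter_upwards [h] with w hw
  rw [hw]

/-- The chain rule for a change of the world-sheet. -/
theorem rlog_comp {M' : Type*} [NormedAddCommGroup M'] [NormedSpace ℝ M'] {φ : M → D} {j : M' → M}
    {z : M'} {j' : M' →L[ℝ] M} (hφ : SmoothAt E φ (j z)) (hj : HasFDerivAt j j' z) :
    rlog E (fun w => φ (j w)) z = (rlog E φ (j z)).comp j' :=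
  (((contDiffAt_rlog_aux hφ).differentiableAt (by simp)).hasFDerivAt.comp z hj).fderiv

end Lie

end Calculus

/-! ### The Maurer–Cartan equation, the bracket, and the adjoint action. -/

section MaurerCartan

variable {E : Type*} [NormedAddCommGroup E] [NormedSpace ℝ E]
  {D : Type*} [TopologicalSpace D] [ChartedSpace E D] [Group D]
  {M : Type*} [NormedAddCommGroup M] [NormedSpace ℝ M]

variable (E D) in
/-- The division `(x', x) ↦ x' x⁻¹` in the chart at `1`. -/
def divChart (p : E × E) : E :=
  unitChart E D ((unitChart E D).symm p.1 * ((unitChart E D).symm p.2)⁻¹)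

variable (E D) in
/-- The right Maurer–Cartan form in the chart at `1`. -/
def mcForm (x : E) : E →L[ℝ] E :=
  (fderiv ℝ (divChart E D) (x, x)).comp (ContinuousLinearMap.inl ℝ E E)

variable (E D) in
/-- The Lie bracket (for the right-invariant convention), as the exterior derivative at `1` of the
right Maurer–Cartan form. -/
def rbracket (a b : E) : E :=
  fderiv ℝ (mcForm E D) (unitPt E D) a b - fderiv ℝ (mcForm E D) (unitPt E D) b a

variable [LieGroup 𝓘(ℝ, E) ∞ D]

theorem contDiffAt_divChart : ContDiffAt ℝ ∞ (divChart E D) (unitPt E D, unitPt E D) := by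
  have h1 : SmoothAt E (fun p : E × E => (unitChart E D).symm p.1) (unitPt E D, unitPt E D) :=
    ContMDiffAt.comp (I' := 𝓘(ℝ, E)) _ smoothAt_unitChart_symm contDiffAt_fst.contMDiffAt
  have h2 : SmoothAt E (fun p : E × E => (unitChart E D).symm p.2) (unitPt E D, unitPt E D) :=
    ContMDiffAt.comp (I' := 𝓘(ℝ, E)) _ smoothAt_unitChart_symm contDiffAt_snd.contMDiffAt
  refine contDiffAt_unitChart_comp (h1.mul h2.inv) ?_
  simp [unitChart_symm_unitPt]

theorem contDiffAt_mcForm : ContDiffAt ℝ ∞ (mcForm E D) (unitPt E D) := by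
  have h : ContDiffAt ℝ ∞ (fderiv ℝ (divChart E D)) (unitPt E D, unitPt E D) :=
    (contDiffAt_divChart (E := E) (D := D)).fderiv_right (m := ∞) (by simp)
  have h' : ContDiffAt ℝ ∞ (fun x : E => fderiv ℝ (divChart E D) (x, x)) (unitPt E D) :=
    ContDiffAt.comp (f := fun x : E => (x, x)) _ h (contDiffAt_id.prodMk contDiffAt_id)
  exact h'.clm_comp contDiffAt_const

theorem mcForm_unitPt : mcForm E D (unitPt E D) = ContinuousLinearMap.id ℝ E := by
  have hmd := ((contDiffAt_divChart (E := E) (D := D)).differentiableAt (by simp)).hasFDerivAt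
  have h := HasFDerivAt.comp (f := fun x => (x, unitPt E D)) (unitPt E D) hmd
    (hasFDerivAt_prodMk_left (𝕜 := ℝ) (unitPt E D) (unitPt E D))
  refine h.unique ((hasFDerivAt_id (unitPt E D)).congr_of_eventuallyEq ?_)
  filter_upwards [unitChart_right_inv_eventually (E := E) (D := D)] with x hx
  simp [divChart, unitChart_symm_unitPt, hx]

/-- The local coordinates, centred at `φ z`, of a map `φ`. -/
abbrev coord (φ : M → D) (z w : M) : E := unitChart E D (φ w * (φ z)⁻¹)

/-- The logarithmic derivative is the pullback of the Maurer–Cartan form. -/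
theorem rlog_eventuallyEq {φ : M → D} {z : M} (hφ : SmoothAt E φ z) :
    ∀ᶠ w in 𝓝 z, rlog E φ w =
      (mcForm E D (coord φ z w)).comp (fderiv ℝ (coord φ z) w) := by
  have hψ := contDiffAt_rlog_aux hφ
  have h1 : ∀ᶠ w in 𝓝 z, DifferentiableAt ℝ (coord (E := E) φ z) w :=
    ((hψ.of_le (by exact_mod_cast le_top : (1 : WithTop ℕ∞) ≤ ∞)).eventually (by simp)).mono
      fun w hw => hw.differentiableAt (by simp)
  have h2 : ∀ᶠ x in 𝓝 (unitPt E D), DifferentiableAt ℝ (divChart E D) (x, x) := by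
    have : ∀ᶠ p in 𝓝 (unitPt E D, unitPt E D), DifferentiableAt ℝ (divChart E D) p :=
      (((contDiffAt_divChart (E := E) (D := D)).of_le
        (by exact_mod_cast le_top : (1 : WithTop ℕ∞) ≤ ∞)).eventually (by simp)).mono
        fun w hw => hw.differentiableAt (by simp)
    exact (continuous_id.prodMk continuous_id).continuousAt.eventually this
  have h0 : coord (E := E) φ z z = unitPt E D := by simp [coord]
  have h3 : ∀ᶠ w in 𝓝 z, DifferentiableAt ℝ (divChart E D) (coord φ z w, coord φ z w) := by
    have h2' : ∀ᶠ x in 𝓝 (coord (E := E) φ z z), DifferentiableAt ℝ (divChart E D) (x, x) := by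
      rwa [h0]
    exact hψ.continuousAt.eventually h2'
  have h4 := (unitChart_left_inv_eventually (E := E)
    (hφ.mul_const (φ z)⁻¹).continuousAt (mul_inv_cancel _)).eventually_nhds
  filter_upwards [h1, h3, h4] with w h1 h3 h4
  -- The factor `φ(z)⁻¹` cancels in a quotient, so one chart centred at `φ z` serves for all `w`
  -- near `z`.
  have e : (fun w' => unitChart E D (φ w' * (φ w)⁻¹)) =ᶠ[𝓝 w]
      divChart E D ∘ fun w' => (coord φ z w', coord φ z w) := by
    filter_upwards [h4] with w' hw'
    simp only [Function.comp_apply, divChart, coord, hw', h4.self_of_nhds]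
    congr 1
    group
  rw [rlog, e.fderiv_eq, (HasFDerivAt.comp w (f := fun w' => (coord φ z w', coord φ z w))
    h3.hasFDerivAt (h1.hasFDerivAt.prodMk (hasFDerivAt_const _ _))).fderiv]
  ext u
  simp [mcForm]

theorem contDiffAt_rlog {φ : M → D} {z : M} (hφ : SmoothAt E φ z) :
    ContDiffAt ℝ ∞ (rlog E φ) z := by
  have hψ := contDiffAt_rlog_aux hφ
  refine ContDiffAt.congr_of_eventuallyEq ?_ (rlog_eventuallyEq hφ)
  refine ContDiffAt.clm_comp ?_ (hψ.fderiv_right (m := ∞) (by simp))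
  refine ContDiffAt.comp (g := mcForm E D) z ?_ hψ
  rw [show coord (E := E) φ z z = unitPt E D by simp [coord]]; exact contDiffAt_mcForm

/-- The Maurer–Cartan equation. -/
theorem maurerCartan {φ : M → D} {z : M} (hφ : SmoothAt E φ z) (u v : M) :
    fderiv ℝ (rlog E φ) z u v - fderiv ℝ (rlog E φ) z v u =
      rbracket E D (rlog E φ z u) (rlog E φ z v) := by
  have hψ : ContDiffAt ℝ ∞ (coord (E := E) φ z) z := contDiffAt_rlog_aux hφ
  have h0 : coord (E := E) φ z z = unitPt E D := by simp [coord]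
  have hN : HasFDerivAt (mcForm E D) (fderiv ℝ (mcForm E D) (unitPt E D)) (coord φ z z) := by
    rw [h0]
    exact ((contDiffAt_mcForm (E := E) (D := D)).differentiableAt (by simp)).hasFDerivAt
  have hd := (hψ.differentiableAt (by simp)).hasFDerivAt
  have hd2 := ((hψ.fderiv_right (m := ∞) (by simp)).differentiableAt (by simp)).hasFDerivAt
  -- By symmetry the second derivative of the coordinates drops out after antisymmetrization; only
  -- the derivative of the Maurer–Cartan form survives, and that is the bracket.
  have hs : IsSymmSndFDerivAt ℝ (coord (E := E) φ z) z :=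
    (contDiffAt_infty.1 hψ 2).isSymmSndFDerivAt (by simp)
  have key := ((hN.comp z hd).clm_comp hd2).congr_of_eventuallyEq (rlog_eventuallyEq hφ)
  have hz : rlog E φ z = fderiv ℝ (coord φ z) z := rfl
  rw [key.fderiv, hz, rbracket]
  have := hs.eq u v
  simp [h0, mcForm_unitPt, this]

theorem maurerCartan' {φ : M → D} {z : M} (hφ : SmoothAt E φ z) (u v : M) :
    fderiv ℝ (fun w => rlog E φ w v) z u - fderiv ℝ (fun w => rlog E φ w u) z v =
      rbracket E D (rlog E φ z u) (rlog E φ z v) := by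
  have h := (contDiffAt_rlog hφ).differentiableAt (by simp)
  rw [← maurerCartan hφ, fderiv_clm_apply h (by fun_prop), fderiv_clm_apply h (by fun_prop)]
  simp

theorem rlog_unitChart_symm :
    rlog E (unitChart E D).symm (unitPt E D) = ContinuousLinearMap.id ℝ E := by
  refine HasFDerivAt.fderiv ((hasFDerivAt_id (unitPt E D)).congr_of_eventuallyEq ?_)
  filter_upwards [unitChart_right_inv_eventually (E := E) (D := D)] with x hx
  simp [unitChart_symm_unitPt, hx]

/-- The inverse chart has the identity as logarithmic derivative at the unit, so conjugating it
exhibits `AdE` itself as a logarithmic derivative. Two conjugations in a row then give the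
composition. -/
theorem AdE_mul (a b : D) : AdE E (a * b) = (AdE E a).comp (AdE E b) := by
  have h := rlog_conj (E := E) (a * b) (smoothAt_unitChart_symm (E := E) (D := D))
  have h' := rlog_conj (E := E) a
    (((smoothAt_unitChart_symm (E := E) (D := D)).const_mul b).mul_const b⁻¹)
  rw [rlog_conj (E := E) b (smoothAt_unitChart_symm (E := E) (D := D))] at h'
  rw [rlog_unitChart_symm] at h h'
  simp only [ContinuousLinearMap.comp_id] at h h'
  rw [← h, ← h']
  congr 1
  funext w
  group

theorem AdE_one : AdE E (1 : D) = ContinuousLinearMap.id ℝ E := by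
  have h := rlog_conj (E := E) (1 : D) (smoothAt_unitChart_symm (E := E) (D := D))
  rw [rlog_unitChart_symm] at h
  simpa [rlog_unitChart_symm] using h.symm

/-- `Ad_φ y` is the logarithmic derivative of `(w, q) ↦ φ(w) q` in the direction `y`. -/
theorem rlog_mul_unitChart_symm {φ : M → D} {z : M} (hφ : SmoothAt E φ z) (y : E) :
    rlog E (fun p : M × E => φ p.1 * (unitChart E D).symm p.2) (z, unitPt E D) (0, y) =
      AdE E (φ z) y := by
  have h1 : SmoothAt E (fun p : M × E => φ p.1) (z, unitPt E D) :=
    ContMDiffAt.comp (I' := 𝓘(ℝ, M)) _ hφ contDiffAt_fst.contMDiffAt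
  have h2 : SmoothAt E (fun p : M × E => (unitChart E D).symm p.2) (z, unitPt E D) :=
    ContMDiffAt.comp (I' := 𝓘(ℝ, E)) _ smoothAt_unitChart_symm contDiffAt_snd.contMDiffAt
  rw [rlog_mul h1 h2, rlog_comp (j := Prod.fst) hφ hasFDerivAt_fst,
    rlog_comp (j := Prod.snd) smoothAt_unitChart_symm hasFDerivAt_snd, rlog_unitChart_symm]
  simp

theorem smoothAt_mul_unitChart_symm {φ : M → D} {z : M} (hφ : SmoothAt E φ z) :
    SmoothAt E (fun p : M × E => φ p.1 * (unitChart E D).symm p.2) (z, unitPt E D) := by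
  have h1 : SmoothAt E (fun p : M × E => φ p.1) (z, unitPt E D) :=
    ContMDiffAt.comp (I' := 𝓘(ℝ, M)) _ hφ contDiffAt_fst.contMDiffAt
  have h2 : SmoothAt E (fun p : M × E => (unitChart E D).symm p.2) (z, unitPt E D) :=
    ContMDiffAt.comp (I' := 𝓘(ℝ, E)) _ smoothAt_unitChart_symm contDiffAt_snd.contMDiffAt
  exact h1.mul h2

/-- The adjoint action is smooth. -/
theorem contDiff_AdE {φ : M → D} (hφ : ∀ z, SmoothAt E φ z) (y : E) :
    ContDiff ℝ ∞ (fun z => AdE E (φ z) y) := by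
  rw [contDiff_iff_contDiffAt]
  intro z
  have h := contDiffAt_rlog (smoothAt_mul_unitChart_symm (hφ z))
  have h' : ContDiffAt ℝ ∞ (fun w : M => rlog E
      (fun p : M × E => φ p.1 * (unitChart E D).symm p.2) (w, unitPt E D) (0, y)) z :=
    (ContDiffAt.comp (f := fun w : M => (w, unitPt E D)) z h
      (contDiffAt_id.prodMk contDiffAt_const)).clm_apply contDiffAt_const
  simpa only [rlog_mul_unitChart_symm (hφ _)] using h'

/-- The derivative of the adjoint action is the bracket. -/
theorem hasFDerivAt_AdE_unitChart_symm (y u : E) :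
    DifferentiableAt ℝ (fun x : E => AdE E ((unitChart E D).symm x) y) (unitPt E D) ∧
    fderiv ℝ (fun x : E => AdE E ((unitChart E D).symm x) y) (unitPt E D) u =
      rbracket E D u y := by
  have hs := smoothAt_unitChart_symm (E := E) (D := D)
  have h := smoothAt_mul_unitChart_symm hs
  -- The Maurer–Cartan equation is applied to the product map at the unit. Along `(x, 1)` its
  -- component in the direction `(0, y)` is `Ad_x y`; along `(1, q)` its component in the direction
  -- `(u, 0)` is the constant `u`.
  set Ψ : E × E → D := fun p => (unitChart E D).symm p.1 * (unitChart E D).symm p.2 with hΨ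
  have hev : ∀ᶠ x in 𝓝 (unitPt E D), rlog E Ψ (x, unitPt E D) (0, y) =
      AdE E ((unitChart E D).symm x) y := by
    have := isManifold_of_lieGroup (E := E) (D := D)
    filter_upwards [(extChartAt_target_mem_nhds (I := 𝓘(ℝ, E)) (1 : D))] with x hx
    exact rlog_mul_unitChart_symm ((contMDiffOn_extChartAt_symm (I := 𝓘(ℝ, E)) (n := ∞)
      (1 : D)).contMDiffAt ((isOpen_extChartAt_target (I := 𝓘(ℝ, E)) (1 : D)).mem_nhds hx)) y
  have hd := (contDiffAt_rlog h).differentiableAt (by simp)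
  have hd' : HasFDerivAt (fun p => rlog E Ψ p (0, y))
      ((fderiv ℝ (rlog E Ψ) (unitPt E D, unitPt E D)).flip (0, y)) (unitPt E D, unitPt E D) := by
    have := hd.hasFDerivAt.clm_apply (hasFDerivAt_const ((0, y) : E × E) _)
    simpa using this
  have h1 := (HasFDerivAt.comp (f := fun x => (x, unitPt E D)) (unitPt E D) hd'
    (hasFDerivAt_prodMk_left (𝕜 := ℝ) (unitPt E D) (unitPt E D))).congr_of_eventuallyEq
    (hev.mono fun x hx => hx.symm)
  refine ⟨h1.differentiableAt, ?_⟩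
  -- the derivative of the other component vanishes
  have h3 : fderiv ℝ (fun p => rlog E Ψ p (u, 0)) (unitPt E D, unitPt E D) (0, y) = 0 := by
    have hd'' : HasFDerivAt (fun p => rlog E Ψ p (u, 0))
        ((fderiv ℝ (rlog E Ψ) (unitPt E D, unitPt E D)).flip (u, 0))
        (unitPt E D, unitPt E D) := by
      have := hd.hasFDerivAt.clm_apply (hasFDerivAt_const ((u, 0) : E × E) _)
      simpa using this
    have h4 := HasFDerivAt.comp (f := fun x => (unitPt E D, x)) (unitPt E D) hd''
      (hasFDerivAt_prodMk_right (𝕜 := ℝ) (unitPt E D) (unitPt E D))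
    have h5 : ((fun p => rlog E Ψ p (u, 0)) ∘ fun x => (unitPt E D, x)) =ᶠ[𝓝 (unitPt E D)]
        fun _ => u := by
      have := isManifold_of_lieGroup (E := E) (D := D)
      filter_upwards [(extChartAt_target_mem_nhds (I := 𝓘(ℝ, E)) (1 : D))] with x hx
      have hx' : SmoothAt E (unitChart E D).symm x :=
        (contMDiffOn_extChartAt_symm (I := 𝓘(ℝ, E)) (n := ∞)
          (1 : D)).contMDiffAt ((isOpen_extChartAt_target (I := 𝓘(ℝ, E)) (1 : D)).mem_nhds hx)
      have k1 : SmoothAt E (fun p : E × E => (unitChart E D).symm p.1) (unitPt E D, x) :=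
        ContMDiffAt.comp (I' := 𝓘(ℝ, E)) _ hs contDiffAt_fst.contMDiffAt
      have k2 : SmoothAt E (fun p : E × E => (unitChart E D).symm p.2) (unitPt E D, x) :=
        ContMDiffAt.comp (I' := 𝓘(ℝ, E)) _ hx' contDiffAt_snd.contMDiffAt
      simp only [Function.comp_apply, hΨ]
      rw [rlog_mul k1 k2, rlog_comp (j := Prod.fst) hs hasFDerivAt_fst,
        rlog_comp (j := Prod.snd) hx' hasFDerivAt_snd, rlog_unitChart_symm]
      simp
    rw [hd''.fderiv]
    have h6 := h4.unique ((hasFDerivAt_const u (unitPt E D)).congr_of_eventuallyEq h5)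
    have := DFunLike.congr_fun h6 y
    simpa using this
  have h7 := maurerCartan' h (u, 0) (0, y)
  rw [h3, hd'.fderiv, rlog_mul_unitChart_symm hs] at h7
  have h8 : rlog E Ψ (unitPt E D, unitPt E D) (u, 0) = u := by
    have k1 : SmoothAt E (fun p : E × E => (unitChart E D).symm p.1) (unitPt E D, unitPt E D) :=
      ContMDiffAt.comp (I' := 𝓘(ℝ, E)) _ hs contDiffAt_fst.contMDiffAt
    have k2 : SmoothAt E (fun p : E × E => (unitChart E D).symm p.2) (unitPt E D, unitPt E D) :=
      ContMDiffAt.comp (I' := 𝓘(ℝ, E)) _ hs contDiffAt_snd.contMDiffAt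
    rw [hΨ, rlog_mul k1 k2, rlog_comp (j := Prod.fst) hs hasFDerivAt_fst,
      rlog_comp (j := Prod.snd) hs hasFDerivAt_snd, rlog_unitChart_symm]
    simp
  rw [h8, unitChart_symm_unitPt, AdE_one] at h7
  rw [h1.fderiv]
  simpa using h7

/-- Differentiate `⟨Ad_w y | Ad_w z⟩ = ⟨y | z⟩` at `w = 1` in the direction `x`. -/
theorem invariant_rbracket [FiniteDimensional ℝ E] {B : LinearMap.BilinForm ℝ E}
    (hB : ∀ (d : D) (x y : E), B (AdE E d x) (AdE E d y) = B x y) (x y z : E) :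
    B (rbracket E D x y) z + B y (rbracket E D x z) = 0 := by
  obtain ⟨hy, hy'⟩ := hasFDerivAt_AdE_unitChart_symm (E := E) (D := D) y x
  obtain ⟨hz, hz'⟩ := hasFDerivAt_AdE_unitChart_symm (E := E) (D := D) z x
  have hb : IsBoundedBilinearMap ℝ (fun p : E × E => B p.1 p.2) :=
    (LinearMap.toContinuousBilinearMap B).isBoundedBilinearMap
  have h := HasFDerivAt.comp (f := fun w => (AdE E ((unitChart E D).symm w) y,
      AdE E ((unitChart E D).symm w) z)) (unitPt E D) (hb.hasFDerivAt _)
    (hy.hasFDerivAt.prodMk hz.hasFDerivAt)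
  have h' : ((fun p : E × E => B p.1 p.2) ∘ fun w => (AdE E ((unitChart E D).symm w) y,
      AdE E ((unitChart E D).symm w) z)) = fun _ => B y z := by
    funext w; exact hB _ _ _
  rw [h'] at h
  have k := DFunLike.congr_fun (h.unique (hasFDerivAt_const _ _)) x
  simp only [unitChart_symm_unitPt, AdE_one, ContinuousLinearMap.comp_apply,
    ContinuousLinearMap.prod_apply, hy', hz', IsBoundedBilinearMap.deriv_apply,
    ContinuousLinearMap.id_apply] at k
  rw [add_comm]
  simpa using k

theorem rbracket_swap (x y : E) : rbracket E D x y = -rbracket E D y x := by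
  simp [rbracket]

end MaurerCartan

/-! ### From manifold derivatives to derivatives in the chart at the unit. -/

section Bridge

variable {E : Type*} [NormedAddCommGroup E] [NormedSpace ℝ E]
  {D : Type*} [TopologicalSpace D] [ChartedSpace E D] [Group D]
  {E' : Type*} [NormedAddCommGroup E'] [NormedSpace ℝ E']
  {S : Type*} [TopologicalSpace S] [ChartedSpace E' S] [Group S]

/-- The statement is phrased with `mfderiv`, the computations with `fderiv` in charts. This lemma
links the two for adjoint actions and for homomorphisms. -/
theorem mfderiv_one_eq_tang {X : S → D} (hX : MDifferentiableAt 𝓘(ℝ, E') 𝓘(ℝ, E) X 1)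
    (hX1 : X 1 = 1) (v : E') :
    (mfderiv 𝓘(ℝ, E') 𝓘(ℝ, E) X 1 v : E) = tang (E := E) (E' := E') X v := by
  refine (DFunLike.congr_fun hX.mfderiv v).trans ?_
  change fderivWithin ℝ (writtenInExtChartAt 𝓘(ℝ, E') 𝓘(ℝ, E) 1 X) (Set.range 𝓘(ℝ, E'))
    (extChartAt 𝓘(ℝ, E') (1 : S) 1) v = tang (E := E) (E' := E') X v
  simp only [writtenInExtChartAt, modelWithCornersSelf_coe, Set.range_id, fderivWithin_univ]
  rw [hX1]
  rfl

variable [LieGroup 𝓘(ℝ, E) ∞ D]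

theorem Ad_eq_AdE (d : D) (v : E) : (Ad E d v : E) = AdE E d v :=
  mfderiv_one_eq_tang ((contMDiff_conj (E := E) d).contMDiffAt.mdifferentiableAt (by simp))
    (by simp) v

theorem dHom_eq_tang {i : S →* D} (hi : ContMDiff 𝓘(ℝ, E') 𝓘(ℝ, E) ∞ i) (v : E') :
    (dHom E E' i v : E) = tang (E := E) (E' := E') i v :=
  mfderiv_one_eq_tang (hi.contMDiffAt.mdifferentiableAt (by simp)) (map_one i) v

theorem logDeriv_eq_rlog {φ : Worldsheet → D} {z : Worldsheet} (hφ : SmoothAt E φ z)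
    (u : Worldsheet) : (logDeriv E φ z u : E) = rlog E φ z u := by
  have h : MDifferentiableAt 𝓘(ℝ, Worldsheet) 𝓘(ℝ, E) (fun w => φ w * (φ z)⁻¹) z :=
    ContMDiffAt.mdifferentiableAt (hφ.mul_const _) (by simp)
  refine (DFunLike.congr_fun h.mfderiv u).trans ?_
  change fderivWithin ℝ (writtenInExtChartAt 𝓘(ℝ, Worldsheet) 𝓘(ℝ, E) z
    (fun w => φ w * (φ z)⁻¹)) (Set.range 𝓘(ℝ, Worldsheet))
    (extChartAt 𝓘(ℝ, Worldsheet) z z) u = rlog E φ z u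
  simp only [writtenInExtChartAt, modelWithCornersSelf_coe, Set.range_id, fderivWithin_univ]
  rw [mul_inv_cancel]
  rfl

variable [LieGroup 𝓘(ℝ, E') ∞ S]

theorem mem_lieAlgebraOf {i : S →* D} (hi : ContMDiff 𝓘(ℝ, E') 𝓘(ℝ, E) ∞ i) (x : E) :
    (x : Lie E D) ∈ lieAlgebraOf E E' i ↔ ∃ v : E', tang (E := E) (E' := E') i v = x := by
  constructor
  · rintro ⟨v, hv⟩
    exact ⟨v, (dHom_eq_tang hi v).symm.trans hv⟩
  · rintro ⟨v, hv⟩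
    exact ⟨v, (dHom_eq_tang hi v).trans hv⟩

variable {M : Type*} [NormedAddCommGroup M] [NormedSpace ℝ M]

theorem smoothAt_hom {i : S →* D} (hi : ContMDiff 𝓘(ℝ, E') 𝓘(ℝ, E) ∞ i)
    {φ : M → S} {z : M} (hφ : SmoothAt E' φ z) : SmoothAt E (fun w => i (φ w)) z :=
  ContMDiffAt.comp (I' := 𝓘(ℝ, E')) z hi.contMDiffAt hφ

/-- The logarithmic derivative of a field with values in a subgroup has values in its Lie
algebra. -/
theorem rlog_mem {i : S →* D} (hi : ContMDiff 𝓘(ℝ, E') 𝓘(ℝ, E) ∞ i)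
    {φ : M → S} {z : M} (hφ : SmoothAt E' φ z) (u : M) :
    (rlog E (fun w => i (φ w)) z u : Lie E D) ∈ lieAlgebraOf E E' i := by
  rw [mem_lieAlgebraOf hi, rlog_hom hi.contMDiffAt hφ]
  exact ⟨_, rfl⟩

/-- Since `i` intertwines conjugation by `s` with conjugation by `i s`, one has `Ad_{i s} (di v) =
di (Ad_s v)`. -/
theorem Ad_mem_lieAlgebraOf {i : S →* D} (hi : ContMDiff 𝓘(ℝ, E') 𝓘(ℝ, E) ∞ i) (s : S)
    {x : Lie E D} (hx : x ∈ lieAlgebraOf E E' i) : Ad E (i s) x ∈ lieAlgebraOf E E' i := by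
  obtain ⟨v, rfl⟩ := (mem_lieAlgebraOf hi x).1 hx
  refine (mem_lieAlgebraOf hi _).2 ⟨AdE E' s v, ?_⟩
  refine Eq.trans ?_ (Ad_eq_AdE (E := E) (i s) (tang (E := E) (E' := E') i v)).symm
  have hs := smoothAt_unitChart_symm (E := E') (D := S)
  have h1 := rlog_conj (E := E) (i s) (smoothAt_hom hi hs)
  have h2 := rlog_hom (E := E) hi.contMDiffAt ((hs.const_mul s).mul_const s⁻¹)
  rw [rlog_conj (E := E') s hs] at h2
  rw [rlog_hom hi.contMDiffAt hs] at h1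
  simp only [map_mul, map_inv] at h2
  rw [h1, rlog_unitChart_symm] at h2
  simpa using (DFunLike.congr_fun h2 v).symm

theorem Ad_mul (a b : D) (x : Lie E D) : Ad E (a * b) x = Ad E a (Ad E b x) := by
  have h1 := Ad_eq_AdE (E := E) (a * b) x
  have h2 := Ad_eq_AdE (E := E) b x
  have h3 := Ad_eq_AdE (E := E) a (Ad E b x)
  rw [AdE_mul] at h1
  exact h1.trans ((congrArg (AdE E a) h2).symm.trans h3.symm)

theorem Ad_one (x : Lie E D) : Ad E (1 : D) x = x := by
  have h1 := Ad_eq_AdE (E := E) (1 : D) x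
  rw [AdE_one] at h1
  exact h1

theorem Ad_inv_Ad (a : D) (x : Lie E D) : Ad E a⁻¹ (Ad E a x) = x := by
  rw [← Ad_mul, inv_mul_cancel, Ad_one]

theorem Ad_Ad_inv (a : D) (x : Lie E D) : Ad E a (Ad E a⁻¹ x) = x := by
  rw [← Ad_mul, mul_inv_cancel, Ad_one]

end Bridge

/-! ### Smoothness of the factorization `l = g ĥ`. -/

section Factor

variable {E EG EH : Type*}
  [NormedAddCommGroup E] [NormedSpace ℝ E] [NormedAddCommGroup EG] [NormedSpace ℝ EG]
  [NormedAddCommGroup EH] [NormedSpace ℝ EH]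
  {D G H : Type*}
  [TopologicalSpace D] [ChartedSpace E D] [Group D]
  [TopologicalSpace G] [ChartedSpace EG G] [Group G]
  [TopologicalSpace H] [ChartedSpace EH H] [Group H]
  [FiniteDimensional ℝ E]
  [LieGroup 𝓘(ℝ, E) ∞ D] [LieGroup 𝓘(ℝ, EG) ∞ G] [LieGroup 𝓘(ℝ, EH) ∞ H]

theorem tang_injective {i : G →* D} (hi : IsLieSubgroup E EG i) :
    Function.Injective (tang (E := E) (E' := EG) i) := by
  intro x y hxy
  refine hi.immersive (?_ : dHom E EG i x = dHom E EG i y)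
  exact (dHom_eq_tang hi.smooth x).trans (hxy.trans (dHom_eq_tang hi.smooth y).symm)

/-- This supplies the completeness of the model spaces used by the inverse function theorem. -/
theorem finiteDimensional_of_isLieSubgroup {i : G →* D} (hi : IsLieSubgroup E EG i) :
    FiniteDimensional ℝ EG :=
  FiniteDimensional.of_injective (tang (E := E) (E' := EG) i).toLinearMap (tang_injective hi)

/-- If two Lie subgroups have complementary Lie algebras, then every element close to `1` is a
product, with factors depending smoothly on it. -/
theorem exists_local_factorization {iG : G →* D} {iH : H →* D} (hG : IsLieSubgroup E EG iG)
    (hH : IsLieSubgroup E EH iH)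
    (hc : IsCompl (lieAlgebraOf E EG iG) (lieAlgebraOf E EH iH)) :
    ∃ s : D → G × H, (∀ᶠ l in 𝓝 (1 : D), iG (s l).1 * iH (s l).2 = l) ∧
      ContMDiffAt 𝓘(ℝ, E) 𝓘(ℝ, EG) ∞ (fun l => (s l).1) 1 := by
  have := finiteDimensional_of_isLieSubgroup hG
  have := finiteDimensional_of_isLieSubgroup hH
  have := FiniteDimensional.complete ℝ EG
  have := FiniteDimensional.complete ℝ EH
  set p0 : EG × EH := (unitPt EG G, unitPt EH H) with hp0
  set φ : EG × EH → D := fun p => iG ((unitChart EG G).symm p.1) * iH ((unitChart EH H).symm p.2)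
    with hφ
  have sG := smoothAt_unitChart_symm (E := EG) (D := G)
  have sH := smoothAt_unitChart_symm (E := EH) (D := H)
  have k1 : SmoothAt E (fun p : EG × EH => iG ((unitChart EG G).symm p.1)) p0 :=
    ContMDiffAt.comp (I' := 𝓘(ℝ, EG)) p0
      (g := fun x => iG ((unitChart EG G).symm x)) (smoothAt_hom hG.smooth sG)
      contDiffAt_fst.contMDiffAt
  have k2 : SmoothAt E (fun p : EG × EH => iH ((unitChart EH H).symm p.2)) p0 :=
    ContMDiffAt.comp (I' := 𝓘(ℝ, EH)) p0
      (g := fun x => iH ((unitChart EH H).symm x)) (smoothAt_hom hH.smooth sH)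
      contDiffAt_snd.contMDiffAt
  have hφs : SmoothAt E φ p0 := k1.mul k2
  have hφ1 : φ p0 = 1 := by simp [hφ, hp0, unitChart_symm_unitPt]
  set κ : EG × EH → E := fun p => unitChart E D (φ p) with hκ
  have hκs : ContDiffAt ℝ ∞ κ p0 := contDiffAt_unitChart_comp hφs hφ1
  -- At the unit the product map has as derivative the sum of the two inclusions of Lie algebras,
  -- which is bijective exactly because these are complementary.
  have hκd : ∀ u : EG × EH, fderiv ℝ κ p0 u =
      tang (E := E) (E' := EG) iG u.1 + tang (E := E) (E' := EH) iH u.2 := by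
    intro u
    have h : fderiv ℝ κ p0 = rlog E φ p0 := by simp [rlog, hφ1, hκ]
    rw [h, hφ, rlog_mul k1 k2,
      rlog_comp (j := Prod.fst) (smoothAt_hom hG.smooth sG) hasFDerivAt_fst,
      rlog_comp (j := Prod.snd) (smoothAt_hom hH.smooth sH) hasFDerivAt_snd,
      rlog_hom hG.smooth.contMDiffAt sG, rlog_hom hH.smooth.contMDiffAt sH,
      rlog_unitChart_symm, rlog_unitChart_symm]
    simp [hp0, unitChart_symm_unitPt, AdE_one]
  have hbij : Function.Bijective (fderiv ℝ κ p0) := by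
    constructor
    · rw [injective_iff_map_eq_zero]
      intro u hu
      rw [hκd] at hu
      have h1 : (tang (E := E) (E' := EG) iG u.1 : Lie E D) ∈ lieAlgebraOf E EG iG :=
        (mem_lieAlgebraOf hG.smooth _).2 ⟨_, rfl⟩
      have h2 : (tang (E := E) (E' := EG) iG u.1 : Lie E D) ∈ lieAlgebraOf E EH iH := by
        refine (mem_lieAlgebraOf hH.smooth _).2 ⟨-u.2, ?_⟩
        rw [map_neg, eq_neg_of_add_eq_zero_left hu]
      have h3 : tang (E := E) (E' := EG) iG u.1 = 0 :=
        Submodule.disjoint_def.1 hc.disjoint _ h1 h2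
      have h4 : tang (E := E) (E' := EH) iH u.2 = 0 := by rwa [h3, zero_add] at hu
      exact Prod.ext (tang_injective hG (h3.trans (map_zero _).symm))
        (tang_injective hH (h4.trans (map_zero _).symm))
    · intro x
      have hx : (x : Lie E D) ∈ lieAlgebraOf E EG iG ⊔ lieAlgebraOf E EH iH := by
        rw [hc.sup_eq_top]; trivial
      obtain ⟨y, hy, z, hz, hyz⟩ := (Submodule.mem_sup (x := (x : Lie E D))).1 hx
      obtain ⟨u, rfl⟩ := (mem_lieAlgebraOf hG.smooth y).1 hy
      obtain ⟨v, rfl⟩ := (mem_lieAlgebraOf hH.smooth z).1 hz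
      exact ⟨(u, v), (hκd _).trans hyz⟩
  let L : (EG × EH) ≃L[ℝ] E := (LinearEquiv.ofBijective
    (fderiv ℝ κ p0 : EG × EH →ₗ[ℝ] E) hbij).toContinuousLinearEquiv
  have hκL : HasFDerivAt κ (L : EG × EH →L[ℝ] E) p0 := by
    have h : (L : EG × EH →L[ℝ] E) = fderiv ℝ κ p0 := by ext <;> rfl
    rw [h]
    exact (hκs.differentiableAt (by simp)).hasFDerivAt
  have hn : (∞ : WithTop ℕ∞) ≠ 0 := by simp
  set σ : E → EG × EH := hκs.localInverse hκL hn with hσ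
  have hσ0 : σ (κ p0) = p0 := hκs.localInverse_apply_image hκL hn
  have hσs : ContDiffAt ℝ ∞ σ (κ p0) := hκs.to_localInverse hκL hn
  have hσr : ∀ᶠ y in 𝓝 (κ p0), κ (σ y) = y :=
    (hκs.hasStrictFDerivAt' hκL hn).eventually_right_inverse
  have hκ0 : κ p0 = unitPt E D := by rw [hκ]; simp only [hφ1]
  have cD : ContMDiffAt 𝓘(ℝ, E) 𝓘(ℝ, E) ∞ (unitChart E D) (1 : D) := by
    have := isManifold_of_lieGroup (E := E) (D := D)
    exact contMDiffAt_extChartAt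
  refine ⟨fun l => ((unitChart EG G).symm (σ (unitChart E D l)).1,
    (unitChart EH H).symm (σ (unitChart E D l)).2), ?_, ?_⟩
  · have e1 : ∀ᶠ y in 𝓝 (κ p0), (unitChart E D).symm (κ (σ y)) = φ (σ y) := by
      have hc : ContinuousAt (fun y => φ (σ y)) (κ p0) :=
        ContinuousAt.comp (g := φ) (by rw [hσ0]; exact hφs.continuousAt) hσs.continuousAt
      exact unitChart_left_inv_eventually hc (by rw [hσ0, hφ1])
    have e2 := hσr.and e1
    rw [hκ0] at e2
    have e3 := cD.continuousAt.eventually e2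
    have e4 : ∀ᶠ l in 𝓝 (1 : D), (unitChart E D).symm (unitChart E D l) = l := by
      filter_upwards [extChartAt_source_mem_nhds (I := 𝓘(ℝ, E)) (1 : D)] with l hl
      exact (unitChart E D).left_inv hl
    filter_upwards [e3, e4] with l h3 h4
    rw [h3.1, h4] at h3
    exact h3.2.symm
  · have h1 : ContMDiffAt 𝓘(ℝ, E) 𝓘(ℝ, EG × EH) ∞ (fun l : D => σ (unitChart E D l)) 1 := by
      refine ContMDiffAt.comp (I' := 𝓘(ℝ, E)) (1 : D) (g := σ) ?_ cD
      have := hσs.contMDiffAt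
      rwa [hκ0] at this
    have h2 : ContMDiffAt 𝓘(ℝ, E) 𝓘(ℝ, EG) ∞ (fun l : D => (σ (unitChart E D l)).1) 1 :=
      ContMDiffAt.comp (I' := 𝓘(ℝ, EG × EH)) (1 : D) (g := Prod.fst) contDiffAt_fst.contMDiffAt h1
    refine ContMDiffAt.comp (I' := 𝓘(ℝ, EG)) (1 : D) (g := (unitChart EG G).symm) ?_ h2
    have h3 : (σ (unitChart E D (1 : D))).1 = unitPt EG G := by
      rw [show unitChart E D 1 = κ p0 from hκ0.symm, hσ0]
    rw [h3]
    exact sG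

namespace PerfectDouble

variable (P : PerfectDouble E EG EH D G H)

theorem factor_mul_inH (l : D) (h : H) : P.factor (l * P.inH h) = P.factor l := by
  obtain ⟨h', e⟩ := P.factor_spec l
  refine P.factor_eq (h := h' * h) ?_
  rw [map_mul, ← mul_assoc, ← e]

theorem factor_inG_mul (g : G) (l : D) : P.factor (P.inG g * l) = g * P.factor l := by
  obtain ⟨h', e⟩ := P.factor_spec l
  refine P.factor_eq (h := h') ?_
  rw [map_mul, mul_assoc, ← e]

/-- The factor in `G` of `l = g ĥ` depends smoothly on `l`. -/
theorem contMDiff_factor : ContMDiff 𝓘(ℝ, E) 𝓘(ℝ, EG) ∞ P.factor := by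
  obtain ⟨s, hs, hs'⟩ := exists_local_factorization P.isLieSubgroup_inG P.isLieSubgroup_inH
    P.isCompl
  have h1 : ContMDiffAt 𝓘(ℝ, E) 𝓘(ℝ, EG) ∞ P.factor 1 := by
    refine hs'.congr_of_eventuallyEq ?_
    filter_upwards [hs] with l hl
    exact P.factor_eq hl.symm
  intro l₀
  obtain ⟨h₀, e⟩ := P.factor_spec l₀
  -- The factor in `G` is equivariant under left translation by `G` and invariant under right
  -- translation by `Ĝ`. These translations carry `l₀` to `1`, where smoothness is known.
  have h2 : P.factor = fun l => P.factor l₀ *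
      P.factor ((P.inG (P.factor l₀))⁻¹ * l * (P.inH h₀)⁻¹) := by
    funext l
    rw [← map_inv, ← map_inv, P.factor_mul_inH, P.factor_inG_mul, mul_inv_cancel_left]
  rw [h2]
  refine ContMDiffAt.mul contMDiffAt_const ?_
  have h3 : ContMDiff 𝓘(ℝ, E) 𝓘(ℝ, E) ∞
      (fun l : D => (P.inG (P.factor l₀))⁻¹ * l * (P.inH h₀)⁻¹) :=
    (contMDiff_const.mul contMDiff_id).mul contMDiff_const
  refine ContMDiffAt.comp l₀ (I' := 𝓘(ℝ, E)) (g := P.factor) ?_ h3.contMDiffAt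
  have h4 : (P.inG (P.factor l₀))⁻¹ * l₀ * (P.inH h₀)⁻¹ = 1 := by
    rw [mul_inv_eq_one, inv_mul_eq_iff_eq_mul, ← e]
  rw [h4]
  exact h1

/-- The factor in `Ĝ` of `l = g ĥ`. -/
def cofactor (l : D) : H := (P.swap.factor l⁻¹)⁻¹

theorem factor_mul_cofactor (l : D) : P.inG (P.factor l) * P.inH (P.cofactor l) = l := by
  obtain ⟨h, e⟩ := P.factor_spec l
  have : P.swap.factor l⁻¹ = h⁻¹ := by
    refine P.swap.factor_eq (h := (P.factor l)⁻¹) ?_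
    change l⁻¹ = P.inH h⁻¹ * P.inG (P.factor l)⁻¹
    rw [map_inv, map_inv, ← mul_inv_rev, ← e]
  rw [cofactor, this, inv_inv, ← e]

theorem contMDiff_cofactor : ContMDiff 𝓘(ℝ, E) 𝓘(ℝ, EH) ∞ P.cofactor := by
  have h : ContMDiff 𝓘(ℝ, E) 𝓘(ℝ, E) ∞ (fun l : D => l⁻¹) := contMDiff_inv 𝓘(ℝ, E) ∞
  have h1 : ContMDiff 𝓘(ℝ, E) 𝓘(ℝ, EH) ∞ (fun l : D => P.swap.factor l⁻¹) :=
    P.swap.contMDiff_factor.comp h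
  exact h1.inv

end PerfectDouble

end Factor

/-! ### The closed `2`-form that measures the change of the Lagrangian. -/

section ClosedForm

variable {E : Type*} [NormedAddCommGroup E] [NormedSpace ℝ E]
  {D : Type*} [TopologicalSpace D] [ChartedSpace E D] [Group D]
  {M : Type*} [NormedAddCommGroup M] [NormedSpace ℝ M]

theorem rbracket_sub_left (x y z : E) :
    rbracket E D (x - y) z = rbracket E D x z - rbracket E D y z := by
  simp [rbracket]; abel

theorem rbracket_sub_right (x y z : E) :
    rbracket E D x (y - z) = rbracket E D x y - rbracket E D x z := by
  simp [rbracket]; abel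

variable (E) in
/-- The map `φ` takes values in a translate of an isotropic subgroup. -/
def IsIsotropicMap (B : LinearMap.BilinForm ℝ E) (φ : M → D) : Prop :=
  ∀ w w' u u', B (rlog E φ w u) (rlog E φ w' u') = 0

variable [LieGroup 𝓘(ℝ, E) ∞ D] [FiniteDimensional ℝ E] {B : LinearMap.BilinForm ℝ E}

theorem hasFDerivAt_bilin {X Y : M → E} {X' Y' : M →L[ℝ] E} {z : M} (hX : HasFDerivAt X X' z)
    (hY : HasFDerivAt Y Y' z) (u : M) :
    DifferentiableAt ℝ (fun w => B (X w) (Y w)) z ∧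
    fderiv ℝ (fun w => B (X w) (Y w)) z u = B (X' u) (Y z) + B (X z) (Y' u) := by
  have hb : IsBoundedBilinearMap ℝ (fun p : E × E => B p.1 p.2) :=
    (LinearMap.toContinuousBilinearMap B).isBoundedBilinearMap
  have h := HasFDerivAt.comp (f := fun w => (X w, Y w)) z (hb.hasFDerivAt _) (hX.prodMk hY)
  refine ⟨h.differentiableAt, ?_⟩
  have h2 := DFunLike.congr_fun h.fderiv u
  simp only [ContinuousLinearMap.comp_apply, ContinuousLinearMap.prod_apply,
    IsBoundedBilinearMap.deriv_apply] at h2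
  rw [add_comm]
  exact h2

theorem contDiff_bilin {X Y : M → E} (hX : ContDiff ℝ ∞ X) (hY : ContDiff ℝ ∞ Y) :
    ContDiff ℝ ∞ (fun w => B (X w) (Y w)) := by
  have hb : IsBoundedBilinearMap ℝ (fun p : E × E => B p.1 p.2) :=
    (LinearMap.toContinuousBilinearMap B).isBoundedBilinearMap
  exact hb.contDiff.comp (hX.prodMk hY)

theorem contDiff_rlog {φ : M → D} (hφ : ∀ z, SmoothAt E φ z) : ContDiff ℝ ∞ (rlog E φ) :=
  contDiff_iff_contDiffAt.2 fun z => contDiffAt_rlog (hφ z)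

theorem hasFDerivAt_rlog_apply {φ : M → D} {z : M} (hφ : SmoothAt E φ z) (v : M) :
    HasFDerivAt (fun w => rlog E φ w v) ((fderiv ℝ (rlog E φ) z).flip v) z := by
  have h := ((contDiffAt_rlog hφ).differentiableAt (by simp)).hasFDerivAt
  simpa using h.clm_apply (hasFDerivAt_const v z)

/-- The Cartan `3`-form vanishes along isotropic maps. -/
theorem IsIsotropicMap.cartan_eq_zero {φ : M → D} (h : IsIsotropicMap E B φ)
    (hφ : ∀ z, SmoothAt E φ z) (z u v w : M) :
    B (rbracket E D (rlog E φ z u) (rlog E φ z v)) (rlog E φ z w) = 0 := by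
  -- Isotropy is assumed between values at different points, so one argument can be frozen at `z`
  -- and the vanishing pairing differentiated in the other.
  have key : ∀ p q : M, B (fderiv ℝ (rlog E φ) z p q) (rlog E φ z w) = 0 := by
    intro p q
    have h1 := (hasFDerivAt_bilin (B := B) (hasFDerivAt_rlog_apply (hφ z) q)
      (hasFDerivAt_const (rlog E φ z w) z) p).2
    have h2 : (fun x => B (rlog E φ x q) (rlog E φ z w)) = fun _ => 0 := by
      funext x; exact h _ _ _ _
    rw [h2] at h1
    simpa using h1.symm
  rw [← maurerCartan (hφ z), map_sub, LinearMap.sub_apply, key, key, sub_zero]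

theorem IsIsotropicMap.conj {φ : M → D} (h : IsIsotropicMap E B φ)
    (hB : ∀ (d : D) (x y : E), B (AdE E d x) (AdE E d y) = B x y)
    (hφ : ∀ z, SmoothAt E φ z) (d : D) : IsIsotropicMap E B (fun w => d * φ w * d⁻¹) := by
  intro w w' u u'
  rw [rlog_conj d (hφ w), rlog_conj d (hφ w')]
  simp only [ContinuousLinearMap.comp_apply]
  rw [hB]
  exact h _ _ _ _

variable (B) in
/-- The change of the Lagrangian under a gauge transformation, as a `2`-form on the world-sheet:
`c` is the logarithmic derivative of `f g = g' ĥ`. -/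
def gaugeForm (φ γ γ' : M → D) (u v : M) (z : M) : ℝ :=
  B (rlog E (fun w => φ w * γ w) z u) (rlog E φ z v - rlog E γ' z v)

theorem contDiff_gaugeForm {φ γ γ' : M → D} (hφ : ∀ z, SmoothAt E φ z) (hγ : ∀ z, SmoothAt E γ z)
    (hγ' : ∀ z, SmoothAt E γ' z) (u v : M) : ContDiff ℝ ∞ (gaugeForm B φ γ γ' u v) := by
  have h1 := contDiff_rlog (fun z => (hφ z).mul (hγ z))
  have h2 := contDiff_rlog hφ
  have h3 := contDiff_rlog hγ'
  exact contDiff_bilin (h1.clm_apply contDiff_const)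
    ((h2.clm_apply contDiff_const).sub (h3.clm_apply contDiff_const))

variable (B) in
/-- Smooth maps to isotropic subgroups with `φ γ = γ' η`, in a group with an invariant form. -/
structure IsDressing (φ γ γ' η : M → D) : Prop where
  symm : ∀ x y, B x y = B y x
  invariant : ∀ (d : D) (x y : E), B (AdE E d x) (AdE E d y) = B x y
  smooth₁ : ∀ z, SmoothAt E φ z
  smooth₂ : ∀ z, SmoothAt E γ z
  smooth₃ : ∀ z, SmoothAt E γ' z
  smooth₄ : ∀ z, SmoothAt E η z
  isotropic₁ : IsIsotropicMap E B φ
  isotropic₂ : IsIsotropicMap E B γ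
  isotropic₃ : IsIsotropicMap E B γ'
  isotropic₄ : IsIsotropicMap E B η
  mul_eq : ∀ z, φ z * γ z = γ' z * η z

/-- With `c`, `p`, `q` the logarithmic derivatives of `φ γ`, `φ`, `γ'`, both `c - p = Ad_φ (∂γ γ⁻¹)`
and `c - q = Ad_γ' (∂η η⁻¹)` are isotropic, as are `p` and `q`. Expanding gives `⟨c_u | c_v⟩ = ⟨c_u
| p_v⟩ + ⟨p_u | c_v⟩` and the same with `q`; subtract. -/
theorem IsDressing.gaugeForm_swap {φ γ γ' η : M → D} (h : IsDressing B φ γ γ' η) (u v z : M) :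
    gaugeForm B φ γ γ' u v z = -gaugeForm B φ γ γ' v u z := by
  obtain ⟨hBs, hB, hφ, hγ, hγ', hη, iφ, iγ, iγ', iη, e⟩ := h
  have c1 := rlog_mul (hφ z) (hγ z)
  have c2 : rlog E (fun w => φ w * γ w) z =
      rlog E γ' z + (AdE E (γ' z)).comp (rlog E η z) := by
    rw [funext e]; exact rlog_mul (hγ' z) (hη z)
  have a1 : ∀ u, rlog E (fun w => φ w * γ w) z u - rlog E φ z u =
      AdE E (φ z) (rlog E γ z u) := fun u => by rw [c1]; simp
  have a2 : ∀ u, rlog E (fun w => φ w * γ w) z u - rlog E γ' z u =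
      AdE E (γ' z) (rlog E η z u) := fun u => by rw [c2]; simp
  have k1 := hB (φ z) (rlog E γ z u) (rlog E γ z v)
  have k2 := hB (γ' z) (rlog E η z u) (rlog E η z v)
  rw [← a1, ← a1, iγ] at k1
  rw [← a2, ← a2, iη] at k2
  have k3 := iφ z z u v
  have k4 := iγ' z z u v
  simp only [gaugeForm, map_sub, LinearMap.sub_apply] at k1 k2 ⊢
  rw [hBs (rlog E φ z u) (rlog E (fun w => φ w * γ w) z v)] at k1
  rw [hBs (rlog E γ' z u) (rlog E (fun w => φ w * γ w) z v)] at k2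
  linarith

/-- Invariance makes `⟨[x, y] | z⟩` cyclic. Expanding the vanishing triple product of the `c - p`
trilinearly then expresses that of the `c` through the mixed terms. By the Maurer–Cartan equation
these are the terms of the exterior derivative of `⟨c ∧ p⟩`. -/
theorem cartan_cyclic (hBs : ∀ x y, B x y = B y x)
    (hB : ∀ (d : D) (x y : E), B (AdE E d x) (AdE E d y) = B x y)
    {c₁ c₂ c₃ p₁ p₂ p₃ : E} (hp : B (rbracket E D p₁ p₂) p₃ = 0)
    (hq : B (rbracket E D (c₁ - p₁) (c₂ - p₂)) (c₃ - p₃) = 0) :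
    (B (rbracket E D c₁ c₂) p₃ - B (rbracket E D p₁ p₂) c₃) +
    (B (rbracket E D c₂ c₃) p₁ - B (rbracket E D p₂ p₃) c₁) +
    (B (rbracket E D c₃ c₁) p₂ - B (rbracket E D p₃ p₁) c₂) = B (rbracket E D c₁ c₂) c₃ := by
  have inv : ∀ x y z, B (rbracket E D x y) z = B (rbracket E D y z) x := by
    intro x y z
    have h1 := invariant_rbracket (D := D) hB y x z
    rw [rbracket_swap x y, map_neg, LinearMap.neg_apply, hBs _ x] at *
    linarith
  simp only [rbracket_sub_left, rbracket_sub_right, map_sub, LinearMap.sub_apply] at hq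
  have e1 := inv c₁ p₂ c₃
  have e2 := inv p₁ c₂ c₃
  have e3 := inv p₂ c₃ c₁
  have e4 := inv c₁ p₂ p₃
  have e5 := inv p₁ c₂ p₃
  have e6 := inv c₂ p₃ p₁
  linarith

/-- The identity `cartan_cyclic` holds for `p = ∂φ φ⁻¹` and for `q = ∂γ' γ'⁻¹` with the same
right-hand side, the Cartan form of `c`; the difference of the two is the closedness. -/
theorem IsDressing.gaugeForm_closed {φ γ γ' η : M → D} (h : IsDressing B φ γ γ' η)
    (u v w z : M) :
    fderiv ℝ (gaugeForm B φ γ γ' v w) z u + fderiv ℝ (gaugeForm B φ γ γ' w u) z v +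
      fderiv ℝ (gaugeForm B φ γ γ' u v) z w = 0 := by
  have hsw := h.gaugeForm_swap
  obtain ⟨hBs, hB, hφ, hγ, hγ', hη, iφ, iγ, iγ', iη, e⟩ := h
  have hc : ∀ z, SmoothAt E (fun w => φ w * γ w) z := fun z => (hφ z).mul (hγ z)
  have c1 := rlog_mul (hφ z) (hγ z)
  have c2 : rlog E (fun w => φ w * γ w) z =
      rlog E γ' z + (AdE E (γ' z)).comp (rlog E η z) := by
    rw [funext e]; exact rlog_mul (hγ' z) (hη z)
  -- Freezing the conjugating element at `φ z` presents `c - p` at `z` as the logarithmic derivative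
  -- of a genuinely isotropic map, so its Cartan form vanishes there.
  have a1 : ∀ u, rlog E (fun w => φ w * γ w) z u - rlog E φ z u =
      rlog E (fun w => φ z * γ w * (φ z)⁻¹) z u := fun u => by
    rw [c1, rlog_conj _ (hγ z)]; simp
  have a2 : ∀ u, rlog E (fun w => φ w * γ w) z u - rlog E γ' z u =
      rlog E (fun w => γ' z * η w * (γ' z)⁻¹) z u := fun u => by
    rw [c2, rlog_conj _ (hη z)]; simp
  have sγ : ∀ x, SmoothAt E (fun w => φ z * γ w * (φ z)⁻¹) x := fun x =>
    ((hγ x).const_mul _).mul_const _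
  have sη : ∀ x, SmoothAt E (fun w => γ' z * η w * (γ' z)⁻¹) x := fun x =>
    ((hη x).const_mul _).mul_const _
  have q1 := (iγ.conj hB hγ (φ z)).cartan_eq_zero sγ z u v w
  have q2 := (iη.conj hB hη (γ' z)).cartan_eq_zero sη z u v w
  rw [← a1, ← a1, ← a1] at q1
  rw [← a2, ← a2, ← a2] at q2
  have r1 := cartan_cyclic hBs hB (iφ.cartan_eq_zero hφ z u v w) q1
  have r2 := cartan_cyclic hBs hB (iγ'.cartan_eq_zero hγ' z u v w) q2
  have d : ∀ x y s : M, fderiv ℝ (gaugeForm B φ γ γ' y s) z x =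
      B (fderiv ℝ (rlog E (fun w => φ w * γ w)) z x y) (rlog E φ z s - rlog E γ' z s) +
      B (rlog E (fun w => φ w * γ w) z y)
        (fderiv ℝ (rlog E φ) z x s - fderiv ℝ (rlog E γ') z x s) := by
    intro x y s
    have := (hasFDerivAt_bilin (B := B) (hasFDerivAt_rlog_apply (hc z) y)
      ((hasFDerivAt_rlog_apply (hφ z) s).sub (hasFDerivAt_rlog_apply (hγ' z) s)) x).2
    exact this
  -- Antisymmetry is differentiated as well: `cartan_cyclic` contains antisymmetrized derivatives,
  -- whereas the cyclic sum of derivatives of the form contains each only in one order.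
  have sw : ∀ x y s : M, fderiv ℝ (gaugeForm B φ γ γ' y s) z x =
      -fderiv ℝ (gaugeForm B φ γ γ' s y) z x := by
    intro x y s
    have h : gaugeForm B φ γ γ' y s = fun z => -gaugeForm B φ γ γ' s y z :=
      funext fun z => hsw y s z
    rw [h, fderiv_fun_neg]
    rfl
  have s1 := sw u v w
  have s2 := sw v w u
  have s3 := sw w u v
  simp only [← maurerCartan (hc z), ← maurerCartan (hφ z), ← maurerCartan (hγ' z)] at r1 r2
  simp only [d, map_sub, LinearMap.sub_apply] at s1 s2 s3 r1 r2 ⊢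
  simp only [hBs (rlog E (fun w => φ w * γ w) z _)] at s1 s2 s3 r1 r2 ⊢
  linarith

end ClosedForm

/-! ### Stokes' theorem on `[0, 1] × ℝ²`. -/

section Stokes

theorem integral_fderiv_eq_zero {q : Worldsheet → ℝ} (hq : ContDiff ℝ ∞ q)
    (hc : HasCompactSupport q) (U : Worldsheet) : ∫ z, fderiv ℝ q z U = 0 := by
  have h1 : Integrable q := hq.continuous.integrable_of_hasCompactSupport hc
  have h2 : Integrable (fun z => fderiv ℝ q z U) := by
    refine Continuous.integrable_of_hasCompactSupport ?_ (hc.fderiv_apply ℝ U)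
    exact (hq.continuous_fderiv (by simp)).clm_apply continuous_const
  have h := integral_mul_fderiv_eq_neg_fderiv_mul_of_integrable (μ := (volume : Measure Worldsheet))
    (f := fun _ => (1 : ℝ)) (g := q) (v := U) (by simp) (by simpa using h2) (by simpa using h1)
    (fun x _ => by fun_prop) (fun x _ => hq.differentiable (by simp) x)
  simpa using h

/-- The derivative also vanishes on the open complement of `K`, so the integral extends to the whole
plane, and no regularity of the boundary of `K` is needed. -/
theorem setIntegral_fderiv_eq_zero {K : Set Worldsheet} (hK : IsCompact K) {q : Worldsheet → ℝ}
    (hq : ContDiff ℝ ∞ q) (h0 : ∀ z ∉ K, q z = 0) (U : Worldsheet) :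
    ∫ z in K, fderiv ℝ q z U = 0 := by
  rw [setIntegral_eq_integral_of_forall_compl_eq_zero]
  · exact integral_fderiv_eq_zero hq (HasCompactSupport.intro hK h0) U
  · intro z hz
    have : q =ᶠ[𝓝 z] fun _ => 0 := by
      filter_upwards [hK.isClosed.isOpen_compl.mem_nhds hz] with w hw
      exact h0 w hw
    rw [this.fderiv_eq]
    simp

/-- Stokes' theorem on `[0, 1] × ℝ²` for a closed `2`-form supported in `[0, 1] × K`. -/
theorem setIntegral_eq_zero_of_closed {K : Set Worldsheet} (hK : IsCompact K)
    {p q r : ℝ × Worldsheet → ℝ} (hp : ContDiff ℝ ∞ p) (hq : ContDiff ℝ ∞ q) (hr : ContDiff ℝ ∞ r)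
    (U V : Worldsheet)
    (hcl : ∀ x, fderiv ℝ p x (1, 0) + fderiv ℝ q x (0, U) + fderiv ℝ r x (0, V) = 0)
    (h0 : ∀ z, p (0, z) = 0) (hqK : ∀ t, ∀ z ∉ K, q (t, z) = 0)
    (hrK : ∀ t, ∀ z ∉ K, r (t, z) = 0) : ∫ z in K, p (1, z) = 0 := by
  have hpc : Continuous (fun x => fderiv ℝ p x (1, 0)) :=
    (hp.continuous_fderiv (by simp)).clm_apply continuous_const
  have h1 : ∀ z, p (1, z) = ∫ t in Set.Ioc (0 : ℝ) 1, fderiv ℝ p (t, z) (1, 0) := by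
    intro z
    have hd : ∀ t : ℝ, HasDerivAt (fun t => p (t, z)) (fderiv ℝ p (t, z) (1, 0)) t := by
      intro t
      have h := HasFDerivAt.comp (f := fun t => (t, z)) t
        ((hp.differentiable (by simp) (t, z)).hasFDerivAt)
        (hasFDerivAt_prodMk_left (𝕜 := ℝ) t z)
      exact h.hasDerivAt
    rw [← intervalIntegral.integral_of_le zero_le_one,
      intervalIntegral.integral_eq_sub_of_hasDerivAt (fun t _ => hd t), h0, sub_zero]
    exact (hpc.comp (continuous_id.prodMk continuous_const)).intervalIntegrable 0 1
  simp only [h1]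
  rw [integral_integral_swap]
  · refine integral_eq_zero_of_ae (Eventually.of_forall fun t => ?_)
    have slice : ∀ {q : ℝ × Worldsheet → ℝ}, ContDiff ℝ ∞ q → ∀ z W,
        fderiv ℝ (fun z => q (t, z)) z W = fderiv ℝ q (t, z) (0, W) := by
      intro q hq z W
      have h := HasFDerivAt.comp (f := fun z => (t, z)) z
        ((hq.differentiable (by simp) (t, z)).hasFDerivAt)
        (hasFDerivAt_prodMk_right (𝕜 := ℝ) t z)
      exact DFunLike.congr_fun h.fderiv W
    have smooth : ∀ {q : ℝ × Worldsheet → ℝ}, ContDiff ℝ ∞ q →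
        ContDiff ℝ ∞ (fun z => q (t, z)) := fun hq =>
      hq.comp (contDiff_const.prodMk contDiff_id)
    have hi : ∀ {q : ℝ × Worldsheet → ℝ}, ContDiff ℝ ∞ q → ∀ W,
        IntegrableOn (fun z => fderiv ℝ (fun z => q (t, z)) z W) K := fun hq W =>
      ((((smooth hq).continuous_fderiv (by simp)).clm_apply
        continuous_const).continuousOn).integrableOn_compact hK
    -- Closedness trades the time derivative of `p` for world-sheet derivatives of functions that
    -- vanish off `K`.
    have h2 : ∀ z, fderiv ℝ p (t, z) (1, 0) =
        -(fderiv ℝ (fun z => q (t, z)) z U + fderiv ℝ (fun z => r (t, z)) z V) := by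
      intro z
      rw [slice hq, slice hr]
      linarith [hcl (t, z)]
    simp only [h2, Pi.zero_apply]
    rw [integral_neg, integral_add (hi hq U) (hi hr V),
      setIntegral_fderiv_eq_zero hK (smooth hq) (hqK t),
      setIntegral_fderiv_eq_zero hK (smooth hr) (hrK t)]
    simp
  · rw [Measure.prod_restrict]
    have : IntegrableOn (Function.uncurry fun (z : Worldsheet) (t : ℝ) =>
        fderiv ℝ p (t, z) (1, 0)) (K ×ˢ Set.Icc (0 : ℝ) 1) (volume.prod volume) := by
      refine ContinuousOn.integrableOn_compact (hK.prod isCompact_Icc) ?_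
      exact (hpc.comp (continuous_snd.prodMk continuous_fst)).continuousOn
    exact this.mono_set (Set.prod_mono le_rfl Set.Ioc_subset_Icc_self)

end Stokes

/-! ### Models defined by a subspace `S` complementary to `Ad_g Ĝ`. -/

section Models

variable {E EG EH EF : Type*}
  [NormedAddCommGroup E] [NormedSpace ℝ E] [NormedAddCommGroup EG] [NormedSpace ℝ EG]
  [NormedAddCommGroup EH] [NormedSpace ℝ EH] [NormedAddCommGroup EF] [NormedSpace ℝ EF]
  {D G H F : Type*}
  [TopologicalSpace D] [ChartedSpace E D] [Group D]
  [TopologicalSpace G] [ChartedSpace EG G] [Group G]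
  [TopologicalSpace H] [ChartedSpace EH H] [Group H]
  [TopologicalSpace F] [ChartedSpace EF F] [Group F]

namespace PerfectDouble

variable (P : PerfectDouble E EG EH D G H)

/-- The subspace `Ad_g Ĝ`. -/
def twist (g : G) : Submodule ℝ (Lie E D) := P.dualAlg.map (Ad E (P.inG g))

/-- The form, on the model space of `D`. -/
def formE : LinearMap.BilinForm ℝ E := P.form

variable (EF) in
/-- A subspace `S` of the Lie algebra of `D` which is `Ad_F`-invariant, contains the Lie algebra of
`F`, and is orthogonal to it. -/
structure IsCosetSpace (i : F →* D) (S : Submodule ℝ (Lie E D)) : Prop where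
  Ad_mem : ∀ (f : F), ∀ x ∈ S, Ad E (i f) x ∈ S
  le : lieAlgebraOf E EF i ≤ S
  orthogonal : ∀ v ∈ lieAlgebraOf E EF i, ∀ x ∈ S, P.form v x = 0

/-- The density `ℓ g b a` is `⟨b | e⟩`, where `e` is the component in `S` of `a` with respect to
the decomposition of the Lie algebra of `D` into `S` and `Ad_g Ĝ`. -/
structure IsModel (S : Submodule ℝ (Lie E D)) (adm : G → Prop) (ℓ : G → P.alg → P.alg → ℝ) :
    Prop where
  adm_iff : ∀ g, adm g ↔ IsCompl S (P.twist g)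
  density_eq : ∀ g, adm g → ∀ (b a : P.alg), ∀ e ∈ S, e - (a : Lie E D) ∈ P.twist g →
    ℓ g b a = P.form b e

variable [FiniteDimensional ℝ E]
  [LieGroup 𝓘(ℝ, E) ∞ D] [LieGroup 𝓘(ℝ, EG) ∞ G] [LieGroup 𝓘(ℝ, EH) ∞ H]
  [LieGroup 𝓘(ℝ, EF) ∞ F]
  {M : Type*} [NormedAddCommGroup M] [NormedSpace ℝ M]

theorem exists_add_eq_of_isCompl {S T : Submodule ℝ (Lie E D)} (h : IsCompl S T) (x : Lie E D) :
    ∃ y ∈ S, ∃ z ∈ T, y + z = x := by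
  rw [← Submodule.mem_sup, h.sup_eq_top]; trivial

theorem form_twist {g : G} {x y : Lie E D} (hx : x ∈ P.twist g) (hy : y ∈ P.twist g) :
    P.form x y = 0 := by
  obtain ⟨x, hx, rfl⟩ := hx
  obtain ⟨y, hy, rfl⟩ := hy
  rw [P.form_invariant]
  exact P.isotropicH x hx y hy

theorem dress_mul_cofactor (d : D) (g : G) :
    d * P.inG g = P.inG (P.dress d g) * P.inH (P.cofactor (d * P.inG g)) :=
  (P.factor_mul_cofactor _).symm

/-- From `d g = g' ĥ` follows `Ad_d Ad_g Ĝ = Ad_{g'} Ad_ĥ Ĝ`, and `Ad_ĥ` preserves the Lie algebra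
of `Ĝ`. -/
theorem Ad_mem_twist_dress (d : D) (g : G) (x : Lie E D) :
    Ad E d x ∈ P.twist (P.dress d g) ↔ x ∈ P.twist g := by
  have e := P.dress_mul_cofactor d g
  set h := P.cofactor (d * P.inG g)
  constructor
  · rintro ⟨y, hy, hxy⟩
    refine ⟨Ad E (P.inH h⁻¹) y, Ad_mem_lieAlgebraOf P.isLieSubgroup_inH.smooth _ hy, ?_⟩
    have e' : P.inG g * P.inH h⁻¹ = d⁻¹ * P.inG (P.dress d g) := by
      rw [map_inv, mul_inv_eq_iff_eq_mul, mul_assoc, eq_inv_mul_iff_mul_eq, e]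
    rw [← Ad_mul, e', Ad_mul, hxy, Ad_inv_Ad]
  · rintro ⟨y, hy, rfl⟩
    refine ⟨Ad E (P.inH h) y, Ad_mem_lieAlgebraOf P.isLieSubgroup_inH.smooth _ hy, ?_⟩
    rw [← Ad_mul, ← Ad_mul, e]

theorem isCompl_twist_dress {i : F →* D} {S : Submodule ℝ (Lie E D)}
    (hS : P.IsCosetSpace EF i S) (f : F) {g : G} (h : IsCompl S (P.twist g)) :
    IsCompl S (P.twist (P.dress (i f) g)) := by
  constructor
  · rw [Submodule.disjoint_def]
    intro x hx hx'
    rw [← Ad_Ad_inv (E := E) (i f) x, P.Ad_mem_twist_dress] at hx'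
    have := hS.Ad_mem f⁻¹ x hx
    rw [map_inv] at this
    rw [← Ad_Ad_inv (E := E) (i f) x, Submodule.disjoint_def.1 h.disjoint _ this hx', map_zero]
  · rw [codisjoint_iff, eq_top_iff]
    intro x _
    obtain ⟨y, hy, z, hz, hyz⟩ := exists_add_eq_of_isCompl h (Ad E (i f)⁻¹ x)
    refine Submodule.mem_sup.2 ⟨_, hS.Ad_mem f y hy, _, (P.Ad_mem_twist_dress (i f) g z).2 hz, ?_⟩
    rw [← map_add, hyz, Ad_Ad_inv]

theorem dress_inv_dress (d : D) (g : G) : P.dress d⁻¹ (P.dress d g) = g := by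
  have e := P.dress_mul_cofactor d g
  set h := P.cofactor (d * P.inG g)
  refine P.factor_eq (h := h⁻¹) ?_
  rw [map_inv, inv_mul_eq_iff_eq_mul, ← mul_assoc, e, mul_inv_cancel_right]

theorem dress_one (g : G) : P.dress 1 g = g := P.factor_eq (h := 1) (by simp)

/-- The logarithmic derivative of a map to `D`, as an element of the Lie algebra. -/
def lg (φ : M → D) (z u : M) : Lie E D := rlog E φ z u

theorem current_eq_lg {g : Worldsheet → G} {z : Worldsheet} (hg : SmoothAt EG g z)
    (u : Worldsheet) :
    (P.current g z u : Lie E D) = lg (E := E) (fun w => P.inG (g w)) z u := by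
  have hi := P.isLieSubgroup_inG.smooth
  have h := logDeriv_eq_rlog (E := EG) hg u
  have h2 := DFunLike.congr_fun (rlog_hom (E := E) hi.contMDiffAt hg) u
  exact ((dHom_eq_tang hi _).trans (congrArg (tang (E := E) (E' := EG) P.inG) h)).trans h2.symm

theorem lg_mul {φ ψ : M → D} {z : M} (hφ : SmoothAt E φ z) (hψ : SmoothAt E ψ z) (u : M) :
    lg (E := E) (fun w => φ w * ψ w) z u = lg φ z u + Ad E (φ z) (lg ψ z u) := by
  have h := DFunLike.congr_fun (rlog_mul hφ hψ) u
  have h2 := Ad_eq_AdE (E := E) (φ z) (rlog E ψ z u)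
  exact h.trans (congrArg (fun x : E => rlog E φ z u + x) h2).symm

section Dressing

variable {i : F →* D} {f : M → F} {g : M → G}

theorem contMDiff_dress (hi : ContMDiff 𝓘(ℝ, EF) 𝓘(ℝ, E) ∞ i) (hf : ∀ z, SmoothAt EF f z)
    (hg : ∀ z, SmoothAt EG g z) (z : M) : SmoothAt EG (fun w => P.dress (i (f w)) (g w)) z :=
  ContMDiffAt.comp (I' := 𝓘(ℝ, E)) z (g := P.factor) P.contMDiff_factor.contMDiffAt
    ((smoothAt_hom hi (hf z)).mul (smoothAt_hom P.isLieSubgroup_inG.smooth (hg z)))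

theorem contMDiff_dress_cofactor (hi : ContMDiff 𝓘(ℝ, EF) 𝓘(ℝ, E) ∞ i)
    (hf : ∀ z, SmoothAt EF f z) (hg : ∀ z, SmoothAt EG g z) (z : M) :
    SmoothAt EH (fun w => P.cofactor (i (f w) * P.inG (g w))) z :=
  ContMDiffAt.comp (I' := 𝓘(ℝ, E)) z (g := P.cofactor) P.contMDiff_cofactor.contMDiffAt
    ((smoothAt_hom hi (hf z)).mul (smoothAt_hom P.isLieSubgroup_inG.smooth (hg z)))

theorem isIsotropicMap_hom {E' S : Type*} [NormedAddCommGroup E'] [NormedSpace ℝ E']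
    [TopologicalSpace S] [ChartedSpace E' S] [Group S] [LieGroup 𝓘(ℝ, E') ∞ S] {j : S →* D}
    (hj : ContMDiff 𝓘(ℝ, E') 𝓘(ℝ, E) ∞ j)
    (hiso : ∀ x ∈ lieAlgebraOf E E' j, ∀ y ∈ lieAlgebraOf E E' j, P.form x y = 0)
    {φ : M → S} (hφ : ∀ z, SmoothAt E' φ z) : IsIsotropicMap E P.formE (fun w => j (φ w)) :=
  fun w w' u u' => hiso _ (rlog_mem hj (hφ w) u) _ (rlog_mem hj (hφ w') u')

theorem isDressing (hi : ContMDiff 𝓘(ℝ, EF) 𝓘(ℝ, E) ∞ i) {S : Submodule ℝ (Lie E D)}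
    (hS : P.IsCosetSpace EF i S) (hf : ∀ z, SmoothAt EF f z) (hg : ∀ z, SmoothAt EG g z) :
    IsDressing P.formE (fun z => i (f z)) (fun z => P.inG (g z))
      (fun z => P.inG (P.dress (i (f z)) (g z)))
      (fun z => P.inH (P.cofactor (i (f z) * P.inG (g z)))) where
  symm := P.form_symm
  invariant d x y := by
    have h := P.form_invariant d x y
    have hx := Ad_eq_AdE (E := E) d x
    have hy := Ad_eq_AdE (E := E) d y
    exact (congrArg₂ (fun x y : E => P.formE x y) hx hy).symm.trans h
  smooth₁ z := smoothAt_hom hi (hf z)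
  smooth₂ z := smoothAt_hom P.isLieSubgroup_inG.smooth (hg z)
  smooth₃ z := smoothAt_hom P.isLieSubgroup_inG.smooth (P.contMDiff_dress hi hf hg z)
  smooth₄ z := smoothAt_hom P.isLieSubgroup_inH.smooth (P.contMDiff_dress_cofactor hi hf hg z)
  -- The Lie algebra of `F` is isotropic, being contained in `S` and orthogonal to `S`.
  isotropic₁ := P.isIsotropicMap_hom hi (fun x hx y hy => hS.orthogonal x hx y (hS.le hy)) hf
  isotropic₂ := P.isIsotropicMap_hom P.isLieSubgroup_inG.smooth P.isotropicG hg
  isotropic₃ := P.isIsotropicMap_hom P.isLieSubgroup_inG.smooth P.isotropicG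
    (P.contMDiff_dress hi hf hg)
  isotropic₄ := P.isIsotropicMap_hom P.isLieSubgroup_inH.smooth P.isotropicH
    (P.contMDiff_dress_cofactor hi hf hg)
  mul_eq z := P.dress_mul_cofactor _ _

/-- The logarithmic derivatives of the two sides of `f g = g' ĥ`. -/
theorem exists_lg_gauge (hi : ContMDiff 𝓘(ℝ, EF) 𝓘(ℝ, E) ∞ i) (hf : ∀ z, SmoothAt EF f z)
    (hg : ∀ z, SmoothAt EG g z) (z u : M) : ∃ w ∈ P.twist (P.dress (i (f z)) (g z)),
    lg (E := E) (fun z => i (f z) * P.inG (g z)) z u =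
      lg (fun z => i (f z)) z u + Ad E (i (f z)) (lg (fun z => P.inG (g z)) z u) ∧
    lg (E := E) (fun z => i (f z) * P.inG (g z)) z u =
      lg (fun z => P.inG (P.dress (i (f z)) (g z))) z u + w := by
  have k1 := lg_mul (E := E) (smoothAt_hom hi (hf z))
    (smoothAt_hom P.isLieSubgroup_inG.smooth (hg z)) u
  have k2 := lg_mul (E := E)
    (smoothAt_hom P.isLieSubgroup_inG.smooth (P.contMDiff_dress hi hf hg z))
    (smoothAt_hom P.isLieSubgroup_inH.smooth (P.contMDiff_dress_cofactor hi hf hg z)) u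
  simp only [← P.dress_mul_cofactor] at k2
  exact ⟨_, ⟨_, rlog_mem P.isLieSubgroup_inH.smooth (P.contMDiff_dress_cofactor hi hf hg z) u,
    rfl⟩, k1, k2⟩

end Dressing

theorem contDiff_rlog_apply {φ : M → D} (hφ : ∀ z, SmoothAt E φ z) (u : M) :
    ContDiff ℝ ∞ (fun z => rlog E φ z u) :=
  (contDiff_rlog hφ).clm_apply contDiff_const

/-- The Lagrangian of a field is continuous where it is defined. -/
theorem continuousOn_lagrangian {S : Submodule ℝ (Lie E D)} {adm : G → Prop}
    {ℓ : G → P.alg → P.alg → ℝ} (hm : P.IsModel S adm ℓ) {g : Worldsheet → G}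
    (hg : IsField EG g) : ContinuousOn (P.lagrangian ℓ g) {z | adm (g z)} := by
  have hg' : ∀ z, SmoothAt EG g z := fun z => hg z
  have hs : ∀ z, SmoothAt E (fun z => P.inG (g z)) z := fun z =>
    smoothAt_hom P.isLieSubgroup_inG.smooth (hg' z)
  let S' : Submodule ℝ E := S
  let W : Submodule ℝ E := P.dualAlg
  -- The map `(s, w) ↦ s + Ad_g w` is bijective exactly when `S` and `Ad_g Ĝ` are complementary. Its
  -- inverse sends the current to its components, and continuity of inversion makes these continuous
  -- in `z`.
  let L : Worldsheet → (S' × W →L[ℝ] E) := fun z =>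
    S'.subtypeL.coprod ((AdE E (P.inG (g z))).comp W.subtypeL)
  have hL : Continuous L := by
    rw [continuous_clm_apply]
    intro y
    exact continuous_const.add (contDiff_AdE hs (y.2 : E)).continuous
  have hbij : ∀ z, adm (g z) → Function.Bijective (L z) := by
    intro z hz
    have hc := (hm.adm_iff _).1 hz
    have key : ∀ y : S' × W, (AdE E (P.inG (g z)) y.2 : Lie E D) ∈ P.twist (g z) := fun y =>
      ⟨_, y.2.2, Ad_eq_AdE (E := E) (P.inG (g z)) y.2⟩
    constructor
    · rw [injective_iff_map_eq_zero]
      intro y hy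
      have h0 : (y.1 : E) + AdE E (P.inG (g z)) y.2 = 0 := hy
      have h1 : ((y.1 : E) : Lie E D) ∈ P.twist (g z) := by
        rw [eq_neg_of_add_eq_zero_left h0]
        exact Submodule.neg_mem (P.twist (g z)) (key y)
      have h2 : (y.1 : E) = 0 := Submodule.disjoint_def.1 hc.disjoint _ y.1.2 h1
      rw [h2, zero_add] at h0
      have h3 : (Ad E (P.inG (g z)) (y.2 : E) : E) = 0 := (Ad_eq_AdE _ _).trans h0
      have h4 : (y.2 : E) = 0 := by
        have := Ad_inv_Ad (E := E) (P.inG (g z)) (y.2 : E)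
        exact this.symm.trans ((congrArg (Ad E (P.inG (g z))⁻¹) h3).trans (map_zero _))
      exact Prod.ext (Subtype.ext h2) (Subtype.ext h4)
    · intro x
      obtain ⟨a, ha, b, hb', hab⟩ := exists_add_eq_of_isCompl hc x
      obtain ⟨w, hw, hb⟩ := hb'
      refine ⟨(⟨a, ha⟩, ⟨w, hw⟩), ?_⟩
      have h1 : (AdE E (P.inG (g z)) w : E) = b := (Ad_eq_AdE _ _).symm.trans hb
      exact (congrArg (fun t : E => Add.add (α := E) a t) h1).trans hab
  let a : Worldsheet → E := fun z => rlog E (fun z => P.inG (g z)) z dirPlus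
  let b : Worldsheet → E := fun z => rlog E (fun z => P.inG (g z)) z dirMinus
  have ha : Continuous a := (contDiff_rlog_apply (E := E) hs dirPlus).continuous
  have hb : Continuous b := (contDiff_rlog_apply (E := E) hs dirMinus).continuous
  let e : Worldsheet → S' × W := fun z => (L z).inverse (a z)
  have hLe : ∀ z, adm (g z) → L z (e z) = a z ∧ ContinuousAt e z := by
    intro z hz
    let Λ : (S' × W) ≃L[ℝ] E :=
      (LinearEquiv.ofBijective (L z : S' × W →ₗ[ℝ] E) (hbij z hz)).toContinuousLinearEquiv
    have hΛ : (Λ : S' × W →L[ℝ] E) = L z := by ext <;> rfl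
    constructor
    · have : e z = Λ.symm (a z) := by
        simp only [e, ← hΛ, ContinuousLinearMap.inverse_equiv]; rfl
      rw [this, ← hΛ]
      simp
    · have h1 : ContinuousAt ContinuousLinearMap.inverse (L z) := by
        rw [← hΛ]
        exact (contDiffAt_map_inverse (𝕜 := ℝ) (n := 0) Λ).continuousAt
      have h2 : ContinuousAt (fun z => (L z).inverse) z :=
        ContinuousAt.comp (f := L) h1 hL.continuousAt
      exact h2.clm_apply ha.continuousAt
  have hb' : IsBoundedBilinearMap ℝ (fun p : E × E => P.formE p.1 p.2) :=
    (LinearMap.toContinuousBilinearMap P.formE).isBoundedBilinearMap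
  have hcont : ContinuousOn (fun z => P.formE (b z) ((e z).1 : E)) {z | adm (g z)} := by
    intro z hz
    have h1 : ContinuousAt (fun z => (b z, ((e z).1 : E))) z :=
      hb.continuousAt.prodMk (continuous_subtype_val.continuousAt.comp
        (continuous_fst.continuousAt.comp (hLe z hz).2))
    exact (ContinuousAt.comp (f := fun z => (b z, ((e z).1 : E)))
      hb'.continuous.continuousAt h1).continuousWithinAt
  refine hcont.congr fun z hz => ?_
  have h1 := hm.density_eq (g z) hz (P.current g z dirMinus) (P.current g z dirPlus)
    ((e z).1 : E) (e z).1.2 (by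
      rw [P.current_eq_lg (hg' z)]
      have h2 : ((e z).1 : E) + AdE E (P.inG (g z)) ((e z).2 : E) = a z := (hLe z hz).1
      have h3 : ((e z).1 : E) - a z = Ad E (P.inG (g z)) (-((e z).2 : E)) := by
        refine Eq.trans ?_ (Ad_eq_AdE (E := E) _ _).symm
        rw [map_neg, ← h2]
        abel
      exact ⟨-((e z).2 : E), Submodule.neg_mem P.dualAlg (e z).2.2, h3.symm⟩)
  rw [lagrangian, h1, P.current_eq_lg (hg' z)]
  rfl

end PerfectDouble

end Models

/-! ### Gauge invariance of a model from an `Ad_F`-invariant subspace. -/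

section Invariance

variable {E EG EH EF : Type*}
  [NormedAddCommGroup E] [NormedSpace ℝ E] [NormedAddCommGroup EG] [NormedSpace ℝ EG]
  [NormedAddCommGroup EH] [NormedSpace ℝ EH] [NormedAddCommGroup EF] [NormedSpace ℝ EF]
  {D G H F : Type*}
  [TopologicalSpace D] [ChartedSpace E D] [Group D]
  [TopologicalSpace G] [ChartedSpace EG G] [Group G]
  [TopologicalSpace H] [ChartedSpace EH H] [Group H]
  [TopologicalSpace F] [ChartedSpace EF F] [Group F]
  [FiniteDimensional ℝ E]
  [LieGroup 𝓘(ℝ, E) ∞ D] [LieGroup 𝓘(ℝ, EG) ∞ G] [LieGroup 𝓘(ℝ, EH) ∞ H]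
  [LieGroup 𝓘(ℝ, EF) ∞ F]

namespace PerfectDouble

variable (P : PerfectDouble E EG EH D G H)
  {M : Type*} [NormedAddCommGroup M] [NormedSpace ℝ M]

/-- Naturality under pullback; it identifies the restriction of the form on `ℝ × ℝ²` to a fixed time
with the form on the world-sheet. -/
theorem gaugeForm_comp {M' : Type*} [NormedAddCommGroup M'] [NormedSpace ℝ M'] {B}
    {φ γ γ' : M → D} (hφ : ∀ z, SmoothAt E φ z) (hγ : ∀ z, SmoothAt E γ z)
    (hγ' : ∀ z, SmoothAt E γ' z) {j : M' → M} {j' : M' →L[ℝ] M} {z : M'}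
    (hj : HasFDerivAt j j' z) (u v : M') :
    gaugeForm (E := E) B (fun z => φ (j z)) (fun z => γ (j z)) (fun z => γ' (j z)) u v z =
      gaugeForm B φ γ γ' (j' u) (j' v) (j z) := by
  have h1 := rlog_comp ((hφ (j z)).mul (hγ (j z))) hj
  have h2 := rlog_comp (hφ (j z)) hj
  have h3 := rlog_comp (hγ' (j z)) hj
  simp only [gaugeForm, h1, h2, h3, ContinuousLinearMap.comp_apply]

/-- Where `φ` is locally `1`, both `φ g` and the dressed field coincide with `g`, so the form
reduces to minus a pairing of two vectors of the isotropic Lie algebra of `G`. -/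
theorem gaugeForm_eq_zero {g : M → G} (hg : ∀ z, SmoothAt EG g z) {φ : M → D} {z : M}
    (h : φ =ᶠ[𝓝 z] fun _ => 1) (u v : M) :
    gaugeForm P.formE φ (fun z => P.inG (g z)) (fun z => P.inG (P.dress (φ z) (g z))) u v z =
      0 := by
  have h1 : rlog E (fun z => φ z * P.inG (g z)) z = rlog E (fun z => P.inG (g z)) z := by
    refine rlog_congr ?_
    filter_upwards [h] with w hw
    rw [hw, one_mul]
  have h2 : rlog E φ z = 0 := by rw [rlog_congr h, rlog_const]
  have h3 : rlog E (fun z => P.inG (P.dress (φ z) (g z))) z =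
      rlog E (fun z => P.inG (g z)) z := by
    refine rlog_congr ?_
    filter_upwards [h] with w hw
    rw [hw, dress_one]
  have iso := P.isIsotropicMap_hom P.isLieSubgroup_inG.smooth P.isotropicG hg z z u v
  simp [gaugeForm, h1, h2, h3, iso]

variable {i : F →* D} {S : Submodule ℝ (Lie E D)} {adm : G → Prop} {ℓ : G → P.alg → P.alg → ℝ}

theorem exists_component (hm : P.IsModel S adm ℓ) {g : G} (hg : adm g) (a : P.alg) :
    ∃ e ∈ S, e - (a : Lie E D) ∈ P.twist g := by
  obtain ⟨y, hy, z, hz, hyz⟩ := exists_add_eq_of_isCompl ((hm.adm_iff g).1 hg) a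
  refine ⟨y, hy, ?_⟩
  rw [← hyz, sub_add_cancel_left]
  exact Submodule.neg_mem _ hz

/-- Both `e - a` and `a` are isotropic; expand `⟨e - a | e - a⟩ = 0`. -/
theorem two_mul_density_self {g : G} {a : P.alg} {e : Lie E D}
    (h : e - (a : Lie E D) ∈ P.twist g) : 2 * P.form a e = P.form e e := by
  have h1 := P.form_twist h h
  have h2 := P.isotropicG a a.2 a a.2
  have h3 := P.form_symm e a
  simp only [map_sub, LinearMap.sub_apply] at h1
  linarith

section Fields

variable {f : Worldsheet → F} {g : Worldsheet → G}

theorem current_gauge (hi : ContMDiff 𝓘(ℝ, EF) 𝓘(ℝ, E) ∞ i) (hf : IsField EF f)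
    (hg : IsField EG g) (z u : Worldsheet) :
    (P.current (P.gauge i f g) z u : Lie E D) =
      lg (E := E) (fun z => P.inG (P.dress (i (f z)) (g z))) z u :=
  P.current_eq_lg (P.contMDiff_dress hi (fun z => hf z) (fun z => hg z) z) u

/-- The component in `S` of the transformed current is `Ad_f e + ∂f f⁻¹`. -/
theorem component_gauge (hi : ContMDiff 𝓘(ℝ, EF) 𝓘(ℝ, E) ∞ i) (hS : P.IsCosetSpace EF i S)
    (hf : IsField EF f) (hg : IsField EG g) (z u : Worldsheet) {e : Lie E D} (he : e ∈ S)
    (h : e - (P.current g z u : Lie E D) ∈ P.twist (g z)) :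
    Ad E (i (f z)) e + lg (fun z => i (f z)) z u ∈ S ∧
    Ad E (i (f z)) e + lg (fun z => i (f z)) z u - (P.current (P.gauge i f g) z u : Lie E D) ∈
      P.twist (P.gauge i f g z) := by
  obtain ⟨w, hw, h1, h2⟩ := P.exists_lg_gauge hi (fun z => hf z) (fun z => hg z) z u
  refine ⟨S.add_mem (hS.Ad_mem _ _ he) (hS.le (rlog_mem hi (hf z) u)), ?_⟩
  rw [P.current_gauge hi hf hg]
  rw [P.current_eq_lg (hg z)] at h
  have h3 := (P.Ad_mem_twist_dress (i (f z)) (g z) _).2 h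
  -- With `v = ∂f f⁻¹` and `v + Ad_f a = a' + w`, the vector `Ad_f e + v - a'` equals `Ad_f (e - a)
  -- + w`, and both terms lie in `Ad_{g'} Ĝ`.
  have h4 := Submodule.add_mem _ h3 hw
  change _ ∈ P.twist (P.dress (i (f z)) (g z))
  convert h4 using 1
  rw [map_sub]
  have h5 : lg (E := E) (fun z => i (f z)) z u +
      Ad E (i (f z)) (lg (fun z => P.inG (g z)) z u) =
      lg (fun z => P.inG (P.dress (i (f z)) (g z))) z u + w := h1.symm.trans h2
  rw [sub_add_eq_add_sub, sub_eq_sub_iff_add_eq_add]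
  calc _ = Ad E (i (f z)) e + (lg (E := E) (fun z => i (f z)) z u +
      Ad E (i (f z)) (lg (fun z => P.inG (g z)) z u)) := by abel
    _ = _ := by rw [h5]; abel

/-- Write `c = v + Ad_f a = a' + w`, with `v = ∂f f⁻¹` and `w ∈ Ad_{g'} Ĝ`. Since `v ⊥ S`, the old
Lagrangian is `⟨c₋ | Ad_f e⟩`. Since `w₋` is orthogonal to `Ad_f e + v₊ - a'₊` and `a'₋` to `a'₊`,
the new one is `⟨c₋ | Ad_f e + v₊ - a'₊⟩`. -/
theorem lagrangian_gauge (hi : ContMDiff 𝓘(ℝ, EF) 𝓘(ℝ, E) ∞ i) (hS : P.IsCosetSpace EF i S)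
    (hm : P.IsModel S adm ℓ) (hf : IsField EF f) (hg : IsField EG g) {z : Worldsheet}
    (hz : adm (g z)) (hz' : adm (P.gauge i f g z)) :
    P.lagrangian ℓ (P.gauge i f g) z - P.lagrangian ℓ g z =
      gaugeForm P.formE (fun z => i (f z)) (fun z => P.inG (g z))
        (fun z => P.inG (P.gauge i f g z)) dirMinus dirPlus z := by
  obtain ⟨e, he, hea⟩ := P.exists_component hm hz (P.current g z dirPlus)
  obtain ⟨he', hea'⟩ := P.component_gauge hi hS hf hg z dirPlus he hea
  obtain ⟨w, hw, h1, h2⟩ := P.exists_lg_gauge hi (fun z => hf z) (fun z => hg z) z dirMinus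
  rw [lagrangian, lagrangian, hm.density_eq _ hz _ _ e he hea,
    hm.density_eq _ hz' _ _ _ he' hea']
  have k1 := P.form_twist hw hea'
  have k2 := P.isotropicG _ (P.current (P.gauge i f g) z dirMinus).2 _
    (P.current (P.gauge i f g) z dirPlus).2
  have k3 := hS.orthogonal _ (rlog_mem hi (hf z) dirMinus) _ (hS.Ad_mem (f z) e he)
  have k4 := P.form_invariant (i (f z)) (lg (fun z => P.inG (g z)) z dirMinus) e
  rw [P.current_eq_lg (hg z)]
  have k5 : gaugeForm P.formE (fun z => i (f z)) (fun z => P.inG (g z))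
        (fun z => P.inG (P.dress (i (f z)) (g z))) dirMinus dirPlus z =
      P.form (lg (fun z => i (f z) * P.inG (g z)) z dirMinus) (lg (fun z => i (f z)) z dirPlus) -
      P.form (lg (fun z => i (f z) * P.inG (g z)) z dirMinus)
        (lg (fun z => P.inG (P.dress (i (f z)) (g z))) z dirPlus) :=
    map_sub (P.formE _) _ _
  have k3' : P.form (lg (fun z => i (f z)) z dirMinus) (Ad E (i (f z)) e) = 0 := k3
  rw [P.current_gauge hi hf hg] at k1 k2 ⊢
  rw [P.current_gauge hi hf hg] at k2
  have h3 := congrArg (fun x => P.form x (Ad E (i (f z)) e)) h1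
  have h4 := congrArg (fun x => P.form x (Ad E (i (f z)) e)) h2
  have h5 := congrArg (fun x => P.form x (lg (fun z => i (f z)) z dirPlus)) h2
  have h6 := congrArg (fun x => P.form x
    (lg (fun z => P.inG (P.dress (i (f z)) (g z))) z dirPlus)) h2
  simp only [map_add, map_sub, LinearMap.add_apply] at h3 h4 h5 h6 k1 ⊢
  change P.form _ _ = 0 at k2
  simp only [gauge] at *
  linarith

/-- Twice the metric is `⟨e | e⟩`, and adding `v = ∂f f⁻¹` to `Ad_f e` does not change the square,
because `v` is orthogonal to `S`, which contains both. Hence no integration is needed. -/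
theorem metric_gauge (hi : ContMDiff 𝓘(ℝ, EF) 𝓘(ℝ, E) ∞ i) (hS : P.IsCosetSpace EF i S)
    (hm : P.IsModel S adm ℓ) (hf : IsField EF f) (hg : IsField EG g) {z : Worldsheet}
    (hz : adm (g z)) (hz' : adm (P.gauge i f g z)) (u : Worldsheet) :
    ℓ (P.gauge i f g z) (P.current (P.gauge i f g) z u) (P.current (P.gauge i f g) z u) =
      ℓ (g z) (P.current g z u) (P.current g z u) := by
  obtain ⟨e, he, hea⟩ := P.exists_component hm hz (P.current g z u)
  obtain ⟨he', hea'⟩ := P.component_gauge hi hS hf hg z u he hea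
  rw [hm.density_eq _ hz _ _ e he hea, hm.density_eq _ hz' _ _ _ he' hea']
  have k1 := P.two_mul_density_self hea
  have k2 := P.two_mul_density_self hea'
  have hv : lg (fun z => i (f z)) z u ∈ lieAlgebraOf E EF i := rlog_mem hi (hf z) u
  have k3 := hS.orthogonal _ hv _ (hS.Ad_mem (f z) e he)
  have k4 := hS.orthogonal _ hv _ (hS.le hv)
  have k5 := P.form_invariant (i (f z)) e e
  have k6 := P.form_symm (Ad E (i (f z)) e) (lg (fun z => i (f z)) z u)
  have k7 : P.form (Ad E (i (f z)) e + lg (fun z => i (f z)) z u)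
      (Ad E (i (f z)) e + lg (fun z => i (f z)) z u) = P.form e e := by
    simp only [map_add, LinearMap.add_apply]
    linarith
  linarith

end Fields

/-- The change of the action under a gauge transformation is the integral of a closed form. -/
theorem setIntegral_gaugeForm_eq_zero (hi : ContMDiff 𝓘(ℝ, EF) 𝓘(ℝ, E) ∞ i)
    (hS : P.IsCosetSpace EF i S) {K : Set Worldsheet} (hK : IsCompact K) {f : Worldsheet → F}
    (hf : IsGaugeTransformation EF K f) {g : Worldsheet → G} (hg : IsField EG g) :
    ∫ z in K, gaugeForm P.formE (fun z => i (f z)) (fun z => P.inG (g z))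
        (fun z => P.inG (P.gauge i f g z)) dirMinus dirPlus z = 0 := by
  obtain ⟨h, hs, h0, h1, hK1⟩ := hf
  have hs' : ∀ x, SmoothAt EF h x := fun x => hs x
  -- The field `g` is kept constant in time; only the gauge transformation moves along the homotopy.
  have hg' : ∀ x : ℝ × Worldsheet, SmoothAt EG (fun x : ℝ × Worldsheet => g x.2) x := fun x =>
    ContMDiffAt.comp (I' := 𝓘(ℝ, Worldsheet)) x (hg x.2) contDiffAt_snd.contMDiffAt
  have hd := P.isDressing hi hS hs' hg'
  set φ : ℝ × Worldsheet → D := fun x => i (h x)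
  set γ : ℝ × Worldsheet → D := fun x => P.inG (g x.2)
  set γ' : ℝ × Worldsheet → D := fun x => P.inG (P.dress (i (h x)) (g x.2))
  have hsm := fun u v => contDiff_gaugeForm (B := P.formE) hd.smooth₁ hd.smooth₂ hd.smooth₃ u v
  have slice := fun t z => gaugeForm_comp (B := P.formE) hd.smooth₁ hd.smooth₂ hd.smooth₃
    (hasFDerivAt_prodMk_right (𝕜 := ℝ) (t : ℝ) (z : Worldsheet)) dirMinus dirPlus
  have off : ∀ u v t, ∀ z ∉ K, gaugeForm P.formE φ γ γ' u v (t, z) = 0 := by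
    intro u v t z hz
    refine P.gaugeForm_eq_zero hg' ?_ u v
    have hz' : ∀ᶠ x in 𝓝 ((t, z) : ℝ × Worldsheet), x.2 ∈ Kᶜ :=
      continuous_snd.continuousAt.eventually (hK.isClosed.isOpen_compl.mem_nhds hz)
    filter_upwards [hz'] with x hx
    rw [show φ x = i (h (x.1, x.2)) from rfl, hK1 x.1 x.2 hx, map_one]
  -- The three functions are the components `ω(∂₋, ∂₊)`, `ω(∂₊, ∂_t)` and `ω(∂_t, ∂₋)`,
  -- differentiated along `∂_t`, `∂₋` and `∂₊` respectively in the closedness relation.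
  have key := setIntegral_eq_zero_of_closed hK (hsm (0, dirMinus) (0, dirPlus))
    (hsm (0, dirPlus) (1, 0)) (hsm (1, 0) (0, dirMinus)) dirMinus dirPlus
    (fun x => hd.gaugeForm_closed (1, 0) (0, dirMinus) (0, dirPlus) x) ?_ (off _ _) (off _ _)
  · rw [← key]
    congr 1
    funext z
    have := slice 1 z
    simp only [ContinuousLinearMap.inr_apply] at this
    rw [← this]
    simp only [φ, γ, γ', h1, gauge]
  · intro z
    have := slice 0 z
    simp only [ContinuousLinearMap.inr_apply] at this
    rw [← this]
    refine P.gaugeForm_eq_zero (φ := fun z => i (h (0, z))) (fun z => hg z) ?_ _ _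
    exact Eventually.of_forall fun w => by simp only [h0, map_one]

/-- Models given by an `Ad_F`-invariant subspace are gauge invariant. -/
theorem IsModel.gaugeInvariant (hm : P.IsModel S adm ℓ) (hi : IsLieSubgroup E EF i)
    (hS : P.IsCosetSpace EF i S) : P.GaugeInvariant (EF := EF) i adm ℓ := by
  have hadm : ∀ (f : F) (g : G), adm (P.dress (i f) g) ↔ adm g := by
    intro f g
    rw [hm.adm_iff, hm.adm_iff]
    refine ⟨fun h => ?_, P.isCompl_twist_dress hS f⟩
    have := P.isCompl_twist_dress hS f⁻¹ h
    rwa [map_inv, dress_inv_dress] at this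
  have hfield : ∀ (f : Worldsheet → F) (g : Worldsheet → G),
      IsField EF f → IsField EG g → IsField EG (P.gauge i f g) := fun f g hf hg z =>
    P.contMDiff_dress hi.smooth (fun z => hf z) (fun z => hg z) z
  refine ⟨hadm, hfield, ?_, ?_, ?_⟩
  · intro f g z
    exact @Quotient.sound _ (@MulAction.orbitRel F G _ (P.dressingAction i)) _ _ ⟨f z, rfl⟩
  · intro K f g hK hf hg hKg
    have hf' : IsField EF f := by
      obtain ⟨h, hs, -, h1, -⟩ := hf
      have : f = fun z => h (1, z) := funext fun z => (h1 z).symm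
      rw [this]
      exact hs.comp (contDiff_const.prodMk contDiff_id).contMDiff
    have hKg' : ∀ z ∈ K, adm (P.gauge i f g z) := fun z hz => (hadm _ _).2 (hKg z hz)
    have i1 : IntegrableOn (P.lagrangian ℓ g) K :=
      ((P.continuousOn_lagrangian hm hg).mono hKg).integrableOn_compact hK
    have i2 : IntegrableOn (P.lagrangian ℓ (P.gauge i f g)) K :=
      ((P.continuousOn_lagrangian hm (hfield f g hf' hg)).mono hKg').integrableOn_compact hK
    refine ⟨i1, i2, ?_⟩
    rw [action, action]
    congr 1
    rw [← sub_eq_zero, ← integral_sub i2 i1,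
      ← P.setIntegral_gaugeForm_eq_zero hi.smooth hS hK hf hg]
    exact setIntegral_congr_fun hK.measurableSet fun z hz =>
      P.lagrangian_gauge hi.smooth hS hm hf' hg (hKg z hz) (hKg' z hz)
  · intro f g z u hf hg hz
    exact P.metric_gauge hi.smooth hS hm hf hg hz ((hadm _ _).2 hz) u

end PerfectDouble

end Invariance

/-! ### Standard and generalized dressing cosets as subspaces of the double. -/

section Cosets

variable {E EG EH EF : Type*}
  [NormedAddCommGroup E] [NormedSpace ℝ E] [NormedAddCommGroup EG] [NormedSpace ℝ EG]
  [NormedAddCommGroup EH] [NormedSpace ℝ EH] [NormedAddCommGroup EF] [NormedSpace ℝ EF]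
  {D G H F : Type*}
  [TopologicalSpace D] [ChartedSpace E D] [Group D]
  [TopologicalSpace G] [ChartedSpace EG G] [Group G]
  [TopologicalSpace H] [ChartedSpace EH H] [Group H]
  [TopologicalSpace F] [ChartedSpace EF F] [Group F]
  [FiniteDimensional ℝ E]
  [LieGroup 𝓘(ℝ, E) ∞ D] [LieGroup 𝓘(ℝ, EG) ∞ G] [LieGroup 𝓘(ℝ, EH) ∞ H]
  [LieGroup 𝓘(ℝ, EF) ∞ F]

namespace PerfectDouble

variable (P : PerfectDouble E EG EH D G H)

theorem J_add_Jhat (x : Lie E D) : (P.J x : Lie E D) + P.Jhat x = x :=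
  Submodule.projection_add_projection_eq_self P.isCompl x

theorem J_coe (y : P.alg) : P.J y = y := Submodule.projectionOnto_apply_left P.isCompl y

theorem J_dual (x : P.dualAlg) : P.J x = 0 := Submodule.projectionOnto_apply_right P.isCompl x

theorem Jhat_coe (x : P.dualAlg) : P.Jhat x = x :=
  Submodule.projectionOnto_apply_left P.isCompl.symm x

theorem Jhat_alg (y : P.alg) : P.Jhat y = 0 :=
  Submodule.projectionOnto_apply_right P.isCompl.symm y

theorem eq_zero_of_add_eq_zero {x : P.dualAlg} {y : P.alg} (h : (x : Lie E D) + y = 0) :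
    x = 0 ∧ y = 0 := by
  constructor
  · have h1 := congrArg P.Jhat h
    rwa [map_add, P.Jhat_coe, P.Jhat_alg, add_zero, map_zero] at h1
  · have h1 := congrArg P.J h
    rwa [map_add, P.J_coe, P.J_dual, zero_add, map_zero] at h1

/-- `x - Π^g x` lies in `Ad_g Ĝ`. -/
theorem sub_poisson_mem_twist (g : G) (x : P.dualAlg) :
    (x : Lie E D) - P.poisson g x ∈ P.twist g := by
  have h1 := P.J_add_Jhat (Ad E (P.inG g)⁻¹ x)
  -- As `Ad_g` preserves the Lie algebra of `G`, the outer `J` in `Π^g` acts trivially; then `x -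
  -- Π^g x = Ad_g Ĵ Ad_{g⁻¹} x`.
  have h2 : Ad E (P.inG g) (P.J (Ad E (P.inG g)⁻¹ x)) ∈ P.alg :=
    Ad_mem_lieAlgebraOf P.isLieSubgroup_inG.smooth g (P.J (Ad E (P.inG g)⁻¹ x)).2
  have h3 : (P.poisson g x : Lie E D) = Ad E (P.inG g) (P.J (Ad E (P.inG g)⁻¹ x)) :=
    congrArg Subtype.val (P.J_coe ⟨_, h2⟩)
  refine ⟨P.Jhat (Ad E (P.inG g)⁻¹ x), (P.Jhat _).2, ?_⟩
  rw [h3, eq_sub_iff_add_eq, add_comm, ← map_add, h1, Ad_Ad_inv]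

theorem eq_zero_of_mem_twist {g : G} {y : P.alg} (h : (y : Lie E D) ∈ P.twist g) : y = 0 := by
  obtain ⟨w, hw, hwy⟩ := h
  have h1 : w ∈ P.alg := by
    rw [← Ad_inv_Ad (E := E) (P.inG g) w, hwy, ← map_inv]
    exact Ad_mem_lieAlgebraOf P.isLieSubgroup_inG.smooth g⁻¹ y.2
  have h2 : w = 0 := Submodule.disjoint_def.1 P.isCompl.disjoint w h1 hw
  rw [h2, map_zero] at hwy
  exact Subtype.ext hwy.symm

/-- Modulo `Ad_g Ĝ` the vector `x` equals `Π^g x`, and `Ad_g Ĝ` meets the Lie algebra of `G` only in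
`0`. This turns the operator equations of the models into decompositions of the double. -/
theorem sub_mem_twist_iff (g : G) (x : P.dualAlg) (y a : P.alg) :
    (x : Lie E D) + y - a ∈ P.twist g ↔ y + P.poisson g x = a := by
  have h := P.sub_poisson_mem_twist g x
  have e : (x : Lie E D) + y - a =
      (x - P.poisson g x) + ((y + P.poisson g x - a : P.alg) : Lie E D) := by
    push_cast; abel
  rw [e, Submodule.add_mem_iff_right _ h, ← sub_eq_zero (a := y + P.poisson g x)]
  exact ⟨P.eq_zero_of_mem_twist, fun h => by rw [h]; exact Submodule.zero_mem _⟩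

theorem add_mem_twist_iff (g : G) (x : P.dualAlg) (y : P.alg) :
    (x : Lie E D) + y ∈ P.twist g ↔ y + P.poisson g x = 0 := by
  have := P.sub_mem_twist_iff g x y 0
  simpa using this

/-- Every vector is congruent modulo `Ad_g Ĝ` to one in the Lie algebra of `G`, so spanning need
only be tested on the latter. -/
theorem isCompl_twist_iff (S : Submodule ℝ (Lie E D)) (g : G) : IsCompl S (P.twist g) ↔
    (∀ s ∈ S, s ∈ P.twist g → s = 0) ∧ ∀ a : P.alg, ∃ e ∈ S, e - (a : Lie E D) ∈ P.twist g := by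
  constructor
  · intro h
    refine ⟨Submodule.disjoint_def.1 h.disjoint, fun a => ?_⟩
    obtain ⟨y, hy, z, hz, hyz⟩ := exists_add_eq_of_isCompl h (a : Lie E D)
    refine ⟨y, hy, ?_⟩
    rw [← hyz, sub_add_cancel_left]
    exact Submodule.neg_mem _ hz
  · rintro ⟨h1, h2⟩
    refine ⟨Submodule.disjoint_def.2 h1, ?_⟩
    rw [codisjoint_iff, eq_top_iff]
    intro x _
    obtain ⟨e, he, hea⟩ := h2 (P.J x + P.poisson g (P.Jhat x))
    refine Submodule.mem_sup.2 ⟨e, he, x - e, ?_, by abel⟩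
    have h3 := Submodule.sub_mem _ (P.sub_poisson_mem_twist g (P.Jhat x)) hea
    have h4 := P.J_add_Jhat x
    have h5 : x - e = (P.Jhat x : Lie E D) - P.poisson g (P.Jhat x) -
        (e - ((P.J x + P.poisson g (P.Jhat x) : P.alg) : Lie E D)) := by
      push_cast
      nth_rewrite 1 [← h4]
      abel
    rw [h5]
    exact h3

theorem IsCosetSpace.swap {P : PerfectDouble E EG EH D G H} {i : F →* D}
    {S : Submodule ℝ (Lie E D)} (h : P.IsCosetSpace EF i S) : P.swap.IsCosetSpace EF i S :=
  ⟨h.Ad_mem, h.le, h.orthogonal⟩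

/-! ### Standard dressing cosets -/

/-- The graph `{x + R x}`. -/
def graphSpace (R : P.dualAlg →ₗ[ℝ] P.alg) : Submodule ℝ (Lie E D) :=
  LinearMap.range (P.dualAlg.subtype + P.alg.subtype ∘ₗ R)

theorem mem_graphSpace {R : P.dualAlg →ₗ[ℝ] P.alg} {s : Lie E D} :
    s ∈ P.graphSpace R ↔ ∃ x : P.dualAlg, (x : Lie E D) + R x = s := Iff.rfl

theorem swap_graphSpace (R : P.dualAlg ≃ₗ[ℝ] P.alg) :
    P.swap.graphSpace R.symm.toLinearMap = P.graphSpace R.toLinearMap := by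
  ext s
  rw [mem_graphSpace, mem_graphSpace]
  constructor
  · rintro ⟨y, rfl⟩
    exact ⟨R.symm y, by simp [add_comm]⟩
  · rintro ⟨x, rfl⟩
    exact ⟨R x, by simp [add_comm]⟩

/-- Solving `(R + Π^g) x = a` is finding `e = x + R x` with `e - a ∈ Ad_g Ĝ`; isotropy of the Lie
algebra of `G` gives `⟨b | x⟩ = ⟨b | e⟩`. -/
theorem isModel_density (R : P.dualAlg ≃ₗ[ℝ] P.alg) :
    P.IsModel (P.graphSpace R.toLinearMap) (fun g => Function.Bijective (P.background R g))
      (P.density R) where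
  adm_iff g := by
    rw [P.isCompl_twist_iff, Function.Bijective, injective_iff_map_eq_zero]
    refine and_congr ⟨fun h => ?_, fun h => ?_⟩ (forall_congr' fun a => ⟨?_, ?_⟩)
    · rintro s ⟨x, rfl⟩ hs
      have h1 := h x ((P.add_mem_twist_iff g x (R x)).1 hs)
      simp [h1]
    · intro x hx
      exact (P.eq_zero_of_add_eq_zero (h _ ⟨x, rfl⟩ ((P.add_mem_twist_iff g x (R x)).2 hx))).1
    · rintro ⟨x, hx⟩
      exact ⟨_, ⟨x, rfl⟩, (P.sub_mem_twist_iff g x (R x) a).2 hx⟩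
    · rintro ⟨_, ⟨x, rfl⟩, hx⟩
      exact ⟨x, (P.sub_mem_twist_iff g x (R x) a).1 hx⟩
  density_eq g hg b a e he hea := by
    obtain ⟨x, rfl⟩ := he
    have h1 : P.background R g x = a := (P.sub_mem_twist_iff g x (R x) a).1 hea
    rw [density, ← h1, Function.leftInverse_invFun hg.1 x]
    have h2 := P.isotropicG b b.2 (R x) (R x).2
    change _ = P.form b ((x : Lie E D) + R x)
    rw [map_add, h2, add_zero]

/-- Regrouped, the condition reads `J Ad_f (x + R x) = R Ĵ Ad_f (x + R x)`, which is invariance of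
the graph. Orthogonality is `⟨γ + R γ | x + R x⟩ = ⟨x | (R + R*) γ⟩`. -/
theorem isCosetSpace_graphSpace {i : F →* D} (R : P.dualAlg ≃ₗ[ℝ] P.alg)
    (Rs : P.dualAlg →ₗ[ℝ] P.alg) (hRs : ∀ x y : P.dualAlg, P.form (R x) y = P.form x (Rs y))
    (hF : lieAlgebraOf E EF i = P.fSpace R Rs) (hc : P.Condition i R.toLinearMap) :
    P.IsCosetSpace EF i (P.graphSpace R.toLinearMap) where
  Ad_mem f s hs := by
    obtain ⟨x, rfl⟩ := hs
    refine ⟨P.Jhat (Ad E (i f) ((x : Lie E D) + R x)), ?_⟩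
    have h1 := P.J_add_Jhat (Ad E (i f) ((x : Lie E D) + R x))
    have h2 := hc f x
    have h3 : P.J (Ad E (i f) ((x : Lie E D) + R x)) =
        R (P.Jhat (Ad E (i f) ((x : Lie E D) + R x))) := by
      simp only [map_add, LinearEquiv.coe_coe] at h2 ⊢
      rw [← h2]
      abel
    rw [add_comm, h3] at h1
    exact h1
  le := by
    rw [hF]
    rintro _ ⟨x, -, rfl⟩
    exact ⟨x, rfl⟩
  orthogonal v hv s hs := by
    rw [hF] at hv
    obtain ⟨γ, hγ, rfl⟩ := hv
    obtain ⟨x, rfl⟩ := hs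
    have h1 : R γ + Rs γ = 0 := hγ
    have h2 := P.isotropicG (R γ) (R γ).2 (R x) (R x).2
    have h3 := P.isotropicH γ γ.2 x x.2
    have h4 := hRs x γ
    have h5 : P.form x ((R γ + Rs γ : P.alg) : Lie E D) = 0 := by rw [h1]; simp
    have h6 := P.form_symm (R γ) x
    have h7 := P.form_symm γ (R x)
    change P.form ((γ : Lie E D) + R γ) ((x : Lie E D) + R x) = 0
    push_cast at h5
    simp only [map_add, LinearMap.add_apply] at h5 ⊢
    linarith

/-! ### Generalized dressing cosets -/

/-- The sum of the graph of `R` and of `Ker R̂`. -/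
def genSpace (R : P.dualAlg →ₗ.[ℝ] P.alg) (Rhat : P.alg →ₗ.[ℝ] P.dualAlg) :
    Submodule ℝ (Lie E D) :=
  LinearMap.range (P.graphMap R) ⊔ (kerP Rhat).map P.alg.subtype

theorem mem_genSpace {R : P.dualAlg →ₗ.[ℝ] P.alg} {Rhat : P.alg →ₗ.[ℝ] P.dualAlg}
    {s : Lie E D} : s ∈ P.genSpace R Rhat ↔
      ∃ x : R.domain, ∃ k ∈ kerP Rhat, ((x : P.dualAlg) : Lie E D) + ((R x + k : P.alg)) = s := by
  rw [genSpace, Submodule.mem_sup]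
  constructor
  · rintro ⟨_, ⟨x, rfl⟩, _, ⟨k, hk, rfl⟩, rfl⟩
    exact ⟨x, k, hk, by simp [graphMap, LinearPMap.toFun_eq_coe, add_assoc]⟩
  · rintro ⟨x, k, hk, rfl⟩
    exact ⟨_, ⟨x, rfl⟩, _, ⟨k, hk, rfl⟩,
      by simp [graphMap, LinearPMap.toFun_eq_coe, add_assoc]⟩

theorem mem_kerP {V W : Type*} [AddCommGroup V] [Module ℝ V] [AddCommGroup W] [Module ℝ W]
    {R : V →ₗ.[ℝ] W} {x : V} : x ∈ kerP R ↔ ∃ h : x ∈ R.domain, R ⟨x, h⟩ = 0 := by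
  constructor
  · rintro ⟨y, hy, rfl⟩
    exact ⟨y.2, hy⟩
  · rintro ⟨h, hx⟩
    exact ⟨⟨x, h⟩, hx, rfl⟩

/-- For `k ∈ Ker R` put `x = R̂ y + k`. Then `y + R̂ y + k = x + R x + (y - R R̂ y)`, and the last
term is in `Ker R̂` because `R̂ R = 1` on `Im R̂`. -/
theorem swap_genSpace_le {R : P.dualAlg →ₗ.[ℝ] P.alg} {Rhat : P.alg →ₗ.[ℝ] P.dualAlg}
    (h1 : imP Rhat ≤ R.domain) (h2 : imP R ≤ Rhat.domain)
    (h3 : ∀ (x : P.dualAlg) (hx : x ∈ imP Rhat),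
      Rhat ⟨R ⟨x, h1 hx⟩, h2 (mem_imP R _)⟩ = x) :
    P.swap.genSpace Rhat R ≤ P.genSpace R Rhat := by
  intro s hs
  obtain ⟨y, k, hk, rfl⟩ := (P.swap.mem_genSpace).1 hs
  obtain ⟨hkd, hk0⟩ := mem_kerP.1 hk
  have hy := h3 (Rhat y) (mem_imP Rhat y)
  set x : R.domain := ⟨Rhat y, h1 (mem_imP Rhat y)⟩ with hx
  refine P.mem_genSpace.2 ⟨x + ⟨k, hkd⟩, (y : P.alg) - R x, ?_, ?_⟩
  · refine mem_kerP.2 ⟨Rhat.domain.sub_mem y.2 (h2 (mem_imP R x)), ?_⟩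
    have : (⟨(y : P.alg) - R x, Rhat.domain.sub_mem y.2 (h2 (mem_imP R x))⟩ : Rhat.domain) =
        y - ⟨R x, h2 (mem_imP R x)⟩ := rfl
    rw [this, LinearPMap.map_sub, hy, sub_self]
  · rw [LinearPMap.map_add, hk0, add_zero, add_sub_cancel]
    simp only [hx, Submodule.coe_add]
    abel

/-- As `ρ` fixes `Im R` and has kernel `Ker R̂`, the equation says `R x + Π^g x ≡ a` modulo `Ker
R̂`; the discrepancy is `k`. -/
theorem genAdmissible_iff {R : P.dualAlg →ₗ.[ℝ] P.alg} {Rhat : P.alg →ₗ.[ℝ] P.dualAlg}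
    {ρ : P.alg →ₗ[ℝ] P.alg} (hρ : P.IsRho R Rhat ρ) (g : G) (x : R.domain) (a : P.alg) :
    P.genBackground R ρ g x = ρ a ↔
      ∃ k ∈ kerP Rhat, ((x : P.dualAlg) : Lie E D) + ((R x + k : P.alg)) - a ∈ P.twist g := by
  obtain ⟨h1, h2, A, -, h3⟩ := hρ
  have h4 : ρ (R x) = R x := by
    have : R x ∈ LinearMap.range ρ := by
      rw [h3]; exact Submodule.mem_sup_left (mem_imP R x)
    obtain ⟨y, hy⟩ := this
    rw [← hy]
    exact DFunLike.congr_fun h1 y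
  have h5 : P.genBackground R ρ g x = ρ (R x + P.poisson g x) := by
    rw [map_add, h4]; rfl
  rw [h5, ← sub_eq_zero, ← map_sub, ← LinearMap.mem_ker, h2]
  constructor
  · intro h
    refine ⟨-(R x + P.poisson g x - a), Submodule.neg_mem _ h, ?_⟩
    rw [P.sub_mem_twist_iff]
    abel
  · rintro ⟨k, hk, hk'⟩
    rw [P.sub_mem_twist_iff] at hk'
    rw [← hk']
    convert Submodule.neg_mem _ hk using 1
    abel

theorem form_eq_of_mem_ann {Rhat : P.alg →ₗ.[ℝ] P.dualAlg} {x : P.dualAlg}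
    (hx : x ∈ P.ann (kerP Rhat)) {k : P.alg} (hk : k ∈ kerP Rhat) : P.form k x = 0 := by
  rw [P.form_symm]; exact hx k hk

/-- Replacing `ρ b` by `b` is harmless: the difference lies in `Ker R̂`, which `Dom R` annihilates.
-/
theorem isModel_genDensity {R : P.dualAlg →ₗ.[ℝ] P.alg} {Rhat : P.alg →ₗ.[ℝ] P.dualAlg}
    (hann : P.ann (kerP Rhat) = R.domain) {ρ : P.alg →ₗ[ℝ] P.alg} (hρ : P.IsRho R Rhat ρ) :
    P.IsModel (P.genSpace R Rhat) (P.GenAdmissible R ρ) (P.genDensity R ρ) where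
  adm_iff g := by
    rw [P.isCompl_twist_iff, GenAdmissible, injective_iff_map_eq_zero]
    have hle : LinearMap.range (P.genBackground R ρ g) ≤ LinearMap.range ρ := by
      rintro _ ⟨x, rfl⟩
      obtain ⟨A, -, h3⟩ := hρ.2.2
      have h4 : R x ∈ LinearMap.range ρ := by
        rw [h3]; exact Submodule.mem_sup_left (mem_imP R x)
      exact Submodule.add_mem _ h4 ⟨_, rfl⟩
    refine and_congr ⟨fun h => ?_, fun h => ?_⟩ ⟨fun h a => ?_, fun h => ?_⟩
    · intro s hs hst
      obtain ⟨x, k, hk, rfl⟩ := P.mem_genSpace.1 hs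
      have h1 : x = 0 := by
        refine h x ?_
        rw [← map_zero ρ, P.genAdmissible_iff hρ]
        exact ⟨k, hk, by simpa using hst⟩
      rw [h1] at hst ⊢
      simp only [LinearPMap.map_zero, zero_add, Submodule.coe_zero] at hst ⊢
      -- What remains is `k`, in the Lie algebra of `G` and in `Ad_g Ĝ`, whose intersection is `0`.
      rw [P.eq_zero_of_mem_twist hst]
      simp
    · intro x hx
      rw [← map_zero ρ, P.genAdmissible_iff hρ] at hx
      obtain ⟨k, hk, hxk⟩ := hx
      have h1 := h _ (P.mem_genSpace.2 ⟨x, k, hk, rfl⟩) (by simpa using hxk)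
      exact Subtype.ext (P.eq_zero_of_add_eq_zero h1).1
    · have h1 : ρ a ∈ LinearMap.range (P.genBackground R ρ g) := by rw [h]; exact ⟨a, rfl⟩
      obtain ⟨x, hx⟩ := h1
      obtain ⟨k, hk, hxk⟩ := (P.genAdmissible_iff hρ g x a).1 hx
      exact ⟨_, P.mem_genSpace.2 ⟨x, k, hk, rfl⟩, hxk⟩
    · refine le_antisymm hle ?_
      rintro _ ⟨a, rfl⟩
      obtain ⟨e, he, hea⟩ := h a
      obtain ⟨x, k, hk, rfl⟩ := P.mem_genSpace.1 he
      exact ⟨x, (P.genAdmissible_iff hρ g x a).2 ⟨k, hk, hea⟩⟩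
  density_eq g hg b a e he hea := by
    obtain ⟨x, k, hk, rfl⟩ := P.mem_genSpace.1 he
    have h1 := (P.genAdmissible_iff hρ g x a).2 ⟨k, hk, hea⟩
    rw [genDensity, ← h1, Function.leftInverse_invFun hg.1 x, map_add,
      P.isotropicG b b.2 _ (R x + k).2, add_zero]
    have h2 : b - ρ b ∈ kerP Rhat := by
      rw [← hρ.2.1, LinearMap.mem_ker, map_sub, sub_eq_zero]
      exact (DFunLike.congr_fun hρ.1 b).symm
    have h3 := P.form_eq_of_mem_ann (x := x) (by rw [hann]; exact x.2) h2
    push_cast at h3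
    rw [map_sub, LinearMap.sub_apply, sub_eq_zero] at h3
    exact h3.symm

theorem Ad_mem_range_graphMap {i : F →* D} {R : P.dualAlg →ₗ.[ℝ] P.alg}
    (h : P.PartialCondition i R) (f : F) {s : Lie E D} (hs : s ∈ LinearMap.range (P.graphMap R)) :
    Ad E (i f) s ∈ LinearMap.range (P.graphMap R) := by
  obtain ⟨x, rfl⟩ := hs
  obtain ⟨h1, h2⟩ := h f x
  refine ⟨⟨_, h1⟩, ?_⟩
  have h3 := P.J_add_Jhat (Ad E (i f) (((x : P.dualAlg) : Lie E D) + R x))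
  rw [map_add, map_add, map_add, h2] at h3
  exact ((add_comm _ _).trans h3).trans (map_add _ _ _).symm

/-- The two conditions make the graphs of `R` and `R̂` invariant. The summand `Ker R̂` need not be
invariant alone, but it lies in the graph of `R̂`, which is contained in `S`. The extra
orthogonality relations come from `Dom R` annihilating `Ker R̂`. -/
theorem isCosetSpace_genSpace {i : F →* D} (X : P.OperatorPair)
    (hF : lieAlgebraOf E EF i = X.fSpace) (h : P.PartialCondition i X.R)
    (hh : P.swap.PartialCondition i X.Rhat) :
    P.IsCosetSpace EF i (P.genSpace X.R X.Rhat) where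
  Ad_mem f s hs := by
    obtain ⟨s₁, hs₁, s₂, ⟨k, hk, rfl⟩, rfl⟩ := Submodule.mem_sup.1 hs
    rw [map_add]
    refine Submodule.add_mem _ (Submodule.mem_sup_left (P.Ad_mem_range_graphMap h f hs₁)) ?_
    obtain ⟨hkd, hk0⟩ := mem_kerP.1 hk
    refine P.swap_genSpace_le X.im_hat_le X.im_le X.left_inv (Submodule.mem_sup_left
      (P.swap.Ad_mem_range_graphMap hh f ⟨⟨k, hkd⟩, ?_⟩))
    change (k : Lie E D) + ((X.Rhat ⟨k, hkd⟩ : P.dualAlg) : Lie E D) = k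
    rw [hk0]
    simp
  le := by
    rw [hF, OperatorPair.fSpace, sup_comm]
    exact sup_le_sup_right LinearMap.map_le_range _
  orthogonal v hv s hs := by
    obtain ⟨x, k, hk, rfl⟩ := P.mem_genSpace.1 hs
    have hann : ∀ (y : X.R.domain), ∀ k ∈ kerP X.Rhat, P.form y.1 k = 0 := fun y => by
      have : y.1 ∈ P.ann (kerP X.Rhat) := by rw [X.ann_ker_hat]; exact y.2
      exact this
    rw [hF] at hv
    obtain ⟨_, ⟨l, hl, rfl⟩, _, ⟨γ, hγ, rfl⟩, rfl⟩ := Submodule.mem_sup.1 hv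
    obtain ⟨hγd, hγ0⟩ := mem_kerP.1 (Submodule.mem_comap.1 hγ)
    have h1 : X.R γ + X.Rs ⟨γ, hγd.2⟩ = 0 := hγ0
    have h2 := X.isAdjoint.adjoint x ⟨γ, hγd.2⟩
    have h3 : P.form x.1 ((X.R γ + X.Rs ⟨γ, hγd.2⟩ : P.alg) : Lie E D) = 0 := by
      rw [h1]; simp
    have h4 := P.isotropicG (X.R γ) (X.R γ).2 _ (X.R x + k).2
    have h5 := P.isotropicH γ.1 γ.1.2 x.1 x.1.2
    have h6 := P.isotropicG l l.2 _ (X.R x + k).2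
    have h7 := hann x l hl
    have h8 := hann γ k hk
    have h9 := P.form_symm (X.R γ) x.1
    have h10 := P.form_symm γ.1 (X.R x)
    have h11 := P.form_symm l x.1
    change P.form ((l : Lie E D) + ((γ.1 : Lie E D) + X.R γ)) _ = 0
    push_cast at *
    simp only [map_add, LinearMap.add_apply] at *
    linarith

theorem swap_genSpace (X : P.OperatorPair) :
    P.swap.genSpace X.Rhat X.R = P.genSpace X.R X.Rhat :=
  le_antisymm (P.swap_genSpace_le X.im_hat_le X.im_le X.left_inv)
    (P.swap.swap_genSpace_le X.im_le X.im_hat_le X.right_inv)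

end PerfectDouble

end Cosets

/-! ### Sfetsos' models: the same subspaces in dual bases. -/

section Sfetsos

variable {E EG EH EF : Type*}
  [NormedAddCommGroup E] [NormedSpace ℝ E] [NormedAddCommGroup EG] [NormedSpace ℝ EG]
  [NormedAddCommGroup EH] [NormedSpace ℝ EH] [NormedAddCommGroup EF] [NormedSpace ℝ EF]
  {D G H F : Type*}
  [TopologicalSpace D] [ChartedSpace E D] [Group D]
  [TopologicalSpace G] [ChartedSpace EG G] [Group G]
  [TopologicalSpace H] [ChartedSpace EH H] [Group H]
  [TopologicalSpace F] [ChartedSpace EF F] [Group F]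
  [FiniteDimensional ℝ E]
  [LieGroup 𝓘(ℝ, E) ∞ D] [LieGroup 𝓘(ℝ, EG) ∞ G] [LieGroup 𝓘(ℝ, EH) ∞ H]
  [LieGroup 𝓘(ℝ, EF) ∞ F]

namespace PerfectDouble

variable (P : PerfectDouble E EG EH D G H)

/-- The vectors `d N` detect equality modulo `Ker R̂`, so pairing `R x + Π^g x ≡ a` with each of
them loses nothing and gives a linear system for the coordinates of `x`, as a row vector. -/
theorem genSpace_solve_iff {ν : Type*} [Fintype ν] {R : P.dualAlg →ₗ.[ℝ] P.alg}
    {Rhat : P.alg →ₗ.[ℝ] P.dualAlg} (d : Module.Basis ν ℝ R.domain)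
    (hN : ∀ y : P.alg, y ∈ kerP Rhat ↔ ∀ M, P.form y (d M : P.dualAlg) = 0)
    {O : G → Matrix ν ν ℝ} (hO : ∀ g M N, O g M N = P.form (R (d M)) (d N : P.dualAlg) +
      P.form (P.poisson g (d M)) (d N : P.dualAlg)) (g : G) (x : R.domain) (a : P.alg) :
    (∃ k ∈ kerP Rhat, ((x : P.dualAlg) : Lie E D) + ((R x + k : P.alg)) - a ∈ P.twist g) ↔
      Matrix.vecMul (d.repr x) (O g) = fun N => P.form a (d N : P.dualAlg) := by
  have h1 : ∀ N, Matrix.vecMul (d.repr x) (O g) N =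
      P.form (R x + P.poisson g x : P.alg) (d N : P.dualAlg) := by
    intro N
    let Λ : R.domain →ₗ[ℝ] ℝ := (P.form.flip (d N : P.dualAlg)) ∘ₗ P.alg.subtype ∘ₗ
      (R.toFun + P.poisson g ∘ₗ R.domain.subtype)
    have h2 : ∀ y, Λ y = P.form (R y + P.poisson g y : P.alg) (d N : P.dualAlg) := fun y => rfl
    rw [← h2]
    conv_rhs => rw [← d.sum_repr x]
    rw [map_sum]
    simp only [Matrix.vecMul, dotProduct]
    refine Finset.sum_congr rfl fun M _ => ?_
    rw [map_smul, smul_eq_mul, h2, hO]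
    push_cast
    rw [map_add, LinearMap.add_apply]
  have h3 : (Matrix.vecMul (d.repr x) (O g) = fun N => P.form a (d N : P.dualAlg)) ↔
      a - (R x + P.poisson g x) ∈ kerP Rhat := by
    rw [hN, funext_iff]
    refine forall_congr' fun N => ?_
    rw [h1, Submodule.coe_sub, map_sub, LinearMap.sub_apply, sub_eq_zero, eq_comm]
  rw [h3]
  constructor
  · rintro ⟨k, hk, hxk⟩
    rw [P.sub_mem_twist_iff] at hxk
    rw [← hxk]
    convert hk using 1
    abel
  · intro h
    refine ⟨_, h, ?_⟩
    rw [P.sub_mem_twist_iff]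
    abel

/-- A model given by a matrix in a basis of `Dom R`. -/
theorem isModel_matrixDensity {ν : Type*} [Fintype ν] [DecidableEq ν]
    {R : P.dualAlg →ₗ.[ℝ] P.alg}
    {Rhat : P.alg →ₗ.[ℝ] P.dualAlg} (d : Module.Basis ν ℝ R.domain)
    (hN : ∀ y : P.alg, y ∈ kerP Rhat ↔ ∀ M, P.form y (d M : P.dualAlg) = 0)
    (hsurj : ∀ c : ν → ℝ, ∃ a : P.alg, ∀ M, P.form a (d M : P.dualAlg) = c M)
    {O : G → Matrix ν ν ℝ} (hO : ∀ g M N, O g M N = P.form (R (d M)) (d N : P.dualAlg) +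
      P.form (P.poisson g (d M)) (d N : P.dualAlg)) :
    P.IsModel (P.genSpace R Rhat) (fun g => IsUnit (O g).det)
      (P.matrixDensity (fun M => (d M : P.dualAlg)) O) where
  adm_iff g := by
    have key := P.genSpace_solve_iff d hN hO g
    rw [P.isCompl_twist_iff]
    constructor
    · intro hu
      have hu' : IsUnit (O g) := (Matrix.isUnit_iff_isUnit_det _).2 hu
      constructor
      · intro s hs hst
        obtain ⟨x, k, hk, rfl⟩ := P.mem_genSpace.1 hs
        have h1 := (key x 0).1 ⟨k, hk, by simpa using hst⟩
        have h2 : Matrix.vecMul (d.repr x) (O g) = Matrix.vecMul 0 (O g) := by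
          rw [h1, Matrix.zero_vecMul]; funext N; simp
        have h3 := Matrix.vecMul_injective_of_isUnit hu' h2
        have h4 : x = 0 := by
          rw [← d.repr.map_eq_zero_iff]
          exact DFunLike.coe_injective h3
        rw [h4] at hst ⊢
        simp only [LinearPMap.map_zero, zero_add, Submodule.coe_zero] at hst ⊢
        rw [P.eq_zero_of_mem_twist hst]
        simp
      · intro a
        have h1 := (key (d.equivFun.symm (Matrix.vecMul
          (fun N => P.form a (d N : P.dualAlg)) (O g)⁻¹)) a).2 (by
            rw [← d.equivFun_apply, LinearEquiv.apply_symm_apply, Matrix.vecMul_vecMul,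
              Matrix.nonsing_inv_mul _ hu, Matrix.vecMul_one])
        obtain ⟨k, hk, hxk⟩ := h1
        exact ⟨_, P.mem_genSpace.2 ⟨_, k, hk, rfl⟩, hxk⟩
    · rintro ⟨-, h2⟩
      -- For a square matrix surjectivity suffices, and every right-hand side is the vector of
      -- pairings of some `a`.
      rw [← Matrix.isUnit_iff_isUnit_det, ← Matrix.vecMul_surjective_iff_isUnit]
      intro c
      obtain ⟨a, ha⟩ := hsurj c
      obtain ⟨e, he, hea⟩ := h2 a
      obtain ⟨x, k, hk, rfl⟩ := P.mem_genSpace.1 he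
      exact ⟨_, ((key x a).1 ⟨k, hk, hea⟩).trans (funext ha)⟩
  density_eq g hg b a e he hea := by
    obtain ⟨x, k, hk, rfl⟩ := P.mem_genSpace.1 he
    have h1 := (P.genSpace_solve_iff d hN hO g x a).1 ⟨k, hk, hea⟩
    have h2 : (d.repr x : ν → ℝ) =
        Matrix.vecMul (fun N => P.form a (d N : P.dualAlg)) (O g)⁻¹ := by
      rw [← h1, Matrix.vecMul_vecMul, Matrix.mul_nonsing_inv _ hg, Matrix.vecMul_one]
    rw [map_add, P.isotropicG b b.2 _ (R x + k).2, add_zero]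
    let Λ : R.domain →ₗ[ℝ] ℝ := (P.form b) ∘ₗ P.dualAlg.subtype ∘ₗ R.domain.subtype
    change _ = Λ x
    rw [← d.sum_repr x, map_sum, matrixDensity, Finset.sum_comm]
    refine Finset.sum_congr rfl fun N _ => ?_
    rw [map_smul, smul_eq_mul, h2, Matrix.vecMul, dotProduct, Finset.sum_mul]
    rfl

theorem form_sum_left {ν : Type*} [Fintype ν] (c : ν → ℝ) (y : ν → P.alg) (x : P.dualAlg) :
    P.form (∑ M, c M • y M : P.alg) x = ∑ M, c M * P.form (y M) x := by
  simp

section Operators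

variable {P} {p q : ℕ} {X : P.OperatorPair}
  {t : Module.Basis (Fin p ⊕ Fin q) ℝ P.alg} {T : Module.Basis (Fin p ⊕ Fin q) ℝ P.dualAlg}
  {Rm : Matrix (Fin q) (Fin q) ℝ}

theorem form_basis_right
    (hdual : ∀ i j, P.form (t i) (T j) = if i = j then 1 else 0) (y : P.alg) (j) :
    P.form y (T j) = t.repr y j := by
  conv_lhs => rw [← t.sum_repr y]
  rw [P.form_sum_left]
  simp [hdual]

theorem form_basis_left
    (hdual : ∀ i j, P.form (t i) (T j) = if i = j then 1 else 0) (x : P.dualAlg) (j) :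
    P.form x (t j) = T.repr x j :=
  form_basis_right (P := P.swap) (t := T) (T := t)
    (fun i j => by rw [P.form_symm, hdual]; simp [eq_comm]) x j

theorem mem_span_basis {V : Type*} [AddCommGroup V] [Module ℝ V] {κ ν : Type*}
    (b : Module.Basis κ ℝ V) (j : ν → κ) (x : V) :
    x ∈ Submodule.span ℝ (Set.range fun M => b (j M)) ↔ ∀ k, k ∉ Set.range j → b.repr x k = 0 := by
  have : (Set.range fun M => b (j M)) = b '' Set.range j := (Set.range_comp b j)
  rw [this, b.mem_span_image]
  constructor
  · intro h k hk
    by_contra hne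
    exact hk (h (Finsupp.mem_support_iff.2 hne))
  · intro h k hk
    by_contra hne
    exact Finsupp.mem_support_iff.1 hk (h k hne)

theorem mem_span_inl_iff {V : Type*} [AddCommGroup V] [Module ℝ V]
    (b : Module.Basis (Fin p ⊕ Fin q) ℝ V) (x : V) :
    x ∈ Submodule.span ℝ (Set.range fun a => b (Sum.inl a)) ↔ ∀ M, b.repr x (Sum.inr M) = 0 := by
  rw [mem_span_basis]
  simp

theorem mem_span_inr_iff {V : Type*} [AddCommGroup V] [Module ℝ V]
    (b : Module.Basis (Fin p ⊕ Fin q) ℝ V) (x : V) :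
    x ∈ Submodule.span ℝ (Set.range fun M => b (Sum.inr M)) ↔ ∀ a, b.repr x (Sum.inl a) = 0 := by
  rw [mem_span_basis]
  simp

/-- The inclusion from left to right holds because the annihilator of the `t_α` is spanned by the
`T^M`; the other is `Im R̂ ⊂ Dom R`. -/
theorem OperatorPair.IsSfetsos.domain_eq (h : X.IsSfetsos t T Rm) :
    X.R.domain = Submodule.span ℝ (Set.range fun M => T (Sum.inr M)) := by
  refine le_antisymm ?_ (h.im_hat_eq_span ▸ X.im_hat_le)
  intro x hx
  rw [mem_span_inr_iff]
  intro a
  rw [← form_basis_left h.dual]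
  rw [← X.ann_ker_hat] at hx
  refine hx _ ?_
  rw [h.ker_hat_eq_span]
  exact Submodule.subset_span ⟨a, rfl⟩

theorem OperatorPair.IsSfetsos.isModel (h : X.IsSfetsos t T Rm) :
    P.IsModel (P.genSpace X.R X.Rhat) (fun g => IsUnit (P.sfetsosMatrix T Rm g).det)
      (P.matrixDensity (fun M => T (Sum.inr M)) (P.sfetsosMatrix T Rm)) := by
  have hli : LinearIndependent ℝ (fun M : Fin q => T (Sum.inr M)) :=
    T.linearIndependent.comp _ Sum.inr_injective
  let d : Module.Basis (Fin q) ℝ X.R.domain :=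
    (Module.Basis.span hli).map (LinearEquiv.ofEq _ _ h.domain_eq.symm)
  have hd : ∀ M, (d M : P.dualAlg) = T (Sum.inr M) := fun M => by
    simp [d, Module.Basis.span_apply]
  have hmod := P.isModel_matrixDensity (R := X.R) (Rhat := X.Rhat) d
    (O := P.sfetsosMatrix T Rm) ?_ ?_ ?_
  · simpa only [hd] using hmod
  · intro y
    rw [h.ker_hat_eq_span, mem_span_inl_iff]
    simp only [hd, form_basis_right h.dual]
  · intro c
    refine ⟨∑ M, c M • t (Sum.inr M), fun M => ?_⟩
    rw [P.form_sum_left, hd]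
    simp [h.dual]
  · intro g M N
    obtain ⟨hM, hRM⟩ := h.matrix M
    have h1 : d M = ⟨T (Sum.inr M), hM⟩ := Subtype.ext (hd M)
    rw [hd, hd, h1, hRM, P.form_sum_left]
    simp [sfetsosMatrix, poissonMatrix, h.dual]

theorem OperatorPair.IsSfetsos.domain_hat_eq (h : X.IsSfetsos t T Rm) : X.Rhat.domain = ⊤ := by
  rw [← X.ann_ker, h.ker_eq_bot, eq_top_iff]
  intro y _ k hk
  rw [(Submodule.mem_bot ℝ).1 hk]
  simp

/-- Applying `R̂` to `R T^M = ∑ R^{MN} t_N` and using `R̂ R = 1` shows that the matrix of `R̂` on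
the `t_M` is a right inverse of the square matrix `R^{MN}`. -/
theorem OperatorPair.IsSfetsos.form_hat_inr (h : X.IsSfetsos t T Rm) (M N : Fin q)
    (hM : t (Sum.inr M) ∈ X.Rhat.domain) :
    P.form (X.Rhat ⟨t (Sum.inr M), hM⟩) (t (Sum.inr N)) = Rm⁻¹ M N := by
  have htop := h.domain_hat_eq
  let τ : Fin q → X.Rhat.domain := fun M => ⟨t (Sum.inr M), htop ▸ Submodule.mem_top⟩
  let B : Matrix (Fin q) (Fin q) ℝ := Matrix.of fun M N => P.form (X.Rhat (τ M)) (t (Sum.inr N))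
  have hB : Rm * B = 1 := by
    ext M K
    obtain ⟨hM, hRM⟩ := h.matrix M
    have hT : T (Sum.inr M) ∈ imP X.Rhat := by
      rw [h.im_hat_eq_span]; exact Submodule.subset_span ⟨M, rfl⟩
    have h1 := X.left_inv _ hT
    have h2 : (⟨X.R ⟨T (Sum.inr M), X.im_hat_le hT⟩, X.im_le (mem_imP X.R _)⟩ : X.Rhat.domain) =
        ∑ N, Rm M N • τ N := by
      refine Subtype.ext ?_
      rw [Submodule.coe_sum]
      exact hRM
    have h3 : X.Rhat (∑ N, Rm M N • τ N) = ∑ N, Rm M N • X.Rhat (τ N) := by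
      simp only [← LinearPMap.toFun_eq_coe, map_sum, map_smul]
    rw [h2, h3] at h1
    have h4 := congrArg (fun x : P.dualAlg => P.form x (t (Sum.inr K))) h1
    beta_reduce at h4
    rw [P.swap.form_sum_left, form_basis_left h.dual] at h4
    rw [Matrix.mul_apply]
    refine h4.trans ?_
    simp [Matrix.one_apply, Finsupp.single_apply]
  have := Matrix.inv_eq_right_inv hB
  rw [this]
  rfl

theorem OperatorPair.IsSfetsos.isModel_dual (h : X.IsSfetsos t T Rm) :
    P.swap.IsModel (P.swap.genSpace X.Rhat X.R)
      (fun g => IsUnit (P.sfetsosDualMatrix t Rm g).det)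
      (P.swap.matrixDensity t (P.sfetsosDualMatrix t Rm)) := by
  have htop := h.domain_hat_eq
  let d : Module.Basis (Fin p ⊕ Fin q) ℝ X.Rhat.domain :=
    t.map (LinearEquiv.ofTop _ htop).symm
  have hd : ∀ M, (d M : P.alg) = t M := fun M => by simp [d]
  have hmod := P.swap.isModel_matrixDensity (R := X.Rhat) (Rhat := X.R) d
    (O := P.sfetsosDualMatrix t Rm) ?_ ?_ ?_
  · simpa only [hd] using hmod
  · intro y
    rw [h.ker_eq_bot, Submodule.mem_bot]
    simp only [hd, form_basis_left h.dual]
    rw [← T.repr.map_eq_zero_iff, Finsupp.ext_iff]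
    rfl
  · intro c
    refine ⟨∑ M, c M • T M, fun M => ?_⟩
    rw [P.swap.form_sum_left, hd]
    simp [P.form_symm (T _) (t _), h.dual]
  · intro g i j
    -- The rows `α` vanish because `R̂` kills `t_α`; the block `Mβ` vanishes because `Im R̂` is
    -- spanned by the `T^N`, which pair to zero with `t_β`.
    have h0 : ∀ i j, P.form (X.Rhat (d i)) (t j) = Matrix.fromBlocks 0 0 0 Rm⁻¹ i j := by
      rintro (α | M) j
      · have h1 : t (Sum.inl α) ∈ kerP X.Rhat := by
          rw [h.ker_hat_eq_span]; exact Submodule.subset_span ⟨α, rfl⟩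
        obtain ⟨h2, h3⟩ := mem_kerP.1 h1
        have h4 : d (Sum.inl α) = ⟨t (Sum.inl α), h2⟩ := Subtype.ext (hd _)
        rw [h4, h3]
        cases j <;> simp
      · cases j with
        | inl β =>
          have h1 := mem_imP X.Rhat (d (Sum.inr M))
          rw [h.im_hat_eq_span, mem_span_inr_iff] at h1
          rw [form_basis_left h.dual, h1]
          simp
        | inr N =>
          have h4 : d (Sum.inr M) = ⟨t (Sum.inr M), htop ▸ Submodule.mem_top⟩ :=
            Subtype.ext (hd _)
          rw [h4, h.form_hat_inr]
          simp
    rw [hd, hd, h0]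
    simp [sfetsosDualMatrix, poissonMatrix, add_comm]

theorem OperatorPair.IsSfetsos.fSpace_eq (h : X.IsSfetsos t T Rm) :
    X.fSpace = (kerP X.Rhat).map P.alg.subtype := by
  rw [OperatorPair.fSpace, h.ker_add_eq_bot, Submodule.comap_bot, Submodule.ker_subtype,
    Submodule.map_bot, sup_bot_eq]

end Operators

end PerfectDouble

end Sfetsos

end

end DressingCosets

/-! ### Gauge invariance of the models and of their duals. -/

open DressingCosets in
theorem mainTheorem3
    {E EG EH EF : Type*}
    [NormedAddCommGroup E] [NormedSpace ℝ E] [FiniteDimensional ℝ E]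
    [NormedAddCommGroup EG] [NormedSpace ℝ EG]
    [NormedAddCommGroup EH] [NormedSpace ℝ EH]
    [NormedAddCommGroup EF] [NormedSpace ℝ EF]
    {D G H F : Type*}
    [TopologicalSpace D] [ChartedSpace E D] [Group D] [LieGroup 𝓘(ℝ, E) ∞ D]
    [TopologicalSpace G] [ChartedSpace EG G] [Group G] [LieGroup 𝓘(ℝ, EG) ∞ G]
    [TopologicalSpace H] [ChartedSpace EH H] [Group H] [LieGroup 𝓘(ℝ, EH) ∞ H]
    [TopologicalSpace F] [ChartedSpace EF F] [Group F] [LieGroup 𝓘(ℝ, EF) ∞ F]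
    (P : PerfectDouble E EG EH D G H)
    (i : F →* D) (hi : IsLieSubgroup E EF i) :
    -- standard dressing cosets: the model on `G` and the dual model on `Ĝ`
    (∀ (R : P.dualAlg ≃ₗ[ℝ] P.alg) (Rs : P.dualAlg →ₗ[ℝ] P.alg),
      (∀ x y : P.dualAlg, P.form (R x) y = P.form x (Rs y)) →
      lieAlgebraOf E EF i = P.fSpace R Rs →
      P.Condition i R →
        P.GaugeInvariant (EF := EF) i
          (fun g => Function.Bijective (P.background R g)) (P.density R) ∧
        P.swap.GaugeInvariant (EF := EF) i
          (fun g => Function.Bijective (P.swap.background R.symm g)) (P.swap.density R.symm)) ∧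
    -- generalized dressing cosets: the model on `G` and the dual model on `Ĝ`
    (∀ X : P.OperatorPair,
      lieAlgebraOf E EF i = X.fSpace →
      P.PartialCondition i X.R →
      P.swap.PartialCondition i X.Rhat →
        (∀ ρ : P.alg →ₗ[ℝ] P.alg, P.IsRho X.R X.Rhat ρ →
          P.GaugeInvariant (EF := EF) i (P.GenAdmissible X.R ρ) (P.genDensity X.R ρ)) ∧
        (∀ ρ : P.dualAlg →ₗ[ℝ] P.dualAlg, P.swap.IsRho X.Rhat X.R ρ →
          P.swap.GaugeInvariant (EF := EF) i
            (P.swap.GenAdmissible X.Rhat ρ) (P.swap.genDensity X.Rhat ρ))) ∧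
    -- the model of Sfetsos on `G` and its dual on `Ĝ`
    (∀ (p q : ℕ) (X : P.OperatorPair)
      (t : Module.Basis (Fin p ⊕ Fin q) ℝ P.alg) (T : Module.Basis (Fin p ⊕ Fin q) ℝ P.dualAlg)
      (Rm : Matrix (Fin q) (Fin q) ℝ),
      X.IsSfetsos t T Rm →
      lieAlgebraOf E EF i = (kerP X.Rhat).map P.alg.subtype →
      P.PartialCondition i X.R →
      P.swap.PartialCondition i X.Rhat →
        P.GaugeInvariant (EF := EF) i
          (fun g => IsUnit (P.sfetsosMatrix T Rm g).det)
          (P.matrixDensity (fun M => T (Sum.inr M)) (P.sfetsosMatrix T Rm)) ∧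
        P.swap.GaugeInvariant (EF := EF) i
          (fun g => IsUnit (P.sfetsosDualMatrix t Rm g).det)
          (P.swap.matrixDensity t (P.sfetsosDualMatrix t Rm))) := by
  refine ⟨?_, ?_, ?_⟩
  · intro R Rs hRs hF hc
    have hS := P.isCosetSpace_graphSpace R Rs hRs hF hc
    refine ⟨(P.isModel_density R).gaugeInvariant P hi hS, ?_⟩
    have hm := P.swap.isModel_density R.symm
    -- The graph of `R⁻¹` is the graph of `R`, and being a coset space does not refer to the choice
    -- between `G` and `Ĝ`; so the dual model needs no new verification.
    rw [P.swap_graphSpace R] at hm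
    exact hm.gaugeInvariant P.swap hi hS.swap
  · intro X hF hc hch
    have hS := P.isCosetSpace_genSpace X hF hc hch
    refine ⟨fun ρ hρ => (P.isModel_genDensity X.ann_ker_hat hρ).gaugeInvariant P hi hS,
      fun ρ hρ => ?_⟩
    have hm := P.swap.isModel_genDensity X.ann_ker hρ
    rw [P.swap_genSpace X] at hm
    exact hm.gaugeInvariant P.swap hi hS.swap
  · intro p q X t T Rm h hF hc hch
    have hS := P.isCosetSpace_genSpace X (hF.trans h.fSpace_eq.symm) hc hch
    refine ⟨h.isModel.gaugeInvariant P hi hS, ?_⟩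
    have hm := h.isModel_dual
    rw [P.swap_genSpace X] at hm
    exact hm.gaugeInvariant P.swap hi hS.swap
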